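/- Let $\gamma:S^1=\mathbb R/\mathbb Z\to\mathbb R^3$ be a smooth regular closed curve with unit tangent $T=\gamma'/|\gamma'|$, and let $\omega$ be the area form of $S^2$. A *framing* of $\gamma$ is a smooth unit normal field $n$ along $\gamma$; it defines a loop $\phi=(e_1,e_2,e_3)=(T,n,T\times n):S^1\to SO(3)$ and the correction term $\tau_\phi=\frac1{2\pi}\int_{S^1}\phi^*(de_3\cdot e_2)$. A *swaddling map* is a smooth map $\beta:D^2\to S^2$ of the closed disc with $\beta(e^{2\pi i s})=T(s)$; its correction term is $\tau_\beta=\frac1{2\pi}\int_{D^2}\beta^*\omega$. Then: 1. If $\phi$ is null-homotopic as a loop in $SO(3)$, then for every swaddling map $\beta$ the areas $2\pi\tau_\beta$ and $2\pi\tau_\phi$ are equal modulo $4\pi$: $2\pi\tau_\beta+4\pi k=2\pi\tau_\phi$ for some $k\in\mathbb Z$. 2. Every multiple of $4\pi$ occurs. For every null-homotopic framing $\phi$ and every $k\in\mathbb Z$ there is a swaddling map $\beta$ with $2\pi\tau_\beta+4\pi k=2\pi\tau_\phi$ (in particular one with $2\pi\tau_\beta+4\pi=2\pi\tau_\phi$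 and one with $\tau_\beta=\tau_\phi$); and for every swaddling map $\beta$ and every $k\in\mathbb Z$ there is a null-homotopic framing $\phi$ with $2\pi\tau_\beta+4\pi k=2\pi\tau_\phi$. 3. For every framing $\phi$ and swaddling map $\beta$, there is a continuous $\sigma:D^2\to SO(3)$ with $e_1\circ\sigma=\beta$ and $\sigma(e^{2\pi is})=\phi(s)$ if and only if $\phi$ is null-homotopic in $SO(3)$ and $\tau_\beta=\tau_\phi$. 4. Suppose moreover that $\gamma$ is injective on $S^1$, let $\Phi(x,y)=\frac{\gamma(y)-\gamma(x)}{|\gamma(y)-\gamma(x)|}$ be its Gauss map on $C_2(S^1)=\{(x,y)\in S^1\times S^1: x\ne y\}$, and compactify $C_2(S^1)$ to an annulus on whose boundary circles $\Phi$ becomes $\pm T$. (a) For every framing $\phi$, glue to this annulus the cylinder $S^1\times[0,\pi]$, mapped to $S^2$ by $c(s,\theta)=-\cos\theta\,T(s)+\sin\theta\,n(s)$. The degree $\frac1{4\pi}\bigl(\int_{C_2(S^1)}\Phi^*\omega+\int_{S^1\times[0,\pi]}c^*\omega\bigr)$ of the resulting map from the torus to $S^2$ is an integer, and $\phi$ is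 null-homotopic in $SO(3)$ if and only if it is odd. (b) For every swaddling map $\beta$, glue to the annulus two discs, mapped by $\beta$ and $-\beta$. The degree $\frac1{4\pi}\bigl(\int_{C_2(S^1)}\Phi^*\omega-\int_{D^2}\beta^*\omega+\int_{D^2}(-\beta)^*\omega\bigr)$ of the resulting antipodally equivariant map from the sphere to $S^2$ is an odd integer; that is, the induced map $\mathbb{RP}^2\to\mathbb{RP}^2$ has mod 2 degree $1$. -/

import Mathlib

open scoped Matrix ContDiff

noncomputable section

/-- The model of `ℝ³`: only its standard dot product `⬝ᵥ` and cross product `⨯₃` are used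
(never the sup norm of the function type). -/
abbrev R3 : Type := Fin 3 → ℝ

/-- The group `SO(3)`, with the topology induced from the space of matrices. The rows of an element
are regarded as a positively oriented orthonormal frame `(e₁, e₂, e₃)`. -/
abbrev SO3 : Type := Matrix.specialOrthogonalGroup (Fin 3) ℝ

/-- The direction `v / |v|` of a nonzero vector, for the Euclidean length `|v|`. -/
def unitDir (v : R3) : R3 := (Real.sqrt (v ⬝ᵥ v))⁻¹ • v

/-- The triple product `det (a, b, c)`. Its restriction `ω_p (u, v) = det (p, u, v)` to tangent
vectors of the unit sphere is the area form of the sphere, oriented by the outward normal. -/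
def triple (a b c : R3) : ℝ := a ⬝ᵥ (b ⨯₃ c)

/-- The coefficient at `da ∧ db` of the pull-back `f^* ω` of the area form under a map `f` from
a region of the `(a, b)`-plane to the unit sphere. -/
def pullbackArea (f : ℝ → ℝ → R3) (a b : ℝ) : ℝ :=
  triple (f a b) (deriv (fun x => f x b) a) (deriv (fun y => f a y) b)

/-- A smooth regular closed space curve, parametrized by the circle `ℝ / ℤ`. -/
structure ClosedCurve where
  toFun : ℝ → R3
  smooth : ContDiff ℝ ∞ toFun
  periodic : Function.Periodic toFun 1
  regular : ∀ s, deriv toFun s ≠ 0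

namespace ClosedCurve

/-- The unit tangent vector. -/
def tangent (γ : ClosedCurve) (s : ℝ) : R3 := unitDir (deriv γ.toFun s)

/-- The curve is a knot: it is injective on the circle `ℝ / ℤ`. -/
def IsKnot (γ : ClosedCurve) : Prop := Set.InjOn γ.toFun (Set.Ico 0 1)

/-- The Gauss map of the curve: the direction from `γ(x)` to `γ(y)`, for distinct points. -/
def gaussMap (γ : ClosedCurve) (x y : ℝ) : R3 := unitDir (γ.toFun y - γ.toFun x)

/-- The integral over the configuration space `C₂(S¹)` of the pull-back of the area form under the
Gauss map (the diagonal is a null set). -/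
def gaussIntegral (γ : ClosedCurve) : ℝ :=
  ∫ x in (0 : ℝ)..1, ∫ y in (0 : ℝ)..1, pullbackArea γ.gaussMap x y

end ClosedCurve

/-- A framing of a closed curve: a smooth unit normal vector field along it. -/
structure Framing (γ : ClosedCurve) where
  normal : ℝ → R3
  smooth : ContDiff ℝ ∞ normal
  periodic : Function.Periodic normal 1
  unit : ∀ s, normal s ⬝ᵥ normal s = 1
  orthogonal : ∀ s, γ.tangent s ⬝ᵥ normal s = 0

/-- A swaddling map of a closed curve: a smooth map of the closed unit disc to the unit sphere
which restricts to the unit tangent on the boundary circle. Only the values on the closed disc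
matter. -/
structure Swaddling (γ : ClosedCurve) where
  toFun : ℂ → R3
  smooth : ContDiffOn ℝ ∞ toFun (Metric.closedBall 0 1)
  unit : ∀ z ∈ Metric.closedBall (0 : ℂ) 1, toFun z ⬝ᵥ toFun z = 1
  boundary : ∀ s : ℝ, toFun (Complex.exp (2 * Real.pi * s * Complex.I)) = γ.tangent s

theorem unitDir_dot_self {v : R3} (hv : v ≠ 0) : unitDir v ⬝ᵥ unitDir v = 1 := by
  have h0 : 0 < v ⬝ᵥ v := by
    refine lt_of_le_of_ne ?_ (fun h => hv (dotProduct_self_eq_zero.1 h.symm))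
    exact Finset.sum_nonneg fun i _ => mul_self_nonneg _
  have h1 : Real.sqrt (v ⬝ᵥ v) ≠ 0 := (Real.sqrt_pos.2 h0).ne'
  have h2 := Real.mul_self_sqrt h0.le
  simp only [unitDir, smul_dotProduct, dotProduct_smul, smul_eq_mul]
  generalize Real.sqrt (v ⬝ᵥ v) = r at *
  rw [← h2]
  field_simp

namespace ClosedCurve

theorem tangent_unit (γ : ClosedCurve) (s : ℝ) : γ.tangent s ⬝ᵥ γ.tangent s = 1 :=
  unitDir_dot_self (γ.regular s)

theorem tangent_periodic (γ : ClosedCurve) : Function.Periodic γ.tangent 1 := by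
  intro s
  have h : deriv γ.toFun (s + 1) = deriv γ.toFun s := by
    rw [← deriv_comp_add_const]
    congr 1
    exact funext γ.periodic
  simp only [tangent, h]

theorem tangent_continuous (γ : ClosedCurve) : Continuous γ.tangent := by
  have h : Continuous (deriv γ.toFun) := γ.smooth.continuous_deriv (by simp)
  have h2 : Continuous fun s => deriv γ.toFun s ⬝ᵥ deriv γ.toFun s := by
    simp only [dotProduct]
    fun_prop
  refine (Continuous.inv₀ (Real.continuous_sqrt.comp h2) fun s => ?_).smul h
  have := γ.tangent_unit s
  intro h0
  simp only [Function.comp_apply] at h0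
  simp [tangent, unitDir, h0] at this

end ClosedCurve

namespace Framing

variable {γ : ClosedCurve}

/-- The third vector `e₃ = e₁ × e₂` of the frame `(e₁, e₂, e₃)`, where `e₁` is the unit tangent and
`e₂` the chosen normal. -/
def binormal (φ : Framing γ) (s : ℝ) : R3 := γ.tangent s ⨯₃ φ.normal s

/-- The orthonormal frame (tangent, normal, binormal) as a matrix with these rows. -/
def frameMatrix (φ : Framing γ) (s : ℝ) : Matrix (Fin 3) (Fin 3) ℝ :=
  Matrix.of ![γ.tangent s, φ.normal s, φ.binormal s]

theorem frameMatrix_mem (φ : Framing γ) (s : ℝ) :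
    φ.frameMatrix s ∈ Matrix.specialOrthogonalGroup (Fin 3) ℝ := by
  have hT := γ.tangent_unit s
  have hn := φ.unit s
  have ho := φ.orthogonal s
  simp only [frameMatrix, binormal]
  generalize γ.tangent s = a at *
  generalize φ.normal s = b at *
  rw [Matrix.mem_specialOrthogonalGroup_iff, Matrix.mem_orthogonalGroup_iff]
  simp only [dotProduct, Fin.sum_univ_three] at hT hn ho
  constructor
  · ext i j
    fin_cases i <;> fin_cases j <;>
      simp [Matrix.mul_apply, Fin.sum_univ_three, cross_apply] <;>
      grind
  · rw [Matrix.det_fin_three]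
    simp [cross_apply]
    grind

/-- The frame as a point of `SO(3)`. -/
def frame (φ : Framing γ) (s : ℝ) : SO3 := ⟨φ.frameMatrix s, φ.frameMatrix_mem s⟩

theorem frame_continuous (φ : Framing γ) : Continuous φ.frame := by
  refine Continuous.subtype_mk ?_ _
  have h1 := γ.tangent_continuous
  have h2 := φ.smooth.continuous
  have h1i : ∀ i, Continuous fun s => γ.tangent s i := fun i => (continuous_apply i).comp h1
  have h2i : ∀ i, Continuous fun s => φ.normal s i := fun i => (continuous_apply i).comp h2
  refine continuous_matrix fun i j => ?_
  fin_cases i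
  · exact h1i j
  · exact h2i j
  · fin_cases j <;> simp [frameMatrix, binormal, cross_apply] <;> fun_prop

theorem frame_periodic (φ : Framing γ) : Function.Periodic φ.frame 1 := fun s =>
  Subtype.ext (by
    simp only [frame, frameMatrix, binormal, γ.tangent_periodic s, φ.periodic s])

/-- The loop `S¹ = ℝ / ℤ → SO(3)` given by the framing. -/
def loop (φ : Framing γ) : C(UnitAddCircle, SO3) where
  toFun := φ.frame_periodic.lift
  continuous_toFun := continuous_coinduced_dom.2 φ.frame_continuous

/-- The framing correction term `τ_φ = (1/2π) ∫_{S¹} φ^*(de₃ · e₂)`. -/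
def tau (φ : Framing γ) : ℝ :=
  (1 / (2 * Real.pi)) * ∫ s in (0 : ℝ)..1, deriv φ.binormal s ⬝ᵥ φ.normal s

/-- The map of the cylinder `C = S¹ × [0, π]` to the sphere determined by the framing: for each `s`
it traces the great half-circle from minus the tangent through the normal to the tangent. -/
def cylinderMap (φ : Framing γ) (s θ : ℝ) : R3 :=
  (-Real.cos θ) • γ.tangent s + Real.sin θ • φ.normal s

/-- The degree, as the integral of the normalized area form, of the extended Gauss map on the torus
obtained by gluing the cylinder `C` to the compactified configuration space `C₂(S¹)`. -/
def extendedGaussDegree (φ : Framing γ) : ℝ :=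
  (1 / (4 * Real.pi)) * (γ.gaussIntegral +
    ∫ s in (0 : ℝ)..1, ∫ θ in (0 : ℝ)..Real.pi, pullbackArea φ.cylinderMap s θ)

end Framing

/-- The integral over the open unit disc of the pull-back of the area form of the sphere. -/
def discArea (f : ℂ → R3) : ℝ :=
  ∫ z in Metric.ball (0 : ℂ) 1, triple (f z) (fderiv ℝ f z 1) (fderiv ℝ f z Complex.I)

namespace Swaddling

variable {γ : ClosedCurve}

/-- The swaddling correction term `τ_β = (1/2π) ∫_{D²} β^* ω`. -/
def tau (β : Swaddling γ) : ℝ := (1 / (2 * Real.pi)) * discArea β.toFun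

/-- The degree, as the integral of the normalized area form, of the extended Gauss map on the sphere
obtained by gluing two discs, mapped by `β` and by `-β`, to the two boundary circles of the
compactified configuration space `C₂(S¹)`; the discs inherit opposite orientations. -/
def extendedGaussDegree (β : Swaddling γ) : ℝ :=
  (1 / (4 * Real.pi)) *
    (γ.gaussIntegral - discArea β.toFun + discArea (fun z => -β.toFun z))

/-- The swaddling map `β` lifts to a continuous map `σ` from the closed disc to `SO(3)`, with
`e₁ ∘ σ = β`, which restricts to the framing `φ` on the boundary circle. -/
def LiftsTo (β : Swaddling γ) (φ : Framing γ) : Prop :=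
  ∃ σ : ℂ → SO3, ContinuousOn σ (Metric.closedBall 0 1) ∧
    (∀ z ∈ Metric.closedBall (0 : ℂ) 1, (σ z : Matrix (Fin 3) (Fin 3) ℝ) 0 = β.toFun z) ∧
    ∀ s : ℝ, σ (Complex.exp (2 * Real.pi * s * Complex.I)) = φ.frame s

end Swaddling

end

open scoped Matrix ContDiff
open Set Function

/-! Frames are lifted to unit quaternions. A framing is null-homotopic exactly when its lift to `S³`
closes up (`IsEvenLoop`, `Framing.nullhomotopic_iff`), and this parity is compared with the
integrals.

Two framings of one curve differ by a rotation through an angle `θ` in the normal planes, of some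
winding number `w`. It lowers `τ` by `w` (`Framing.rotate_tau`), while the lift turns through `θ /
2` and acquires the sign `(-1)^w` (`Framing.isEvenLoop_rotate`). So the values `2πτ` of
null-homotopic framings differ by multiples of `4π`.

The link with areas is the structure equation `de₂ ∧ de₃ = e₁^*ω`. Along a swaddling map `β` there
is a unit normal field, since the disc is contractible, and by Stokes its boundary framing has `τ =
τ_β` (`Swaddling.exists_framing`). Another framing extends over `β` if and only if its winding
number relative to this one vanishes, that is, if and only if the values of `τ` agree. Conversely, a
closed lift bounds a disc in `S³` by general position, and the first vectors of the corresponding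
frames form a swaddling map (`Framing.exists_swaddling`).

For a knot, the Gauss map extends smoothly to `t = 0` in the coordinates `(x, t)`, `y = x + t`, and
changes sign when `x` and `y` are exchanged; so its area is twice that over `0 ≤ t ≤ 1/2`. Stokes
expresses the latter by `τ_φ` on `t = 0` and by a similar integral on `t = 1/2`, where the Gauss map
is antipodal under `x ↦ x + 1/2`. There the shift flips the frame by a half-turn about a rotating
normal axis. The angle of the axis grows by `2πm` in half a period, the integral equals `2πm`, and
two flips carry the lift `q` to `-(-1)^m q` (`antipodal_parity`). Hence the Gauss integral is
`4π(τ_φ - m)`, with `m` odd exactly for even framings. The cylinder adds `-4πτ_φ`, the two discs add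
`-4πτ_β`, and the degree is `-m`, where for `β` an even framing with `τ_φ = τ_β` is used. -/

/-! ### Vector algebra and moving frames. -/

theorem dotProduct_self_nonneg' {ι : Type*} [Fintype ι] (v : ι → ℝ) : 0 ≤ v ⬝ᵥ v :=
  Finset.sum_nonneg fun _ _ => mul_self_nonneg _

theorem dotProduct_self_pos {ι : Type*} [Fintype ι] {v : ι → ℝ} (hv : v ≠ 0) : 0 < v ⬝ᵥ v :=
  lt_of_le_of_ne (dotProduct_self_nonneg' v) fun h => hv (dotProduct_self_eq_zero.1 h.symm)

theorem ne_zero_of_dotProduct_self_eq_one {ι : Type*} [Fintype ι] {v : ι → ℝ} (hv : v ⬝ᵥ v = 1) :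
    v ≠ 0 := by
  rintro rfl
  simp at hv

/-- The direction of a nonzero vector. -/
noncomputable def direction {ι : Type*} [Fintype ι] (v : ι → ℝ) : ι → ℝ :=
  (Real.sqrt (v ⬝ᵥ v))⁻¹ • v

theorem unitDir_eq_direction (v : R3) : unitDir v = direction v := rfl

theorem direction_dot_self {ι : Type*} [Fintype ι] {v : ι → ℝ} (hv : v ≠ 0) :
    direction v ⬝ᵥ direction v = 1 := by
  have h0 := dotProduct_self_pos hv
  have h1 : Real.sqrt (v ⬝ᵥ v) ≠ 0 := (Real.sqrt_pos.2 h0).ne'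
  have h2 := Real.mul_self_sqrt h0.le
  simp only [direction, smul_dotProduct, dotProduct_smul, smul_eq_mul]
  generalize Real.sqrt (v ⬝ᵥ v) = r at *
  rw [← h2]
  field_simp

theorem direction_of_unit {ι : Type*} [Fintype ι] {v : ι → ℝ} (hv : v ⬝ᵥ v = 1) :
    direction v = v := by
  simp [direction, hv]

theorem direction_neg {ι : Type*} [Fintype ι] (v : ι → ℝ) : direction (-v) = -direction v := by
  simp [direction]

theorem direction_smul {ι : Type*} [Fintype ι] {c : ℝ} (hc : 0 < c) (v : ι → ℝ) :
    direction (c • v) = direction v := by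
  have h : Real.sqrt (c • v ⬝ᵥ c • v) = c * Real.sqrt (v ⬝ᵥ v) := by
    rw [smul_dotProduct, dotProduct_smul, smul_eq_mul, smul_eq_mul, ← mul_assoc,
      Real.sqrt_mul (mul_self_nonneg c), Real.sqrt_mul_self hc.le]
  rw [direction, direction, h, smul_smul, mul_inv, mul_comm c⁻¹, mul_assoc, inv_mul_cancel₀ hc.ne',
    mul_one]

section Smooth

variable {E : Type*} [NormedAddCommGroup E] [NormedSpace ℝ E] {S : Set E} {n : WithTop ℕ∞}
  {ι : Type*} [Fintype ι]

theorem ContDiffOn.dotProduct {f g : E → ι → ℝ} (hf : ContDiffOn ℝ n f S)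
    (hg : ContDiffOn ℝ n g S) : ContDiffOn ℝ n (fun z => f z ⬝ᵥ g z) S := by
  simp only [_root_.dotProduct]
  exact ContDiffOn.sum fun i _ => (contDiffOn_pi.1 hf i).mul (contDiffOn_pi.1 hg i)

theorem ContDiffOn.cross {f g : E → R3} (hf : ContDiffOn ℝ n f S)
    (hg : ContDiffOn ℝ n g S) : ContDiffOn ℝ n (fun z => f z ⨯₃ g z) S := by
  have hf' := contDiffOn_pi.1 hf
  have hg' := contDiffOn_pi.1 hg
  refine contDiffOn_pi.2 fun i => ?_
  simp only [cross_apply]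
  fin_cases i
  · exact ((hf' 1).mul (hg' 2)).sub ((hf' 2).mul (hg' 1))
  · exact ((hf' 2).mul (hg' 0)).sub ((hf' 0).mul (hg' 2))
  · exact ((hf' 0).mul (hg' 1)).sub ((hf' 1).mul (hg' 0))

theorem ContDiffOn.direction {f : E → ι → ℝ} (hf : ContDiffOn ℝ n f S)
    (h0 : ∀ z ∈ S, f z ≠ 0) : ContDiffOn ℝ n (fun z => direction (f z)) S := by
  have h : ∀ z ∈ S, f z ⬝ᵥ f z ≠ 0 := fun z hz => (dotProduct_self_pos (h0 z hz)).ne'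
  exact (((hf.dotProduct hf).sqrt h).inv fun z hz =>
    (Real.sqrt_pos.2 (dotProduct_self_pos (h0 z hz))).ne').smul hf

end Smooth

theorem ContinuousOn.dotProduct' {E ι : Type*} [TopologicalSpace E] [Fintype ι] {S : Set E}
    {f g : E → ι → ℝ} (hf : ContinuousOn f S) (hg : ContinuousOn g S) :
    ContinuousOn (fun z => f z ⬝ᵥ g z) S := by
  simp only [dotProduct]
  exact continuousOn_finsetSum _ fun i _ =>
    (continuousOn_pi.1 hf i).mul (continuousOn_pi.1 hg i)

theorem ContinuousOn.direction {E ι : Type*} [TopologicalSpace E] [Fintype ι] {S : Set E}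
    {f : E → ι → ℝ} (hf : ContinuousOn f S)
    (h0 : ∀ z ∈ S, f z ≠ 0) : ContinuousOn (fun z => direction (f z)) S :=
  ((hf.dotProduct' hf).sqrt.inv₀ fun z hz =>
    (Real.sqrt_pos.2 (dotProduct_self_pos (h0 z hz))).ne').smul hf

section Derivatives

variable {ι : Type*} [Fintype ι]

theorem HasDerivAt.dotProduct {f g : ℝ → ι → ℝ} {f' g' : ι → ℝ} {x : ℝ} (hf : HasDerivAt f f' x)
    (hg : HasDerivAt g g' x) :
    HasDerivAt (fun x => f x ⬝ᵥ g x) (f' ⬝ᵥ g x + f x ⬝ᵥ g') x := by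
  simp only [_root_.dotProduct, ← Finset.sum_add_distrib]
  exact HasDerivAt.fun_sum fun i _ => (hasDerivAt_pi.1 hf i).mul (hasDerivAt_pi.1 hg i)

theorem HasDerivAt.cross {f g : ℝ → R3} {f' g' : R3} {x : ℝ} (hf : HasDerivAt f f' x)
    (hg : HasDerivAt g g' x) :
    HasDerivAt (fun x => f x ⨯₃ g x) (f' ⨯₃ g x + f x ⨯₃ g') x := by
  have hf' := hasDerivAt_pi.1 hf
  have hg' := hasDerivAt_pi.1 hg
  refine hasDerivAt_pi.2 fun i => ?_
  simp only [cross_apply]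
  fin_cases i
  · exact (((hf' 1).mul (hg' 2)).sub ((hf' 2).mul (hg' 1))).congr_deriv (by simp; ring)
  · exact (((hf' 2).mul (hg' 0)).sub ((hf' 0).mul (hg' 2))).congr_deriv (by simp; ring)
  · exact (((hf' 0).mul (hg' 1)).sub ((hf' 1).mul (hg' 0))).congr_deriv (by simp; ring)

end Derivatives

/-- Supplies the infinitesimal orthonormality relations of a moving frame, used in the pointwise
formulas for the correction terms. -/
theorem HasDerivAt.dot_const_eq {u v : ℝ → R3} {u' v' : R3} {a s : ℝ} (hu : HasDerivAt u u' s)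
    (hv : HasDerivAt v v' s) (h : ∀ s, u s ⬝ᵥ v s = a) : u' ⬝ᵥ v s + u s ⬝ᵥ v' = 0 :=
  (hu.dotProduct hv).unique
    ((hasDerivAt_const s a).congr_of_eventuallyEq (Filter.Eventually.of_forall h))

theorem specialOrthogonal_rows {M : Matrix (Fin 3) (Fin 3) ℝ}
    (hM : M ∈ Matrix.specialOrthogonalGroup (Fin 3) ℝ) (i j : Fin 3) :
    M i ⬝ᵥ M j = if i = j then 1 else 0 := by
  have h1 := (Matrix.mem_orthogonalGroup_iff (Fin 3) ℝ).1
    (Matrix.mem_specialOrthogonalGroup_iff.1 hM).1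
  have := congrFun (congrFun h1 i) j
  rw [Matrix.one_apply] at this
  rw [← this]
  rfl

/-- The matrix with rows `a`, `b` and `a × b`. -/
def frameOf (a b : R3) : Matrix (Fin 3) (Fin 3) ℝ := Matrix.of ![a, b, a ⨯₃ b]

theorem frameOf_mem {a b : R3} (ha : a ⬝ᵥ a = 1) (hb : b ⬝ᵥ b = 1) (hab : a ⬝ᵥ b = 0) :
    frameOf a b ∈ Matrix.specialOrthogonalGroup (Fin 3) ℝ := by
  rw [frameOf, Matrix.mem_specialOrthogonalGroup_iff, Matrix.mem_orthogonalGroup_iff]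
  simp only [dotProduct, Fin.sum_univ_three] at ha hb hab
  constructor
  · ext i j
    fin_cases i <;> fin_cases j <;>
      simp [Matrix.mul_apply, Fin.sum_univ_three, cross_apply] <;>
      grind
  · rw [Matrix.det_fin_three]
    simp [cross_apply]
    grind

theorem continuousOn_frameOf {E : Type*} [TopologicalSpace E] {S : Set E} {a b : E → R3}
    (ha : ContinuousOn a S) (hb : ContinuousOn b S) :
    ContinuousOn (fun z => frameOf (a z) (b z)) S := by
  have ha' := continuousOn_pi.1 ha
  have hb' := continuousOn_pi.1 hb
  refine continuousOn_pi.2 fun i => continuousOn_pi.2 fun j => ?_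
  fin_cases i
  · exact ha' j
  · exact hb' j
  · fin_cases j <;> simp [frameOf, cross_apply] <;> fun_prop (disch := assumption)

/-- The orthonormal expansion of a vector normal to `a` in the frame `(a, b, a × b)`. -/
theorem normal_expansion {a b v : R3} (ha : a ⬝ᵥ a = 1) (hb : b ⬝ᵥ b = 1) (hab : a ⬝ᵥ b = 0)
    (hv : a ⬝ᵥ v = 0) : v = (v ⬝ᵥ b) • b + (v ⬝ᵥ a ⨯₃ b) • (a ⨯₃ b) := by
  simp only [dotProduct, Fin.sum_univ_three] at *
  ext i
  fin_cases i <;> simp [cross_apply] <;> grind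

theorem normal_coords_sq {a b v : R3} (ha : a ⬝ᵥ a = 1) (hb : b ⬝ᵥ b = 1) (hab : a ⬝ᵥ b = 0)
    (hv : a ⬝ᵥ v = 0) (hv1 : v ⬝ᵥ v = 1) : (v ⬝ᵥ b) ^ 2 + (v ⬝ᵥ a ⨯₃ b) ^ 2 = 1 := by
  simp only [dotProduct, Fin.sum_univ_three] at *
  simp [cross_apply]
  grind

/-! ### Transport of normal fields along fine subdivisions. -/

/-- A function of two parameters which is positive on the diagonal is positive for consecutive
points of a sufficiently fine subdivision of `[0, 1]`, uniformly on a compact set. -/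
theorem exists_subdivision_pos {E : Type*} [TopologicalSpace E] {K : Set E} (hK : IsCompact K)
    {D : ℝ → ℝ → E → ℝ}
    (hD : ContinuousOn (fun p : ℝ × ℝ × E => D p.1 p.2.1 p.2.2) (Icc 0 1 ×ˢ Icc 0 1 ×ˢ K))
    (hpos : ∀ r ∈ Icc (0 : ℝ) 1, ∀ z ∈ K, 0 < D r r z) :
    ∃ N : ℕ, 0 < N ∧ ∀ k < N, ∀ z ∈ K, 0 < D (k / N) ((k + 1 : ℕ) / N) z := by
  by_contra! h
  -- Counterexamples are indexed by `N + 1` parts, so that no subdivision is empty.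
  have h' : ∀ N : ℕ, ∃ k < N + 1, ∃ z ∈ K, D (k / (N + 1 : ℕ)) ((k + 1 : ℕ) / (N + 1 : ℕ)) z ≤ 0 :=
    fun N => h (N + 1) N.succ_pos
  choose k hk z hz hkz using h'
  let p : ℕ → ℝ × ℝ × E := fun N =>
    ((k N : ℝ) / (N + 1 : ℕ), ((k N + 1 : ℕ) : ℝ) / (N + 1 : ℕ), z N)
  have hN : ∀ N : ℕ, (0 : ℝ) < (N + 1 : ℕ) := fun N => by positivity
  have hp : ∀ N, p N ∈ Icc (0 : ℝ) 1 ×ˢ Icc (0 : ℝ) 1 ×ˢ K := by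
    intro N
    refine ⟨⟨by positivity, ?_⟩, ⟨by positivity, ?_⟩, hz N⟩
    · exact (div_le_one (hN N)).2 (by exact_mod_cast (hk N).le)
    · exact (div_le_one (hN N)).2 (by exact_mod_cast hk N)
  have hcpt : IsCompact (Icc (0 : ℝ) 1 ×ˢ Icc (0 : ℝ) 1 ×ˢ K) :=
    isCompact_Icc.prod (isCompact_Icc.prod hK)
  -- A cluster point of the counterexamples lies on the diagonal, because consecutive division
  -- points differ by `1 / (N + 1)`, and `D ≤ 0` there by continuity.
  obtain ⟨q, hq, hcl⟩ := hcpt.exists_mapClusterPt (u := p) (f := Filter.atTop)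
    (Filter.tendsto_principal.2 (Filter.Eventually.of_forall hp))
  have hdiff : Filter.Tendsto (fun N => (p N).2.1 - (p N).1) Filter.atTop (nhds 0) := by
    have : (fun N => (p N).2.1 - (p N).1) = fun N : ℕ => 1 / ((N : ℝ) + 1) := by
      funext N
      simp only [p]
      push_cast
      rw [← sub_div]
      congr 1
      ring
    rw [this]
    exact tendsto_one_div_add_atTop_nhds_zero_nat
  have hqd : q.2.1 - q.1 = 0 := by
    have hc : Continuous fun x : ℝ × ℝ × E => x.2.1 - x.1 := by fun_prop
    have h1 : MapClusterPt (q.2.1 - q.1) Filter.atTop ((fun x : ℝ × ℝ × E => x.2.1 - x.1) ∘ p) :=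
      hcl.continuousAt_comp hc.continuousAt
    have h2 : ClusterPt (q.2.1 - q.1) (nhds (0 : ℝ)) := ClusterPt.mono h1 hdiff
    exact eq_of_nhds_neBot h2
  have hle : D q.1 q.2.1 q.2.2 ≤ 0 := by
    by_contra! hgt
    have hev : ∀ᶠ x in nhdsWithin q (Icc (0 : ℝ) 1 ×ˢ Icc (0 : ℝ) 1 ×ˢ K),
        0 < D x.1 x.2.1 x.2.2 := (hD q hq).eventually (lt_mem_nhds hgt)
    rw [eventually_nhdsWithin_iff] at hev
    obtain ⟨N, hNf⟩ := (hcl.frequently hev).exists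
    exact absurd (hNf (hp N)) (not_lt.2 (hkz N))
  have := hpos q.1 hq.1 q.2.2 hq.2.2
  rw [sub_eq_zero.1 hqd] at hle
  exact absurd this (not_lt.2 hle)

section Transport

variable {E : Type*} [NormedAddCommGroup E] [NormedSpace ℝ E] {S : Set E} {n : WithTop ℕ∞}

/-- The direction of the orthogonal projection of `v` to the plane normal to `e`. -/
noncomputable def normalDir (e v : R3) : R3 := direction (v - (v ⬝ᵥ e) • e)

/-- If `v` were a multiple of `e`, being normal to `e'` would force the factor to vanish. So
projecting a normal vector from one point of a fine subdivision to the next never degenerates. -/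
theorem sub_proj_ne_zero {e e' v : R3} (he' : e' ⬝ᵥ e ≠ 0) (hv : v ≠ 0) (hev : e' ⬝ᵥ v = 0) :
    v - (v ⬝ᵥ e) • e ≠ 0 := by
  intro h
  have h1 : v = (v ⬝ᵥ e) • e := sub_eq_zero.1 h
  have h2 : (v ⬝ᵥ e) * (e' ⬝ᵥ e) = 0 := by
    rw [← smul_eq_mul, ← dotProduct_smul, ← h1, hev]
  have h3 : v ⬝ᵥ e = 0 := (mul_eq_zero.1 h2).resolve_right he'
  rw [h3, zero_smul] at h1
  exact hv h1

theorem dot_normalDir {e v : R3} (he : e ⬝ᵥ e = 1) : e ⬝ᵥ normalDir e v = 0 := by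
  simp only [normalDir, direction, dotProduct_smul, dotProduct_sub, he, smul_eq_mul]
  rw [dotProduct_comm e v]
  ring

theorem normalDir_of_normal {e v : R3} (hv : v ⬝ᵥ v = 1) (hev : e ⬝ᵥ v = 0) :
    normalDir e v = v := by
  rw [normalDir, dotProduct_comm v e, hev, zero_smul, sub_zero, direction_of_unit hv]

/-- A unit normal field along `H 0` can be transported to a unit normal field along `H 1`,
if the subdivision of `[0, 1]` into `N` parts is sufficiently fine. -/
theorem exists_normal_transport {H : ℝ → E → R3} {N : ℕ} (hN : 0 < N)
    (hH : ∀ r ∈ Icc (0 : ℝ) 1, ContDiffOn ℝ n (H r) S)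
    (hu : ∀ r ∈ Icc (0 : ℝ) 1, ∀ z ∈ S, H r z ⬝ᵥ H r z = 1)
    (hpos : ∀ k < N, ∀ z ∈ S, 0 < H (k / N) z ⬝ᵥ H ((k + 1 : ℕ) / N) z)
    {ν : E → R3} (hν : ContDiffOn ℝ n ν S) (hν1 : ∀ z ∈ S, ν z ⬝ᵥ ν z = 1)
    (hν0 : ∀ z ∈ S, H 0 z ⬝ᵥ ν z = 0) :
    ∃ μ : E → R3, ContDiffOn ℝ n μ S ∧ (∀ z ∈ S, μ z ⬝ᵥ μ z = 1) ∧
      (∀ z ∈ S, H 1 z ⬝ᵥ μ z = 0) ∧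
      (∀ z w, (∀ r, H r z = H r w) → ν z = ν w → μ z = μ w) ∧
      ∀ z ∈ S, (∀ r, H r z = H 0 z) → μ z = ν z := by
  -- Each step projects the field to the plane normal to the next map and normalises it. This is
  -- done pointwise, so coincidences of the data persist, which later gives periodicity; and nothing
  -- changes at points where `H` is independent of `r`.
  have key : ∀ k ≤ N, ∃ μ : E → R3, ContDiffOn ℝ n μ S ∧ (∀ z ∈ S, μ z ⬝ᵥ μ z = 1) ∧
      (∀ z ∈ S, H (k / N) z ⬝ᵥ μ z = 0) ∧
      (∀ z w, (∀ r, H r z = H r w) → ν z = ν w → μ z = μ w) ∧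
      ∀ z ∈ S, (∀ r, H r z = H 0 z) → μ z = ν z := by
    intro k
    induction k with
    | zero => exact fun _ => ⟨ν, hν, hν1, by simpa using hν0, fun _ _ _ h => h, fun _ _ _ => rfl⟩
    | succ k ih =>
      intro hk
      obtain ⟨μ, h1, h2, h3, h4, h5⟩ := ih (by omega)
      have hr : ((k + 1 : ℕ) : ℝ) / N ∈ Icc (0 : ℝ) 1 :=
        ⟨by positivity, (div_le_one (by positivity)).2 (by exact_mod_cast hk)⟩
      have hne : ∀ z ∈ S,
          μ z - (μ z ⬝ᵥ H ((k + 1 : ℕ) / N) z) • H ((k + 1 : ℕ) / N) z ≠ 0 := fun z hz =>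
        sub_proj_ne_zero (hpos k (by omega) z hz).ne' (ne_zero_of_dotProduct_self_eq_one (h2 z hz))
          (h3 z hz)
      refine ⟨fun z => normalDir (H ((k + 1 : ℕ) / N) z) (μ z), ?_, ?_, ?_, ?_, ?_⟩
      · exact (h1.sub ((h1.dotProduct (hH _ hr)).smul (hH _ hr))).direction hne
      · exact fun z hz => direction_dot_self (hne z hz)
      · exact fun z hz => dot_normalDir (hu _ hr z hz)
      · intro z w hzw hνzw
        simp only [hzw, h4 z w hzw hνzw]
      · intro z hz hconst
        have hμ := h5 z hz hconst
        simp only [hμ, hconst]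
        exact normalDir_of_normal (hν1 z hz) (hν0 z hz)
  have := key N le_rfl
  rwa [div_self (by positivity)] at this

end Transport

/-! ### The structure equation and Stokes' theorem on a strip. -/

/-- Parseval's identity for the orthonormal frame `(a, b, a × b)`. -/
theorem frame_parseval {a b : R3} (ha : a ⬝ᵥ a = 1) (hb : b ⬝ᵥ b = 1) (hab : a ⬝ᵥ b = 0)
    (u v : R3) : u ⬝ᵥ v =
      (u ⬝ᵥ a) * (v ⬝ᵥ a) + (u ⬝ᵥ b) * (v ⬝ᵥ b) + (u ⬝ᵥ a ⨯₃ b) * (v ⬝ᵥ a ⨯₃ b) := by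
  have h : a ⬝ᵥ (u - (u ⬝ᵥ a) • a) = 0 := by
    rw [dotProduct_sub, dotProduct_smul, ha, dotProduct_comm a u]
    simp
  have hu : u = (u ⬝ᵥ a) • a + (u - (u ⬝ᵥ a) • a) := by abel
  have hba : a ⬝ᵥ a ⨯₃ b = 0 := dot_self_cross a b
  rw [normal_expansion ha hb hab h] at hu
  conv_lhs => rw [hu]
  simp only [add_dotProduct, smul_dotProduct, sub_dotProduct, smul_eq_mul, hab, hba,
    dotProduct_comm a v, dotProduct_comm b v, dotProduct_comm (a ⨯₃ b) v]
  ring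

/-- The structure equation `de₂ ∧ de₃ = e₁^* ω` of an orthonormal frame `(e₁, e₂, e₃)`:
here `b`, `x` are `e₁`, `e₂`, and the suffixes denote partial derivatives. -/
theorem structure_equation {b x bs xs bt xt : R3} (hb : b ⬝ᵥ b = 1) (hx : x ⬝ᵥ x = 1)
    (hbx : b ⬝ᵥ x = 0) (hbs : b ⬝ᵥ bs = 0) (hbt : b ⬝ᵥ bt = 0) (hxs : x ⬝ᵥ xs = 0)
    (hxt : x ⬝ᵥ xt = 0) (hs : bs ⬝ᵥ x + b ⬝ᵥ xs = 0) (ht : bt ⬝ᵥ x + b ⬝ᵥ xt = 0) :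
    xs ⬝ᵥ (bt ⨯₃ x + b ⨯₃ xt) - xt ⬝ᵥ (bs ⨯₃ x + b ⨯₃ xs) = triple b bs bt := by
  -- `yb`, `yx`, `yc` are the components in the frame of a derivative of `b × x`; `tr` evaluates the
  -- area form on combinations of `x` and `b × x`.
  have yb : ∀ u v : R3, (u ⨯₃ x + b ⨯₃ v) ⬝ᵥ b = -(u ⬝ᵥ b ⨯₃ x) := by
    intro u v
    simp [dotProduct, Fin.sum_univ_three, cross_apply]
    ring
  have yx : ∀ u v : R3, (u ⨯₃ x + b ⨯₃ v) ⬝ᵥ x = -(v ⬝ᵥ b ⨯₃ x) := by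
    intro u v
    simp [dotProduct, Fin.sum_univ_three, cross_apply]
    ring
  have yc : ∀ u v : R3, (u ⨯₃ x + b ⨯₃ v) ⬝ᵥ b ⨯₃ x =
      (b ⬝ᵥ u) * (x ⬝ᵥ x) - (u ⬝ᵥ x) * (b ⬝ᵥ x) + (b ⬝ᵥ b) * (x ⬝ᵥ v) - (b ⬝ᵥ x) * (b ⬝ᵥ v) := by
    intro u v
    simp [dotProduct, Fin.sum_univ_three, cross_apply]
    ring
  have tr : ∀ p q p' q' : ℝ, triple b (p • x + q • (b ⨯₃ x)) (p' • x + q' • (b ⨯₃ x)) =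
      (p * q' - q * p') * ((b ⬝ᵥ b) * (x ⬝ᵥ x) - (b ⬝ᵥ x) ^ 2) := by
    intro p q p' q'
    simp [triple, dotProduct, Fin.sum_univ_three, cross_apply, Matrix.vecHead, Matrix.vecTail]
    ring
  rw [frame_parseval hb hx hbx xs, frame_parseval hb hx hbx xt, yb, yx, yc, yb, yx, yc,
    normal_expansion hb hx hbx hbs, normal_expansion hb hx hbx hbt, tr]
  rw [← normal_expansion hb hx hbx hbs, ← normal_expansion hb hx hbx hbt, dotProduct_comm xs b,
    dotProduct_comm xt b, dotProduct_comm xs x, dotProduct_comm xt x]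
  simp only [hb, hx, hbx, hbs, hbt, hxs, hxt]
  rw [eq_neg_of_add_eq_zero_right hs, eq_neg_of_add_eq_zero_right ht]
  ring

theorem uniqueDiffOn_strip {c : ℝ} (hc : 0 < c) :
    UniqueDiffOn ℝ ((univ : Set ℝ) ×ˢ Icc 0 c) :=
  uniqueDiffOn_univ.prod (uniqueDiffOn_Icc hc)

theorem strip_mem_nhds {c : ℝ} {p : ℝ × ℝ} (hp : p.2 ∈ Ioo 0 c) :
    (univ : Set ℝ) ×ˢ Icc 0 c ∈ nhds p :=
  prod_mem_nhds Filter.univ_mem (Icc_mem_nhds hp.1 hp.2)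

theorem HasFDerivAt.hasDerivAt_fst {F : Type*} [NormedAddCommGroup F] [NormedSpace ℝ F]
    {f : ℝ × ℝ → F} {f' : ℝ × ℝ →L[ℝ] F} {p : ℝ × ℝ} (h : HasFDerivAt f f' p) :
    HasDerivAt (fun x => f (x, p.2)) (f' (1, 0)) p.1 :=
  HasFDerivAt.comp_hasDerivAt (f := fun x : ℝ => (x, p.2)) p.1 h
    ((hasDerivAt_id p.1).prodMk (hasDerivAt_const p.1 p.2))

theorem HasFDerivAt.hasDerivAt_snd {F : Type*} [NormedAddCommGroup F] [NormedSpace ℝ F]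
    {f : ℝ × ℝ → F} {f' : ℝ × ℝ →L[ℝ] F} {p : ℝ × ℝ} (h : HasFDerivAt f f' p) :
    HasDerivAt (fun y => f (p.1, y)) (f' (0, 1)) p.2 :=
  HasFDerivAt.comp_hasDerivAt (f := fun y : ℝ => (p.1, y)) p.2 h
    ((hasDerivAt_const p.2 p.1).prodMk (hasDerivAt_id p.2))

/-- **Stokes' theorem** for the form `X · dY` on a strip, for vector-valued functions which are
periodic in the first variable. -/
theorem integral_wedge_strip {X Y : ℝ × ℝ → R3} {c : ℝ} (hc : 0 < c)
    (hX : ContDiffOn ℝ ∞ X (univ ×ˢ Icc 0 c)) (hY : ContDiffOn ℝ ∞ Y (univ ×ˢ Icc 0 c))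
    (hXp : ∀ t ∈ Icc 0 c, X (1, t) = X (0, t))
    (hYp : ∀ t ∈ Icc 0 c, ∀ x, Y (x + 1, t) = Y (x, t)) :
    ∫ x in (0 : ℝ)..1, ∫ t in (0 : ℝ)..c,
      (fderiv ℝ X (x, t) (1, 0) ⬝ᵥ fderiv ℝ Y (x, t) (0, 1) -
        fderiv ℝ X (x, t) (0, 1) ⬝ᵥ fderiv ℝ Y (x, t) (1, 0)) =
    (∫ x in (0 : ℝ)..1, X (x, 0) ⬝ᵥ deriv (fun x => Y (x, 0)) x) -
      ∫ x in (0 : ℝ)..1, X (x, c) ⬝ᵥ deriv (fun x => Y (x, c)) x := by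
  set U : Set (ℝ × ℝ) := univ ×ˢ Icc 0 c with hU
  have hud : UniqueDiffOn ℝ U := uniqueDiffOn_strip hc
  have hY' : ContDiffOn ℝ ∞ (fderivWithin ℝ Y U) U := hY.fderivWithin hud (by simp)
  have hD : ∀ v : ℝ × ℝ, ContDiffOn ℝ ∞ (fun p => fderivWithin ℝ Y U p v) U := fun v =>
    hY'.clm_apply contDiffOn_const
  -- The divergence of `(f, g)` is the integrand, since the mixed second derivatives of `Y` cancel.
  -- Derivatives within the closed strip keep `f` and `g` smooth up to the edges.
  set f : ℝ × ℝ → ℝ := fun p => X p ⬝ᵥ fderivWithin ℝ Y U p (0, 1)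
  set g : ℝ × ℝ → ℝ := fun p => -(X p ⬝ᵥ fderivWithin ℝ Y U p (1, 0))
  have hf : ContDiffOn ℝ ∞ f U := hX.dotProduct (hD _)
  have hg : ContDiffOn ℝ ∞ g U := (hX.dotProduct (hD _)).neg
  have hsub : uIcc (0 : ℝ) 1 ×ˢ uIcc 0 c ⊆ U := by
    rw [uIcc_of_le hc.le]
    exact prod_mono (subset_univ _) subset_rfl
  have hdiff : ∀ {h : ℝ × ℝ → ℝ}, ContDiffOn ℝ ∞ h U → ∀ p ∈ U, U ∈ nhds p →
      HasFDerivAt h (fderivWithin ℝ h U p) p := fun hh p hp hn => by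
    rw [fderivWithin_of_mem_nhds hn]
    exact ((hh.contDiffAt hn).differentiableAt (by simp)).hasFDerivAt
  have hnhds : ∀ p ∈ Ioo (min 0 1) (max 0 1) ×ˢ Ioo (min 0 c) (max 0 c), p ∈ U ∧ U ∈ nhds p := by
    intro p hp
    rw [min_eq_left hc.le, max_eq_right hc.le] at hp
    exact ⟨⟨mem_univ _, Ioo_subset_Icc_self hp.2⟩, strip_mem_nhds hp.2⟩
  have main := MeasureTheory.integral2_divergence_prod_of_hasFDerivAt f g (fderivWithin ℝ f U)
    (fderivWithin ℝ g U) 0 0 1 c (hf.continuousOn.mono hsub) (hg.continuousOn.mono hsub)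
    (fun p hp => hdiff hf p (hnhds p hp).1 (hnhds p hp).2)
    (fun p hp => hdiff hg p (hnhds p hp).1 (hnhds p hp).2) (by
      refine ContinuousOn.integrableOn_compact (isCompact_uIcc.prod isCompact_uIcc) ?_
      refine ContinuousOn.mono ?_ hsub
      exact ((hf.continuousOn_fderivWithin hud (by simp)).clm_apply continuousOn_const).add
        ((hg.continuousOn_fderivWithin hud (by simp)).clm_apply continuousOn_const))
  have hslice : ∀ t ∈ Icc 0 c, ∀ x, HasDerivAt (fun x => Y (x, t))
      (fderivWithin ℝ Y U (x, t) (1, 0)) x := by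
    intro t ht x
    have h1 : HasFDerivWithinAt Y (fderivWithin ℝ Y U (x, t)) U (x, t) :=
      (hY.differentiableOn (by simp) (x, t) ⟨mem_univ _, ht⟩).hasFDerivWithinAt
    have h2 : HasDerivWithinAt (fun x : ℝ => ((x, t) : ℝ × ℝ)) (1, 0) univ x :=
      ((hasDerivAt_id x).prodMk (hasDerivAt_const x t)).hasDerivWithinAt
    exact (HasFDerivWithinAt.comp_hasDerivWithinAt x h1 h2
      fun x _ => (⟨mem_univ _, ht⟩ : ((x, t) : ℝ × ℝ) ∈ U)).hasDerivAt Filter.univ_mem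
  -- The sides `x = 0` and `x = 1` cancel by periodicity; the end points of the `t`-interval do not
  -- affect the integrals.
  have hfp : ∀ t ∈ Ioo 0 c, f (1, t) = f (0, t) := by
    intro t ht
    have hs : ∀ x : ℝ, HasDerivAt (fun t => Y (x, t)) (fderivWithin ℝ Y U (x, t) (0, 1)) t := by
      intro x
      have hn : U ∈ nhds (x, t) := strip_mem_nhds ht
      rw [fderivWithin_of_mem_nhds hn]
      exact ((hY.contDiffAt hn).differentiableAt (by simp)).hasFDerivAt.hasDerivAt_snd
    have h1 : HasDerivAt (fun t => Y (0, t)) (fderivWithin ℝ Y U (1, t) (0, 1)) t := by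
      refine (hs 1).congr_of_eventuallyEq ?_
      filter_upwards [Icc_mem_nhds ht.1 ht.2] with t' ht'
      simpa using (hYp t' ht' 0).symm
    simp only [f, hXp t (Ioo_subset_Icc_self ht), (hs 0).unique h1]
  have hside : ∫ t in (0 : ℝ)..c, f (1, t) = ∫ t in (0 : ℝ)..c, f (0, t) := by
    refine intervalIntegral.integral_congr_uIoo ?_
    intro t ht
    rw [uIoo_of_le hc.le] at ht
    exact hfp t ht
  have hdiv : ∫ x in (0 : ℝ)..1, ∫ t in (0 : ℝ)..c,
      (fderiv ℝ X (x, t) (1, 0) ⬝ᵥ fderiv ℝ Y (x, t) (0, 1) -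
        fderiv ℝ X (x, t) (0, 1) ⬝ᵥ fderiv ℝ Y (x, t) (1, 0)) =
      ∫ x in (0 : ℝ)..1, ∫ t in (0 : ℝ)..c,
        (fderivWithin ℝ f U (x, t) (1, 0) + fderivWithin ℝ g U (x, t) (0, 1)) := by
    refine intervalIntegral.integral_congr fun x _ => ?_
    refine intervalIntegral.integral_congr_uIoo fun t ht => ?_
    rw [uIoo_of_le hc.le] at ht
    have hn : U ∈ nhds (x, t) := strip_mem_nhds ht
    have hXd := ((hX.contDiffAt hn).differentiableAt (by simp)).hasFDerivAt
    have hfd := hdiff hf (x, t) ⟨mem_univ _, Ioo_subset_Icc_self ht⟩ hn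
    have hgd := hdiff hg (x, t) ⟨mem_univ _, Ioo_subset_Icc_self ht⟩ hn
    have hYc : ContDiffAt ℝ ∞ Y (x, t) := hY.contDiffAt hn
    have hYd : DifferentiableAt ℝ (fderiv ℝ Y) (x, t) :=
      (hYc.fderiv_right (m := ∞) (by simp)).differentiableAt (by simp)
    have hsymm : IsSymmSndFDerivAt ℝ Y (x, t) :=
      hYc.isSymmSndFDerivAt (by simpa using ENat.LEInfty.out)
    have hev : ∀ v, (fun p => fderivWithin ℝ Y U p v) =ᶠ[nhds (x, t)] fun p => fderiv ℝ Y p v := by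
      intro v
      filter_upwards [(strip_mem_nhds (p := (x, t)) ht |> eventually_mem_nhds_iff.2)] with p hp
      rw [fderivWithin_of_mem_nhds hp]
    have hDd : ∀ v, HasFDerivAt (fun p => fderivWithin ℝ Y U p v)
        ((fderiv ℝ (fderiv ℝ Y) (x, t)).flip v) (x, t) := fun v =>
      (hYd.hasFDerivAt.clm_apply (hasFDerivAt_const v (x, t))).congr_of_eventuallyEq (hev v)
        |>.congr_fderiv (by ext <;> simp)
    have e1 := (hXd.hasDerivAt_fst.dotProduct (hDd (0, 1)).hasDerivAt_fst).unique hfd.hasDerivAt_fst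
    have e2 := ((hXd.hasDerivAt_snd.dotProduct (hDd (1, 0)).hasDerivAt_snd).neg).unique
      hgd.hasDerivAt_snd
    simp only [fderivWithin_of_mem_nhds hn, ContinuousLinearMap.flip_apply] at e1 e2 ⊢
    rw [← e1, ← e2, hsymm (0, 1) (1, 0)]
    ring
  rw [hdiv, main, hside]
  have hb : ∀ t ∈ Icc 0 c, ∫ x in (0 : ℝ)..1, g (x, t) =
      -∫ x in (0 : ℝ)..1, X (x, t) ⬝ᵥ deriv (fun x => Y (x, t)) x := by
    intro t ht
    rw [← intervalIntegral.integral_neg]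
    refine intervalIntegral.integral_congr fun x _ => ?_
    simp only [g, (hslice t ht x).deriv]
  rw [hb c ⟨hc.le, le_rfl⟩, hb 0 ⟨le_rfl, hc.le⟩]
  ring

/-- The integral of the area form over a strip, in terms of an orthonormal frame `(B, X, B × X)`
along the strip. -/
theorem integral_pullbackArea_strip {B X : ℝ × ℝ → R3} {c : ℝ} (hc : 0 < c)
    (hB : ContDiffOn ℝ ∞ B (univ ×ˢ Icc 0 c)) (hX : ContDiffOn ℝ ∞ X (univ ×ˢ Icc 0 c))
    (hB1 : ∀ p ∈ (univ : Set ℝ) ×ˢ Icc 0 c, B p ⬝ᵥ B p = 1)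
    (hX1 : ∀ p ∈ (univ : Set ℝ) ×ˢ Icc 0 c, X p ⬝ᵥ X p = 1)
    (hBX : ∀ p ∈ (univ : Set ℝ) ×ˢ Icc 0 c, B p ⬝ᵥ X p = 0)
    (hBp : ∀ t ∈ Icc 0 c, ∀ x, B (x + 1, t) = B (x, t))
    (hXp : ∀ t ∈ Icc 0 c, ∀ x, X (x + 1, t) = X (x, t)) :
    ∫ x in (0 : ℝ)..1, ∫ t in (0 : ℝ)..c, pullbackArea (fun x t => B (x, t)) x t =
    (∫ x in (0 : ℝ)..1, X (x, 0) ⬝ᵥ deriv (fun x => B (x, 0) ⨯₃ X (x, 0)) x) -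
      ∫ x in (0 : ℝ)..1, X (x, c) ⬝ᵥ deriv (fun x => B (x, c) ⨯₃ X (x, c)) x := by
  rw [← integral_wedge_strip (Y := fun p => B p ⨯₃ X p) hc hX (hB.cross hX)
    (fun t ht => by simpa using hXp t ht 0) (fun t ht x => by simp only [hBp t ht, hXp t ht])]
  refine intervalIntegral.integral_congr fun x _ => ?_
  refine intervalIntegral.integral_congr_uIoo fun t ht => ?_
  rw [uIoo_of_le hc.le] at ht
  have hn : (univ : Set ℝ) ×ˢ Icc 0 c ∈ nhds (x, t) := strip_mem_nhds ht
  have hBd := ((hB.contDiffAt hn).differentiableAt (by simp)).hasFDerivAt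
  have hXd := ((hX.contDiffAt hn).differentiableAt (by simp)).hasFDerivAt
  have hYd := (((hB.cross hX).contDiffAt hn).differentiableAt (by simp)).hasFDerivAt
  have y1 := (hBd.hasDerivAt_fst.cross hXd.hasDerivAt_fst).unique hYd.hasDerivAt_fst
  have y2 := (hBd.hasDerivAt_snd.cross hXd.hasDerivAt_snd).unique hYd.hasDerivAt_snd
  have const1 : ∀ {V W : ℝ × ℝ → R3} {V' W' : ℝ × ℝ →L[ℝ] R3} {a : ℝ},
      HasFDerivAt V V' (x, t) → HasFDerivAt W W' (x, t) →
      (∀ p ∈ (univ : Set ℝ) ×ˢ Icc 0 c, V p ⬝ᵥ W p = a) →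
      V' (1, 0) ⬝ᵥ W (x, t) + V (x, t) ⬝ᵥ W' (1, 0) = 0 ∧
      V' (0, 1) ⬝ᵥ W (x, t) + V (x, t) ⬝ᵥ W' (0, 1) = 0 := by
    intro V W V' W' a hV hW ha
    constructor
    · refine (hV.hasDerivAt_fst.dotProduct hW.hasDerivAt_fst).unique ?_
      refine (hasDerivAt_const x a).congr_of_eventuallyEq (Filter.Eventually.of_forall fun y => ?_)
      exact ha _ ⟨mem_univ _, Ioo_subset_Icc_self ht⟩
    · refine (hV.hasDerivAt_snd.dotProduct hW.hasDerivAt_snd).unique ?_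
      refine (hasDerivAt_const t a).congr_of_eventuallyEq ?_
      filter_upwards [Icc_mem_nhds ht.1 ht.2] with s hs
      exact ha _ ⟨mem_univ _, hs⟩
  have hm : (x, t) ∈ (univ : Set ℝ) ×ˢ Icc 0 c := ⟨mem_univ _, Ioo_subset_Icc_self ht⟩
  have half : ∀ {u v : R3}, u ⬝ᵥ v + v ⬝ᵥ u = 0 → v ⬝ᵥ u = 0 := fun {u v} h => by
    rw [dotProduct_comm u v] at h
    linarith
  obtain ⟨b1, b2⟩ := const1 hBd hBd hB1
  obtain ⟨x1, x2⟩ := const1 hXd hXd hX1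
  obtain ⟨m1, m2⟩ := const1 hBd hXd hBX
  simp only [pullbackArea, hBd.hasDerivAt_fst.deriv, hBd.hasDerivAt_snd.deriv, ← y1, ← y2]
  exact (structure_equation (hB1 _ hm) (hX1 _ hm) (hBX _ hm) (half b1) (half b2) (half x1)
    (half x2) m1 m2).symm

/-! ### Normal fields over the disc and area in polar coordinates. -/

theorem exists_unit_normal (e : R3) : ∃ v : R3, v ⬝ᵥ v = 1 ∧ e ⬝ᵥ v = 0 := by
  -- A quarter turn of the projection of `e` to the first two coordinates is normal to `e`; it
  -- vanishes only when `e` lies on the third axis.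
  by_cases h : (![-e 1, e 0, 0] : R3) = 0
  · refine ⟨![1, 0, 0], by simp [dotProduct, Fin.sum_univ_three], ?_⟩
    have h1 := congrFun h 1
    simp at h1
    simp [dotProduct, Fin.sum_univ_three, h1]
  · refine ⟨direction ![-e 1, e 0, 0], direction_dot_self h, ?_⟩
    simp [direction, dotProduct, Fin.sum_univ_three]
    ring

theorem uniqueDiffOn_closedDisc : UniqueDiffOn ℝ (Metric.closedBall (0 : ℂ) 1) :=
  uniqueDiffOn_convex (convex_closedBall _ _)
    (by rw [interior_closedBall _ one_ne_zero]; exact ⟨0, by simp⟩)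

/-- A smooth map from the closed disc to the sphere admits a smooth unit normal field. -/
theorem exists_normal_on_disc {f : ℂ → R3} (hf : ContDiffOn ℝ ∞ f (Metric.closedBall 0 1))
    (h1 : ∀ z ∈ Metric.closedBall (0 : ℂ) 1, f z ⬝ᵥ f z = 1) :
    ∃ μ : ℂ → R3, ContDiffOn ℝ ∞ μ (Metric.closedBall 0 1) ∧
      (∀ z ∈ Metric.closedBall (0 : ℂ) 1, μ z ⬝ᵥ μ z = 1) ∧
      ∀ z ∈ Metric.closedBall (0 : ℂ) 1, f z ⬝ᵥ μ z = 0 := by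
  have hmaps : ∀ r ∈ Icc (0 : ℝ) 1, ∀ z ∈ Metric.closedBall (0 : ℂ) 1,
      r • z ∈ Metric.closedBall (0 : ℂ) 1 := by
    intro r hr z hz
    rw [mem_closedBall_zero_iff] at *
    rw [norm_smul, Real.norm_of_nonneg hr.1]
    exact mul_le_one₀ hr.2 (norm_nonneg z) hz
  -- The homotopy `f (r • z)` joins the constant map `f 0` to `f`; a fixed vector normal to `f 0` is
  -- transported along it.
  obtain ⟨N, hN, hpos⟩ := exists_subdivision_pos (isCompact_closedBall (0 : ℂ) 1)
    (D := fun r r' z => f (r • z) ⬝ᵥ f (r' • z)) (by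
      refine ContinuousOn.dotProduct' (hf.continuousOn.comp (by fun_prop) ?_)
        (hf.continuousOn.comp (by fun_prop) ?_)
      · exact fun p hp => hmaps _ hp.1 _ hp.2.2
      · exact fun p hp => hmaps _ hp.2.1 _ hp.2.2)
    (fun r hr z hz => by rw [h1 _ (hmaps r hr z hz)]; exact one_pos)
  obtain ⟨v, hv1, hv0⟩ := exists_unit_normal (f 0)
  obtain ⟨μ, hμ, hμ1, hμ0, -, -⟩ := exists_normal_transport (H := fun r z => f (r • z)) hN
    (fun r hr => hf.comp (contDiff_const_smul r).contDiffOn (hmaps r hr))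
    (fun r hr z hz => h1 _ (hmaps r hr z hz)) hpos (ν := fun _ => v) contDiffOn_const
    (fun _ _ => hv1) (fun z _ => by simpa using hv0)
  exact ⟨μ, hμ, hμ1, by simpa using hμ0⟩

/-- The point `r e^{2πis}` of the plane. -/
noncomputable def polarPoint (p : ℝ × ℝ) : ℂ := p.2 • Complex.exp (2 * Real.pi * p.1 * Complex.I)

theorem contDiff_polarPoint : ContDiff ℝ ∞ polarPoint := by
  have h : ContDiff ℝ ∞ fun p : ℝ × ℝ => (p.1 : ℂ) := Complex.ofRealCLM.contDiff.comp contDiff_fst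
  exact contDiff_snd.smul ((contDiff_const.mul h).mul contDiff_const).cexp

theorem norm_exp_turn (s : ℝ) : ‖Complex.exp (2 * Real.pi * s * Complex.I)‖ = 1 := by
  have := Complex.norm_exp_ofReal_mul_I (2 * Real.pi * s)
  push_cast at this
  exact this

theorem exp_turn_add_one (s : ℝ) : Complex.exp (2 * Real.pi * (s + 1 : ℝ) * Complex.I) =
    Complex.exp (2 * Real.pi * s * Complex.I) := by
  rw [← Complex.exp_periodic (2 * Real.pi * s * Complex.I)]
  push_cast
  ring_nf

theorem norm_polarPoint (p : ℝ × ℝ) : ‖polarPoint p‖ = |p.2| := by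
  rw [polarPoint, norm_smul, norm_exp_turn, mul_one, Real.norm_eq_abs]

theorem polarPoint_mem {p : ℝ × ℝ} (hp : p.2 ∈ Icc (0 : ℝ) 1) :
    polarPoint p ∈ Metric.closedBall (0 : ℂ) 1 := by
  rw [mem_closedBall_zero_iff, norm_polarPoint, abs_of_nonneg hp.1]
  exact hp.2

theorem polarPoint_add_one (s r : ℝ) : polarPoint (s + 1, r) = polarPoint (s, r) := by
  simp only [polarPoint, exp_turn_add_one]

theorem polarPoint_one (s : ℝ) : polarPoint (s, 1) = Complex.exp (2 * Real.pi * s * Complex.I) := by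
  simp [polarPoint]

theorem polarPoint_zero (s : ℝ) : polarPoint (s, 0) = 0 := by
  simp [polarPoint]

theorem hasDerivAt_polarPoint_fst (s r : ℝ) : HasDerivAt (fun s => polarPoint (s, r))
    ((2 * Real.pi * r) • (Complex.I * Complex.exp (2 * Real.pi * s * Complex.I))) s := by
  have h1 : HasDerivAt (fun s : ℝ => (2 * Real.pi * s * Complex.I : ℂ))
      (2 * Real.pi * 1 * Complex.I) s :=
    ((Complex.ofRealCLM.hasDerivAt (x := s)).const_mul (2 * Real.pi : ℂ)).mul_const Complex.I
  refine (h1.cexp.const_smul r).congr_deriv ?_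
  simp only [Complex.real_smul]
  push_cast
  ring

theorem hasDerivAt_polarPoint_snd (s r : ℝ) : HasDerivAt (fun r => polarPoint (s, r))
    (Complex.exp (2 * Real.pi * s * Complex.I)) r := by
  simpa [polarPoint] using (hasDerivAt_id r).smul_const (Complex.exp (2 * Real.pi * s * Complex.I))

/-- Here `u`, `v` stand for the derivatives in the directions `1`, `I`, and the two combinations for
those in angle and radius. The minus sign records that the order `(s, r)` reverses the orientation.
-/
theorem triple_rotated (a u v : R3) (c s k : ℝ) :
    triple a (k • ((-s) • u + c • v)) (c • u + s • v) = -(k * (c ^ 2 + s ^ 2) * triple a u v) := by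
  simp [triple, dotProduct, Fin.sum_univ_three, cross_apply]
  ring

/-- The area form in polar coordinates. -/
theorem pullbackArea_polar {f : ℂ → R3} {s r : ℝ}
    (hf : DifferentiableAt ℝ f (polarPoint (s, r))) :
    pullbackArea (fun s r => f (polarPoint (s, r))) s r = -(2 * Real.pi * r *
      triple (f (polarPoint (s, r))) (fderiv ℝ f (polarPoint (s, r)) 1)
        (fderiv ℝ f (polarPoint (s, r)) Complex.I)) := by
  have h1 := hf.hasFDerivAt.comp_hasDerivAt s (hasDerivAt_polarPoint_fst s r)
  have h2 := hf.hasFDerivAt.comp_hasDerivAt r (hasDerivAt_polarPoint_snd s r)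
  have e1 : Complex.exp (2 * Real.pi * s * Complex.I) = (Real.cos (2 * Real.pi * s)) • (1 : ℂ) +
      (Real.sin (2 * Real.pi * s)) • Complex.I := by
    rw [Complex.exp_mul_I]
    simp
  have e2 : Complex.I * Complex.exp (2 * Real.pi * s * Complex.I) =
      (-Real.sin (2 * Real.pi * s)) • (1 : ℂ) + (Real.cos (2 * Real.pi * s)) • Complex.I := by
    rw [e1]
    simp only [Complex.real_smul]
    linear_combination (Real.sin (2 * Real.pi * s) : ℂ) * Complex.I_mul_I +
      (Complex.ofReal_neg (Real.sin (2 * Real.pi * s))) * (-1)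
  simp only [pullbackArea]
  rw [show deriv (fun x => f (polarPoint (x, r))) s = _ from h1.deriv,
    show deriv (fun y => f (polarPoint (s, y))) r = _ from h2.deriv, e2, e1]
  simp only [map_add, map_smul]
  rw [triple_rotated, Real.cos_sq_add_sin_sq, mul_one]

theorem continuousOn_triple {E : Type*} [TopologicalSpace E] {S : Set E} {a b c : E → R3}
    (ha : ContinuousOn a S) (hb : ContinuousOn b S) (hc : ContinuousOn c S) :
    ContinuousOn (fun z => triple (a z) (b z) (c z)) S := by
  have ha' := continuousOn_pi.1 ha
  have hb' := continuousOn_pi.1 hb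
  have hc' := continuousOn_pi.1 hc
  simp [triple, dotProduct, Fin.sum_univ_three, cross_apply]
  fun_prop (disch := assumption)

/-- The sign comes from listing the angle before the radius. The density formed with derivatives
within the closed disc is continuous up to the circle, which makes Fubini applicable. -/
theorem discArea_eq_integral_polar {f : ℂ → R3}
    (hf : ContDiffOn ℝ ∞ f (Metric.closedBall 0 1)) :
    ∫ s in (0 : ℝ)..1, ∫ r in (0 : ℝ)..1, pullbackArea (fun s r => f (polarPoint (s, r))) s r =
      -discArea f := by
  set D := Metric.closedBall (0 : ℂ) 1 with hD
  have hud : UniqueDiffOn ℝ D := uniqueDiffOn_closedDisc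
  set k : ℂ → ℝ := fun z =>
    triple (f z) (fderivWithin ℝ f D z 1) (fderivWithin ℝ f D z Complex.I) with hk
  have hkc : ContinuousOn k D := by
    have h' := hf.continuousOn_fderivWithin hud (by simp)
    exact continuousOn_triple hf.continuousOn (h'.clm_apply continuousOn_const)
      (h'.clm_apply continuousOn_const)
  have hnhds : ∀ z ∈ Metric.ball (0 : ℂ) 1, D ∈ nhds z := fun z hz =>
    Filter.mem_of_superset (Metric.isOpen_ball.mem_nhds hz) Metric.ball_subset_closedBall
  have harea : discArea f = ∫ z in Metric.ball (0 : ℂ) 1, k z := by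
    refine MeasureTheory.setIntegral_congr_fun measurableSet_ball fun z hz => ?_
    simp only [hk, fderivWithin_of_mem_nhds (hnhds z hz)]
  have hpol : ∫ z in Metric.ball (0 : ℂ) 1, k z =
      ∫ p in Ioo (0 : ℝ) 1 ×ˢ Ioo (-Real.pi) Real.pi, p.1 * k (Complex.polarCoord.symm p) := by
    rw [← MeasureTheory.integral_indicator measurableSet_ball,
      ← Complex.integral_comp_polarCoord_symm]
    have h1 : ∀ p ∈ polarCoord.target,
        p.1 • (Metric.ball (0 : ℂ) 1).indicator k (Complex.polarCoord.symm p) =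
        (Iio (1 : ℝ) ×ˢ univ).indicator (fun p => p.1 * k (Complex.polarCoord.symm p)) p := by
      intro p hp
      have hp0 : 0 < p.1 := hp.1
      by_cases h : p.1 < 1
      · rw [indicator_of_mem (by rwa [mem_ball_zero_iff, Complex.norm_polarCoord_symm,
          abs_of_pos hp0]), indicator_of_mem (mem_prod.2 ⟨h, mem_univ _⟩),
          smul_eq_mul]
      · rw [indicator_of_notMem (by rwa [mem_ball_zero_iff, Complex.norm_polarCoord_symm,
          abs_of_pos hp0]), indicator_of_notMem (fun h' => h h'.1), smul_zero]
    rw [MeasureTheory.setIntegral_congr_fun polarCoord.open_target.measurableSet h1,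
      MeasureTheory.setIntegral_indicator (measurableSet_Iio.prod MeasurableSet.univ)]
    congr 2
    rw [polarCoord_target, prod_inter_prod, inter_univ, Ioi_inter_Iio]
  have hcont : ContinuousOn (fun p : ℝ × ℝ => p.2 * k (polarPoint p)) (univ ×ˢ Icc 0 1) :=
    continuousOn_snd.mul (hkc.comp contDiff_polarPoint.continuous.continuousOn
      fun p hp => polarPoint_mem hp.2)
  have hsymm : ∀ p : ℝ × ℝ, Complex.polarCoord.symm p = polarPoint (p.2 / (2 * Real.pi), p.1) := by
    intro p
    have h : (2 * Real.pi * (p.2 / (2 * Real.pi) : ℝ) : ℂ) = p.2 := by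
      push_cast
      field_simp
    rw [polarPoint, h, Complex.polarCoord_symm_apply, Complex.exp_mul_I, Complex.real_smul]
    simp
  have hiter : ∫ p in Ioo (0 : ℝ) 1 ×ˢ Ioo (-Real.pi) Real.pi,
      p.1 * k (Complex.polarCoord.symm p) =
      ∫ θ in (-Real.pi)..Real.pi, ∫ r in (0 : ℝ)..1, r * k (polarPoint (θ / (2 * Real.pi), r)) := by
    have hc : ContinuousOn (fun p : ℝ × ℝ => p.2 * k (polarPoint (p.1 / (2 * Real.pi), p.2)))
        (Icc (-Real.pi) Real.pi ×ˢ Icc 0 1) :=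
      hcont.comp (f := fun p : ℝ × ℝ => (p.1 / (2 * Real.pi), p.2))
        (Continuous.continuousOn (by fun_prop)) fun p hp => ⟨mem_univ _, hp.2⟩
    have hint := (hc.integrableOn_compact (μ := MeasureTheory.volume)
      (isCompact_Icc.prod isCompact_Icc)).mono_set
      (prod_mono Ioo_subset_Icc_self Ioo_subset_Icc_self)
    rw [MeasureTheory.Measure.volume_eq_prod] at hint ⊢
    rw [← MeasureTheory.setIntegral_prod_swap]
    simp only [hsymm, Prod.fst_swap, Prod.snd_swap]
    rw [MeasureTheory.setIntegral_prod _ hint,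
      intervalIntegral.integral_of_le (by linarith [Real.pi_pos]),
      MeasureTheory.integral_Ioc_eq_integral_Ioo]
    simp only [intervalIntegral.integral_of_le zero_le_one,
      MeasureTheory.integral_Ioc_eq_integral_Ioo]
  set Ψ : ℝ → ℝ := fun s => ∫ r in (0 : ℝ)..1, r * k (polarPoint (s, r))
  have hper : Periodic Ψ 1 := fun s => by simp only [Ψ, polarPoint_add_one]
  -- The polar angle runs over `[-π, π]`, hence `s` over `[-1/2, 1/2]`; periodicity moves this to
  -- `[0, 1]`.
  have hsub : ∫ θ in (-Real.pi)..Real.pi, Ψ (θ / (2 * Real.pi)) =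
      (2 * Real.pi) * ∫ s in (0 : ℝ)..1, Ψ s := by
    rw [intervalIntegral.integral_comp_div Ψ (by positivity)]
    have := hper.intervalIntegral_add_eq (-(1 / 2)) 0
    rw [smul_eq_mul]
    congr 1
    rw [zero_add] at this
    rw [← this]
    congr 1 <;> field_simp
    norm_num
  rw [harea, hpol, hiter, hsub, ← intervalIntegral.integral_const_mul,
    ← intervalIntegral.integral_neg]
  refine intervalIntegral.integral_congr fun s _ => ?_
  simp only [Ψ]
  rw [← intervalIntegral.integral_const_mul, ← intervalIntegral.integral_neg]
  refine intervalIntegral.integral_congr_uIoo fun r hr => ?_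
  rw [uIoo_of_le zero_le_one] at hr
  have hz : polarPoint (s, r) ∈ Metric.ball (0 : ℂ) 1 := by
    rw [mem_ball_zero_iff, norm_polarPoint, abs_of_pos hr.1]
    exact hr.2
  rw [pullbackArea_polar ((hf.contDiffAt (hnhds _ hz)).differentiableAt (by simp))]
  simp only [hk, fderivWithin_of_mem_nhds (hnhds _ hz)]
  ring

/-- A swaddling map determines, up to homotopy, a framing with the same correction term: the
boundary values of a normal field over the disc. -/
theorem Swaddling.exists_framing {γ : ClosedCurve} (β : Swaddling γ) :
    ∃ (μ : ℂ → R3) (φ : Framing γ), ContDiffOn ℝ ∞ μ (Metric.closedBall 0 1) ∧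
      (∀ z ∈ Metric.closedBall (0 : ℂ) 1, μ z ⬝ᵥ μ z = 1) ∧
      (∀ z ∈ Metric.closedBall (0 : ℂ) 1, β.toFun z ⬝ᵥ μ z = 0) ∧
      (∀ s : ℝ, φ.normal s = μ (Complex.exp (2 * Real.pi * s * Complex.I))) ∧
      φ.tau = β.tau := by
  obtain ⟨μ, hμ, hμ1, hμ0⟩ := exists_normal_on_disc β.smooth β.unit
  have hmaps : MapsTo polarPoint (univ ×ˢ Icc 0 1) (Metric.closedBall (0 : ℂ) 1) :=
    fun p hp => polarPoint_mem hp.2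
  have hmem : ∀ s : ℝ, Complex.exp (2 * Real.pi * s * Complex.I) ∈ Metric.closedBall (0 : ℂ) 1 :=
    fun s => by rw [mem_closedBall_zero_iff, norm_exp_turn]
  have hX : ContDiffOn ℝ ∞ (fun p => μ (polarPoint p)) (univ ×ˢ Icc 0 1) :=
    hμ.comp contDiff_polarPoint.contDiffOn hmaps
  have hB : ContDiffOn ℝ ∞ (fun p => β.toFun (polarPoint p)) (univ ×ˢ Icc 0 1) :=
    β.smooth.comp contDiff_polarPoint.contDiffOn hmaps
  let φ : Framing γ :=
    { normal := fun s => μ (Complex.exp (2 * Real.pi * s * Complex.I))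
      smooth := by
        have h : ContDiff ℝ ∞ fun s : ℝ => polarPoint (s, 1) :=
          contDiff_polarPoint.comp (contDiff_id.prodMk contDiff_const)
        simp only [polarPoint_one] at h
        exact contDiffOn_univ.1 (hμ.comp h.contDiffOn fun s _ => hmem s)
      periodic := fun s => by simp only [exp_turn_add_one]
      unit := fun s => hμ1 _ (hmem s)
      orthogonal := fun s => by rw [← β.boundary]; exact hμ0 _ (hmem s) }
  refine ⟨μ, φ, hμ, hμ1, hμ0, fun s => rfl, ?_⟩
  -- The edge `r = 0` collapses to a point and contributes nothing; the edge `r = 1` is the integral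
  -- in `τ`, and its sign cancels that of the polar area.
  have stokes := integral_pullbackArea_strip one_pos hB hX (fun p hp => β.unit _ (hmaps hp))
    (fun p hp => hμ1 _ (hmaps hp)) (fun p hp => hμ0 _ (hmaps hp))
    (fun t _ x => by simp only [polarPoint_add_one])
    (fun t _ x => by simp only [polarPoint_add_one])
  simp only [discArea_eq_integral_polar β.smooth, polarPoint_zero, deriv_const', dotProduct_zero,
    intervalIntegral.integral_zero, polarPoint_one, β.boundary, zero_sub, neg_inj] at stokes
  rw [Framing.tau, Swaddling.tau, stokes]
  congr 1
  exact intervalIntegral.integral_congr fun s _ => dotProduct_comm _ _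

/-! ### Lifting frames to unit quaternions. -/

/-- The orthonormal frame `(q i q̄, q j q̄, q k q̄)` of a unit quaternion `q`, as the rows of a
matrix. -/
def quatFrame (q : Fin 4 → ℝ) : Matrix (Fin 3) (Fin 3) ℝ :=
  !![q 0 ^ 2 + q 1 ^ 2 - q 2 ^ 2 - q 3 ^ 2, 2 * (q 1 * q 2 + q 0 * q 3),
      2 * (q 1 * q 3 - q 0 * q 2);
    2 * (q 1 * q 2 - q 0 * q 3), q 0 ^ 2 - q 1 ^ 2 + q 2 ^ 2 - q 3 ^ 2,
      2 * (q 2 * q 3 + q 0 * q 1);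
    2 * (q 1 * q 3 + q 0 * q 2), 2 * (q 2 * q 3 - q 0 * q 1),
      q 0 ^ 2 - q 1 ^ 2 - q 2 ^ 2 + q 3 ^ 2]

/-- The matrix `q qᵀ` expressed by the frame of the unit quaternion `q`. -/
noncomputable def quatSquare (M : Matrix (Fin 3) (Fin 3) ℝ) : Matrix (Fin 4) (Fin 4) ℝ :=
  (1 / 4 : ℝ) • !![1 + M 0 0 + M 1 1 + M 2 2, M 1 2 - M 2 1, M 2 0 - M 0 2, M 0 1 - M 1 0;
    M 1 2 - M 2 1, 1 + M 0 0 - M 1 1 - M 2 2, M 0 1 + M 1 0, M 2 0 + M 0 2;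
    M 2 0 - M 0 2, M 0 1 + M 1 0, 1 - M 0 0 + M 1 1 - M 2 2, M 1 2 + M 2 1;
    M 0 1 - M 1 0, M 2 0 + M 0 2, M 1 2 + M 2 1, 1 - M 0 0 - M 1 1 + M 2 2]

/-- The unit quaternion `q` lifts the frame `M`. -/
def IsLift (q : Fin 4 → ℝ) (M : Matrix (Fin 3) (Fin 3) ℝ) : Prop :=
  q ⬝ᵥ q = 1 ∧ quatFrame q = M

theorem quatFrame_neg (q : Fin 4 → ℝ) : quatFrame (-q) = quatFrame q := by
  simp [quatFrame]

theorem IsLift.neg {q : Fin 4 → ℝ} {M : Matrix (Fin 3) (Fin 3) ℝ} (h : IsLift q M) :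
    IsLift (-q) M :=
  ⟨by simpa using h.1, by rw [quatFrame_neg, h.2]⟩

theorem quatFrame_mem {q : Fin 4 → ℝ} (hq : q ⬝ᵥ q = 1) :
    quatFrame q ∈ Matrix.specialOrthogonalGroup (Fin 3) ℝ := by
  simp only [dotProduct, Fin.sum_univ_four] at hq
  have h2 : (q 0 * q 0 + q 1 * q 1 + q 2 * q 2 + q 3 * q 3) ^ 2 = 1 := by rw [hq, one_pow]
  have h3 : (q 0 * q 0 + q 1 * q 1 + q 2 * q 2 + q 3 * q 3) ^ 3 = 1 := by rw [hq, one_pow]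
  rw [Matrix.mem_specialOrthogonalGroup_iff, Matrix.mem_orthogonalGroup_iff]
  constructor
  · ext i j
    fin_cases i <;> fin_cases j <;>
      simp [Matrix.mul_apply, Fin.sum_univ_three, quatFrame] <;>
      first | ring1 | linear_combination h2
  · rw [Matrix.det_fin_three]
    simp [quatFrame]
    linear_combination h3

theorem IsLift.square_apply {q : Fin 4 → ℝ} {M : Matrix (Fin 3) (Fin 3) ℝ} (h : IsLift q M)
    (a b : Fin 4) : quatSquare M a b = q a * q b := by
  obtain ⟨hq, rfl⟩ := h
  simp only [dotProduct, Fin.sum_univ_four] at hq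
  fin_cases a <;> fin_cases b <;> simp [quatSquare, quatFrame] <;>
    first | ring1 | linear_combination (-1 / 4 : ℝ) * hq

theorem IsLift.square_mulVec {q v : Fin 4 → ℝ} {M : Matrix (Fin 3) (Fin 3) ℝ}
    (h : IsLift q M) : quatSquare M *ᵥ v = (q ⬝ᵥ v) • q := by
  ext a
  simp only [Matrix.mulVec, dotProduct, h.square_apply, Pi.smul_apply, smul_eq_mul, Finset.sum_mul]
  exact Finset.sum_congr rfl fun b _ => by ring

/-- The symmetric matrix `quatSquare M` has trace one and rank one, hence is `q qᵀ` for its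
normalised row through a positive diagonal entry. The quadratic relations behind the rank come from
`M Mᵀ = Mᵀ M = 1` and from `adj M = Mᵀ`, where `det M = 1` enters. -/
theorem exists_isLift {M : Matrix (Fin 3) (Fin 3) ℝ}
    (hM : M ∈ Matrix.specialOrthogonalGroup (Fin 3) ℝ) : ∃ q, IsLift q M := by
  have hO := (Matrix.mem_specialOrthogonalGroup_iff.1 hM).1
  have h1 := (Matrix.mem_orthogonalGroup_iff (Fin 3) ℝ).1 hO
  have h2 := (Matrix.mem_orthogonalGroup_iff' (Fin 3) ℝ).1 hO
  have hdet := (Matrix.mem_specialOrthogonalGroup_iff.1 hM).2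
  have hadj : M.adjugate = Mᵀ := by
    have h3 : M * M.adjugate = 1 := by rw [Matrix.mul_adjugate, hdet, one_smul]
    have h4 : Mᵀ * M = 1 := h2
    calc M.adjugate = (Mᵀ * M) * M.adjugate := by rw [h4, one_mul]
      _ = Mᵀ := by rw [mul_assoc, h3, mul_one]
  have e1 : ∀ i j, M i 0 * M j 0 + M i 1 * M j 1 + M i 2 * M j 2 = if i = j then 1 else 0 := by
    intro i j
    have := congrFun (congrFun h1 i) j
    simpa [Matrix.mul_apply, Fin.sum_univ_three, Matrix.one_apply] using this
  have e2 : ∀ i j, M 0 i * M 0 j + M 1 i * M 1 j + M 2 i * M 2 j = if i = j then 1 else 0 := by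
    intro i j
    have := congrFun (congrFun h2 i) j
    simpa [Matrix.mul_apply, Fin.sum_univ_three, Matrix.one_apply] using this
  have e3 : ∀ i j, M.adjugate i j = M j i := fun i j => by rw [hadj, Matrix.transpose_apply]
  rw [Matrix.adjugate_fin_three] at e3
  simp only [Fin.forall_fin_succ, Fin.isValue, Fin.succ_zero_eq_one, Fin.succ_one_eq_two,
    IsEmpty.forall_iff, and_true] at e1 e2 e3
  simp at e1 e2 e3
  have minors : ∀ a b c, quatSquare M a b * quatSquare M a c =
      quatSquare M a a * quatSquare M b c := by
    obtain ⟨⟨a00, a01, a02⟩, ⟨a10, a11, a12⟩, a20, a21, a22⟩ := e1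
    obtain ⟨⟨b00, b01, b02⟩, ⟨b10, b11, b12⟩, b20, b21, b22⟩ := e2
    obtain ⟨⟨c00, c01, c02⟩, ⟨c10, c11, c12⟩, c20, c21, c22⟩ := e3
    clear h1 h2 hdet hadj hO hM
    intro a b c
    fin_cases a <;> fin_cases b <;> fin_cases c <;>
      simp only [quatSquare, Matrix.smul_apply, Matrix.of_apply, Matrix.cons_val', Matrix.cons_val,
        smul_eq_mul, Fin.reduceFinMk, Fin.zero_eta, Fin.mk_one] <;>
      generalize M 0 0 = m00, M 0 1 = m01, M 0 2 = m02, M 1 0 = m10, M 1 1 = m11, M 1 2 = m12,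
        M 2 0 = m20, M 2 1 = m21, M 2 2 = m22 at * <;>
      first | ring1 | grind only
  have htr : quatSquare M 0 0 + quatSquare M 1 1 + quatSquare M 2 2 + quatSquare M 3 3 = 1 := by
    simp [quatSquare]
    ring
  obtain ⟨a, ha⟩ : ∃ a, 0 < quatSquare M a a := by
    by_contra! h
    linarith [h 0, h 1, h 2, h 3]
  have hs := Real.mul_self_sqrt ha.le
  have hs0 := (Real.sqrt_pos.2 ha).ne'
  have hq : ∀ b c, (quatSquare M a b / Real.sqrt (quatSquare M a a)) *
      (quatSquare M a c / Real.sqrt (quatSquare M a a)) = quatSquare M b c := by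
    intro b c
    rw [div_mul_div_comm, hs, minors, mul_div_cancel_left₀ _ ha.ne']
  refine ⟨fun b => quatSquare M a b / Real.sqrt (quatSquare M a a), ?_, ?_⟩
  · simp only [dotProduct, Fin.sum_univ_four, hq, htr]
  · ext i j
    fin_cases i <;> fin_cases j <;> simp [quatFrame, pow_two, hq] <;> simp [quatSquare] <;> ring

/-- Both lifts have the same matrix `q qᵀ = p pᵀ`, which is applied to `q`. -/
theorem IsLift.eq_smul {p q : Fin 4 → ℝ} {M : Matrix (Fin 3) (Fin 3) ℝ} (hp : IsLift p M)
    (hq : IsLift q M) : q = (p ⬝ᵥ q) • p := by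
  rw [← hp.square_mulVec, hq.square_mulVec, hq.1, one_smul]

theorem IsLift.dot_eq {p q : Fin 4 → ℝ} {M : Matrix (Fin 3) (Fin 3) ℝ} (hp : IsLift p M)
    (hq : IsLift q M) : p ⬝ᵥ q = 1 ∨ p ⬝ᵥ q = -1 := by
  have h := hq.1
  rw [hp.eq_smul hq] at h
  simp only [smul_dotProduct, dotProduct_smul, smul_eq_mul, hp.1, mul_one] at h
  exact mul_self_eq_one_iff.1 h

/-- The vector `quatSquare M *ᵥ v` is the orthogonal projection of `v` to the line of the two lifts,
so its direction is the lift nearer to `v`. This formula continues a lift from one frame to nearby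
ones. -/
theorem isLift_direction {M : Matrix (Fin 3) (Fin 3) ℝ} {v : Fin 4 → ℝ}
    (hM : M ∈ Matrix.specialOrthogonalGroup (Fin 3) ℝ) (hv : quatSquare M *ᵥ v ≠ 0) :
    IsLift (direction (quatSquare M *ᵥ v)) M := by
  obtain ⟨p, hp⟩ := exists_isLift hM
  rw [hp.square_mulVec] at hv ⊢
  rcases lt_trichotomy (p ⬝ᵥ v) 0 with h | h | h
  · rw [← neg_neg ((p ⬝ᵥ v) • p), ← neg_smul, direction_neg, direction_smul (by linarith),
      direction_of_unit hp.1]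
    exact hp.neg
  · simp [h] at hv
  · rw [direction_smul h, direction_of_unit hp.1]
    exact hp

theorem continuousOn_quatSquare_mulVec {E : Type*} [TopologicalSpace E] {K : Set E}
    {f : E → Matrix (Fin 3) (Fin 3) ℝ} {v : E → Fin 4 → ℝ} (hf : ContinuousOn f K)
    (hv : ContinuousOn v K) : ContinuousOn (fun z => quatSquare (f z) *ᵥ v z) K := by
  have hf' : ∀ i j, ContinuousOn (fun z => f z i j) K := fun i j =>
    continuousOn_pi.1 (continuousOn_pi.1 hf i) j
  have hv' := continuousOn_pi.1 hv
  refine continuousOn_pi.2 fun a => ?_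
  fin_cases a <;> simp [quatSquare, Matrix.mulVec, dotProduct, Fin.sum_univ_four] <;>
    fun_prop (disch := assumption)

/-- The square of the scalar product of lifts of two frames. -/
noncomputable def liftOverlap (M M' : Matrix (Fin 3) (Fin 3) ℝ) : ℝ :=
  ∑ a, ∑ b, quatSquare M a b * quatSquare M' a b

theorem liftOverlap_eq {v : Fin 4 → ℝ} {M M' : Matrix (Fin 3) (Fin 3) ℝ} (hv : IsLift v M) :
    liftOverlap M M' = v ⬝ᵥ quatSquare M' *ᵥ v := by
  simp only [liftOverlap, hv.square_apply, dotProduct, Matrix.mulVec, Finset.mul_sum]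
  exact Finset.sum_congr rfl fun a _ => Finset.sum_congr rfl fun b _ => by ring

theorem liftOverlap_self {M : Matrix (Fin 3) (Fin 3) ℝ}
    (hM : M ∈ Matrix.specialOrthogonalGroup (Fin 3) ℝ) : liftOverlap M M = 1 := by
  obtain ⟨p, hp⟩ := exists_isLift hM
  rw [liftOverlap_eq hp, hp.square_mulVec, hp.1, one_smul, hp.1]

/-- A continuous family of frames over a compact star-convex set lifts to unit quaternions. -/
theorem exists_continuousOn_lift {E : Type*} [NormedAddCommGroup E] [NormedSpace ℝ E] {K : Set E}
    (hK : IsCompact K) (hs : StarConvex ℝ 0 K) (h0 : (0 : E) ∈ K)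
    {f : E → Matrix (Fin 3) (Fin 3) ℝ} (hf : ContinuousOn f K)
    (hf1 : ∀ z ∈ K, f z ∈ Matrix.specialOrthogonalGroup (Fin 3) ℝ) :
    ∃ q : E → Fin 4 → ℝ, ContinuousOn q K ∧ ∀ z ∈ K, IsLift (q z) (f z) := by
  have hmaps : ∀ r ∈ Icc (0 : ℝ) 1, ∀ z ∈ K, r • z ∈ K := fun r hr z hz =>
    hs.smul_mem hz hr.1 hr.2
  obtain ⟨N, hN, hpos⟩ := exists_subdivision_pos hK
    (D := fun r r' z => liftOverlap (f (r • z)) (f (r' • z))) (by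
      have h1 : ContinuousOn (fun p : ℝ × ℝ × E => f (p.1 • p.2.2)) (Icc 0 1 ×ˢ Icc 0 1 ×ˢ K) :=
        hf.comp (by fun_prop) fun p hp => hmaps _ hp.1 _ hp.2.2
      have h2 : ContinuousOn (fun p : ℝ × ℝ × E => f (p.2.1 • p.2.2)) (Icc 0 1 ×ˢ Icc 0 1 ×ˢ K) :=
        hf.comp (by fun_prop) fun p hp => hmaps _ hp.2.1 _ hp.2.2
      have hQ : ∀ {g : ℝ × ℝ × E → Matrix (Fin 3) (Fin 3) ℝ},
          ContinuousOn g (Icc 0 1 ×ˢ Icc 0 1 ×ˢ K) → ∀ a b,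
          ContinuousOn (fun p => quatSquare (g p) a b) (Icc 0 1 ×ˢ Icc 0 1 ×ˢ K) := by
        intro g hg a b
        have := continuousOn_pi.1
          (continuousOn_quatSquare_mulVec hg (continuousOn_const (c := Pi.single b 1))) a
        simpa using this
      exact continuousOn_finsetSum _ fun a _ => continuousOn_finsetSum _ fun b _ =>
        (hQ h1 a b).mul (hQ h2 a b))
    (fun r hr z hz => by rw [liftOverlap_self (hf1 _ (hmaps r hr z hz))]; exact one_pos)
  -- Lifts are propagated along rays, starting from a single lift of `f 0`: the lift at `k / N` is
  -- projected to the line of lifts at `(k + 1) / N`. Positive overlap keeps the projection from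
  -- vanishing.
  have key : ∀ k ≤ N, ∃ q : E → Fin 4 → ℝ, ContinuousOn q K ∧
      ∀ z ∈ K, IsLift (q z) (f (((k : ℝ) / N) • z)) := by
    intro k
    induction k with
    | zero =>
      obtain ⟨p, hp⟩ := exists_isLift (hf1 0 h0)
      exact fun _ => ⟨fun _ => p, continuousOn_const, fun z _ => by simpa using hp⟩
    | succ k ih =>
      intro hk
      obtain ⟨q, hq, hl⟩ := ih (by omega)
      have hr : ((k + 1 : ℕ) : ℝ) / N ∈ Icc (0 : ℝ) 1 :=
        ⟨by positivity, (div_le_one (by positivity)).2 (by exact_mod_cast hk)⟩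
      have hne : ∀ z ∈ K, quatSquare (f ((((k + 1 : ℕ) : ℝ) / N) • z)) *ᵥ q z ≠ 0 := by
        intro z hz h
        have := hpos k (by omega) z hz
        rw [liftOverlap_eq (hl z hz), h, dotProduct_zero] at this
        exact lt_irrefl _ this
      refine ⟨fun z => direction (quatSquare (f ((((k + 1 : ℕ) : ℝ) / N) • z)) *ᵥ q z), ?_,
        fun z hz => isLift_direction (hf1 _ (hmaps _ hr z hz)) (hne z hz)⟩
      exact (continuousOn_quatSquare_mulVec
        (hf.comp (by fun_prop) fun z hz => hmaps _ hr z hz) hq).direction hne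
  obtain ⟨q, hq, hl⟩ := key N le_rfl
  exact ⟨q, hq, fun z hz => by simpa [div_self (show (N : ℝ) ≠ 0 by positivity)] using hl z hz⟩

/-- The scalar product of two lifts is continuous with values `±1`, hence constant. -/
theorem IsPreconnected.lift_unique {E : Type*} [TopologicalSpace E] {K : Set E}
    (hK : IsPreconnected K) {f : E → Matrix (Fin 3) (Fin 3) ℝ} {p q : E → Fin 4 → ℝ}
    (hp : ContinuousOn p K) (hpf : ∀ z ∈ K, IsLift (p z) (f z))
    (hq : ContinuousOn q K) (hqf : ∀ z ∈ K, IsLift (q z) (f z)) :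
    ∃ ε : ℝ, (ε = 1 ∨ ε = -1) ∧ ∀ z ∈ K, q z = ε • p z := by
  rcases K.eq_empty_or_nonempty with rfl | ⟨w, hw⟩
  · exact ⟨1, Or.inl rfl, by simp⟩
  refine ⟨p w ⬝ᵥ q w, (hpf w hw).dot_eq (hqf w hw), fun z hz => ?_⟩
  have : p w ⬝ᵥ q w = p z ⬝ᵥ q z := by
    have hT : ({1, -1} : Set ℝ).Finite := by simp
    refine hK.constant_of_mapsTo hT.isDiscrete (hp.dotProduct' hq) (fun x hx => ?_) hw hz
    exact (hpf x hx).dot_eq (hqf x hx)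
  rw [this]
  exact (hpf z hz).eq_smul (hqf z hz)

/-- A loop of frames is even if it lifts to a loop of unit quaternions. -/
def IsEvenLoop (f : ℝ → Matrix (Fin 3) (Fin 3) ℝ) : Prop :=
  ∃ q : ℝ → Fin 4 → ℝ, ContinuousOn q (Icc 0 1) ∧ (∀ s ∈ Icc (0 : ℝ) 1, IsLift (q s) (f s)) ∧
    q 1 = q 0

theorem isEvenLoop_iff {f : ℝ → Matrix (Fin 3) (Fin 3) ℝ} {q : ℝ → Fin 4 → ℝ}
    (hq : ContinuousOn q (Icc 0 1)) (hqf : ∀ s ∈ Icc (0 : ℝ) 1, IsLift (q s) (f s)) :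
    IsEvenLoop f ↔ q 1 = q 0 := by
  refine ⟨?_, fun h => ⟨q, hq, hqf, h⟩⟩
  rintro ⟨p, hp, hpf, h⟩
  obtain ⟨ε, -, hε⟩ := isPreconnected_Icc.lift_unique hp hpf hq hqf
  rw [hε 1 (by simp), hε 0 (by simp), h]

theorem exists_path_lift {f : ℝ → Matrix (Fin 3) (Fin 3) ℝ} (hf : ContinuousOn f (Icc 0 1))
    (hf1 : ∀ s ∈ Icc (0 : ℝ) 1, f s ∈ Matrix.specialOrthogonalGroup (Fin 3) ℝ) :
    ∃ q : ℝ → Fin 4 → ℝ, ContinuousOn q (Icc 0 1) ∧ ∀ s ∈ Icc (0 : ℝ) 1, IsLift (q s) (f s) :=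
  exists_continuousOn_lift isCompact_Icc ((convex_Icc 0 1).starConvex (by simp)) (by simp) hf hf1

/-- The whole square is lifted. The sign relating the lifts on the sides `s = 0` and `s = 1` does
not depend on `r`, so the two end loops have the same parity. -/
theorem isEvenLoop_congr_of_homotopy {H : ℝ × ℝ → Matrix (Fin 3) (Fin 3) ℝ}
    (hH : ContinuousOn H (Icc 0 1 ×ˢ Icc 0 1))
    (hH1 : ∀ p ∈ Icc (0 : ℝ) 1 ×ˢ Icc (0 : ℝ) 1,
      H p ∈ Matrix.specialOrthogonalGroup (Fin 3) ℝ)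
    (hloop : ∀ r ∈ Icc (0 : ℝ) 1, H (r, 1) = H (r, 0)) :
    IsEvenLoop (fun s => H (0, s)) ↔ IsEvenLoop (fun s => H (1, s)) := by
  have h0 : (0 : ℝ × ℝ) ∈ Icc (0 : ℝ) 1 ×ˢ Icc (0 : ℝ) 1 := by
    rw [mem_prod]
    simp
  obtain ⟨q, hq, hqH⟩ := exists_continuousOn_lift (isCompact_Icc.prod isCompact_Icc)
    (((convex_Icc (0 : ℝ) 1).prod (convex_Icc (0 : ℝ) 1)).starConvex h0) h0 hH hH1
  have hm : ∀ r ∈ Icc (0 : ℝ) 1, ContinuousOn (fun s => q (r, s)) (Icc 0 1) := fun r hr =>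
    hq.comp (by fun_prop) fun s hs => ⟨hr, hs⟩
  have hl : ∀ r ∈ Icc (0 : ℝ) 1, ∀ s ∈ Icc (0 : ℝ) 1, IsLift (q (r, s)) (H (r, s)) :=
    fun r hr s hs => hqH _ ⟨hr, hs⟩
  have m0 : (0 : ℝ) ∈ Icc (0 : ℝ) 1 := by simp
  have m1 : (1 : ℝ) ∈ Icc (0 : ℝ) 1 := by simp
  rw [isEvenLoop_iff (hm 0 m0) (hl 0 m0), isEvenLoop_iff (hm 1 m1) (hl 1 m1)]
  have hc : ∀ s ∈ Icc (0 : ℝ) 1, ContinuousOn (fun r => q (r, s)) (Icc 0 1) := fun s hs =>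
    hq.comp (by fun_prop) fun r hr => ⟨hr, hs⟩
  obtain ⟨ε, hε, h⟩ := isPreconnected_Icc.lift_unique (f := fun r => H (r, 0)) (hc 0 m0)
    (fun r hr => hl r hr 0 m0) (hc 1 m1) (fun r hr => hloop r hr ▸ hl r hr 1 m1)
  have hne : ∀ r ∈ Icc (0 : ℝ) 1, q (r, 0) ≠ 0 := fun r hr =>
    ne_zero_of_dotProduct_self_eq_one (hl r hr 0 m0).1
  rw [h 0 m0, h 1 m1]
  rcases hε with rfl | rfl
  · simp
  · simp only [neg_smul, one_smul, neg_eq_self, hne 0 m0, hne 1 m1]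

/-! ### Angle functions and rotations of framings. -/

theorem contDiff_integral_of_contDiff {g : ℝ → ℝ} (hg : ContDiff ℝ ∞ g) (c : ℝ) :
    ContDiff ℝ ∞ fun s => c + ∫ u in (0 : ℝ)..s, g u := by
  have hd : ∀ s, HasDerivAt (fun s => c + ∫ u in (0 : ℝ)..s, g u) (g s) s := fun s =>
    (intervalIntegral.integral_hasDerivAt_right (hg.continuous.intervalIntegrable _ _)
      (hg.continuous.stronglyMeasurableAtFilter _ _) hg.continuous.continuousAt).const_add c
  rw [contDiff_infty_iff_deriv]
  refine ⟨fun s => (hd s).differentiableAt, ?_⟩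
  rwa [show deriv (fun s => c + ∫ u in (0 : ℝ)..s, g u) = g from funext fun s => (hd s).deriv]

/-- A smooth path in the unit circle has a smooth angle function. -/
theorem exists_angle {x y : ℝ → ℝ} (hx : ContDiff ℝ ∞ x) (hy : ContDiff ℝ ∞ y)
    (h : ∀ s, x s ^ 2 + y s ^ 2 = 1) :
    ∃ θ : ℝ → ℝ, ContDiff ℝ ∞ θ ∧ (∀ s, x s = Real.cos (θ s)) ∧ ∀ s, y s = Real.sin (θ s) := by
  have hx' : ContDiff ℝ ∞ (deriv x) := (contDiff_infty_iff_deriv.1 hx).2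
  have hy' : ContDiff ℝ ∞ (deriv y) := (contDiff_infty_iff_deriv.1 hy).2
  have dx : ∀ s, HasDerivAt x (deriv x s) s := fun s =>
    (hx.differentiable (by simp) s).hasDerivAt
  have dy : ∀ s, HasDerivAt y (deriv y s) s := fun s =>
    (hy.differentiable (by simp) s).hasDerivAt
  -- `g` is the angular speed, and the angle is its primitive starting at an argument of `(x 0, y
  -- 0)`. The scalar product of `(x, y)` with `(cos θ, sin θ)` is then constantly `1`, so the two
  -- unit vectors coincide.
  set g : ℝ → ℝ := fun s => x s * deriv y s - y s * deriv x s
  have hg : ContDiff ℝ ∞ g := (hx.mul hy').sub (hy.mul hx')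
  obtain ⟨c, hc1, hc2⟩ : ∃ c : ℝ, x 0 = Real.cos c ∧ y 0 = Real.sin c := by
    have hn : ‖(⟨x 0, y 0⟩ : ℂ)‖ = 1 := by
      rw [Complex.norm_def, Complex.normSq_mk, Real.sqrt_eq_one, ← h 0]
      ring
    refine ⟨Complex.arg ⟨x 0, y 0⟩, ?_, ?_⟩
    · rw [Complex.cos_arg (by rw [← norm_ne_zero_iff, hn]; exact one_ne_zero), hn, div_one]
    · rw [Complex.sin_arg, hn, div_one]
  set θ : ℝ → ℝ := fun s => c + ∫ u in (0 : ℝ)..s, g u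
  have hθ : ContDiff ℝ ∞ θ := contDiff_integral_of_contDiff hg c
  have dθ : ∀ s, HasDerivAt θ (g s) s := fun s =>
    (intervalIntegral.integral_hasDerivAt_right (hg.continuous.intervalIntegrable _ _)
      (hg.continuous.stronglyMeasurableAtFilter _ _) hg.continuous.continuousAt).const_add c
  have hxy : ∀ s, x s * deriv x s + y s * deriv y s = 0 := by
    intro s
    have h1 := (((dx s).pow 2).add ((dy s).pow 2)).unique
      ((hasDerivAt_const s (1 : ℝ)).congr_of_eventuallyEq (Filter.Eventually.of_forall h))
    simp at h1
    linarith
  have hθ0 : θ 0 = c := by simp [θ]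
  have h1 : ∀ s, x s * Real.cos (θ s) + y s * Real.sin (θ s) = 1 := by
    have hd : ∀ s, HasDerivAt (fun s => x s * Real.cos (θ s) + y s * Real.sin (θ s)) 0 s := by
      intro s
      refine (((dx s).mul (dθ s).cos).add ((dy s).mul (dθ s).sin)).congr_deriv ?_
      simp only [g]
      linear_combination (deriv x s * Real.cos (θ s) + deriv y s * Real.sin (θ s)) * (- h s) +
        (x s * Real.cos (θ s) + y s * Real.sin (θ s)) * hxy s
    intro s
    have := is_const_of_deriv_eq_zero (fun s => (hd s).differentiableAt) (fun s => (hd s).deriv) s 0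
    simp only [hθ0] at this
    rw [this, hc1, hc2, ← Real.cos_sq_add_sin_sq c]
    ring
  have h2 : ∀ s, (x s - Real.cos (θ s)) ^ 2 + (y s - Real.sin (θ s)) ^ 2 = 0 := by
    intro s
    linear_combination h s + Real.cos_sq_add_sin_sq (θ s) - 2 * h1 s
  refine ⟨θ, hθ, fun s => ?_, fun s => ?_⟩
  · nlinarith [h2 s, sq_nonneg (x s - Real.cos (θ s)), sq_nonneg (y s - Real.sin (θ s))]
  · nlinarith [h2 s, sq_nonneg (x s - Real.cos (θ s)), sq_nonneg (y s - Real.sin (θ s))]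

/-- A continuous function with values in `2πℤ` is constant. -/
theorem exists_int_of_cos_sin_eq {u v : ℝ → ℝ} (hu : Continuous u) (hv : Continuous v)
    (hc : ∀ s, Real.cos (u s) = Real.cos (v s)) (hs : ∀ s, Real.sin (u s) = Real.sin (v s)) :
    ∃ m : ℤ, ∀ s, u s = v s + 2 * Real.pi * m := by
  have h : ∀ s, ∃ m : ℤ, u s = v s + 2 * Real.pi * m := by
    intro s
    have : ((u s : Real.Angle)) = (v s : Real.Angle) := Real.Angle.cos_sin_inj (hc s) (hs s)
    obtain ⟨m, hm⟩ := Real.Angle.angle_eq_iff_two_pi_dvd_sub.1 this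
    exact ⟨m, by linarith⟩
  choose m hm using h
  have hmc : Continuous fun s => (m s : ℝ) := by
    have : (fun s => (m s : ℝ)) = fun s => (u s - v s) / (2 * Real.pi) := by
      funext s
      rw [hm s]
      field_simp
      ring
    rw [this]
    fun_prop
  have hmc' : Continuous m := Int.isClosedEmbedding_coe_real.isEmbedding.continuous_iff.2 hmc
  refine ⟨m 0, fun s => ?_⟩
  rw [hm s, PreconnectedSpace.constant inferInstance hmc' (x := s) (y := 0)]

theorem ClosedCurve.tangent_contDiff (γ : ClosedCurve) : ContDiff ℝ ∞ γ.tangent :=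
  contDiffOn_univ.1 ((contDiffOn_univ.2 (contDiff_infty_iff_deriv.1 γ.smooth).2).direction
    fun s _ => γ.regular s)

namespace Framing

variable {γ : ClosedCurve}

theorem binormal_contDiff (φ : Framing γ) : ContDiff ℝ ∞ φ.binormal :=
  contDiffOn_univ.1 ((contDiffOn_univ.2 γ.tangent_contDiff).cross (contDiffOn_univ.2 φ.smooth))

theorem binormal_unit (φ : Framing γ) (s : ℝ) : φ.binormal s ⬝ᵥ φ.binormal s = 1 := by
  rw [binormal, cross_dot_cross, γ.tangent_unit, φ.unit, φ.orthogonal]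
  simp

theorem normal_dot_binormal (φ : Framing γ) (s : ℝ) : φ.normal s ⬝ᵥ φ.binormal s = 0 :=
  dot_cross_self _ _

theorem tangent_dot_binormal (φ : Framing γ) (s : ℝ) : γ.tangent s ⬝ᵥ φ.binormal s = 0 :=
  dot_self_cross _ _

theorem binormal_periodic (φ : Framing γ) : Periodic φ.binormal 1 := fun s => by
  simp only [binormal, γ.tangent_periodic s, φ.periodic s]

theorem frameMatrix_continuous (φ : Framing γ) : Continuous φ.frameMatrix :=
  continuous_subtype_val.comp φ.frame_continuous

/-- The framing turned by the angle `θ` in the normal plane. -/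
noncomputable def rotate (φ : Framing γ) (θ : ℝ → ℝ) (hθ : ContDiff ℝ ∞ θ) (w : ℤ)
    (hw : ∀ s, θ (s + 1) = θ s + 2 * Real.pi * w) : Framing γ where
  normal s := Real.cos (θ s) • φ.normal s + Real.sin (θ s) • φ.binormal s
  smooth := (hθ.cos.smul φ.smooth).add (hθ.sin.smul φ.binormal_contDiff)
  periodic s := by
    beta_reduce
    rw [hw, show θ s + 2 * Real.pi * w = θ s + w * (2 * Real.pi) by ring,
      Real.cos_add_int_mul_two_pi, Real.sin_add_int_mul_two_pi, φ.periodic, φ.binormal_periodic]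
  unit s := by
    simp only [add_dotProduct, dotProduct_add, smul_dotProduct, dotProduct_smul, smul_eq_mul,
      φ.unit, φ.binormal_unit, φ.normal_dot_binormal,
      dotProduct_comm (φ.binormal s) (φ.normal s)]
    linear_combination Real.cos_sq_add_sin_sq (θ s)
  orthogonal s := by
    simp [φ.orthogonal, φ.tangent_dot_binormal]

theorem rotate_binormal (φ : Framing γ) {θ : ℝ → ℝ} {hθ : ContDiff ℝ ∞ θ} {w : ℤ}
    {hw : ∀ s, θ (s + 1) = θ s + 2 * Real.pi * w} (s : ℝ) :
    (φ.rotate θ hθ w hw).binormal s =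
      (-Real.sin (θ s)) • φ.normal s + Real.cos (θ s) • φ.binormal s := by
  have hT : γ.tangent s ⨯₃ φ.binormal s = -φ.normal s := by
    rw [binormal, cross_cross_eq_smul_sub_smul']
    simp [φ.orthogonal, γ.tangent_unit]
  change γ.tangent s ⨯₃ (Real.cos (θ s) • φ.normal s + Real.sin (θ s) • φ.binormal s) = _
  rw [map_add, map_smul, map_smul, hT, ← binormal]
  simp [add_comm]

theorem two_pi_mul_tau (φ : Framing γ) :
    2 * Real.pi * φ.tau = ∫ s in (0 : ℝ)..1, deriv φ.binormal s ⬝ᵥ φ.normal s := by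
  rw [tau]
  field_simp

/-- Pointwise `de₃ · e₂` changes by `-θ'`, and `θ` grows by `2πw` over a period. -/
theorem rotate_tau (φ : Framing γ) {θ : ℝ → ℝ} {hθ : ContDiff ℝ ∞ θ} {w : ℤ}
    {hw : ∀ s, θ (s + 1) = θ s + 2 * Real.pi * w} : (φ.rotate θ hθ w hw).tau = φ.tau - w := by
  have dn : ∀ s, HasDerivAt φ.normal (deriv φ.normal s) s := fun s =>
    (φ.smooth.differentiable (by simp) s).hasDerivAt
  have db : ∀ s, HasDerivAt φ.binormal (deriv φ.binormal s) s := fun s =>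
    (φ.binormal_contDiff.differentiable (by simp) s).hasDerivAt
  have dθ : ∀ s, HasDerivAt θ (deriv θ s) s := fun s =>
    (hθ.differentiable (by simp) s).hasDerivAt
  have hpt : ∀ s, deriv (φ.rotate θ hθ w hw).binormal s ⬝ᵥ (φ.rotate θ hθ w hw).normal s =
      deriv φ.binormal s ⬝ᵥ φ.normal s - deriv θ s := by
    intro s
    have hb : (φ.rotate θ hθ w hw).binormal = fun s =>
        (-Real.sin (θ s)) • φ.normal s + Real.cos (θ s) • φ.binormal s :=
      funext φ.rotate_binormal
    have hd := (((dθ s).sin.fun_neg).fun_smul (dn s)).fun_add ((dθ s).cos.fun_smul (db s))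
    rw [hb, hd.deriv]
    have hnn := (dn s).dot_const_eq (dn s) φ.unit
    have hbb := (db s).dot_const_eq (db s) φ.binormal_unit
    have hnb := (dn s).dot_const_eq (db s) φ.normal_dot_binormal
    simp only [rotate, add_dotProduct, dotProduct_add, smul_dotProduct, dotProduct_smul,
      smul_eq_mul, φ.unit, φ.binormal_unit, φ.normal_dot_binormal,
      dotProduct_comm (φ.binormal s), dotProduct_comm (φ.normal s)] at hnn hbb hnb ⊢
    have hcs := Real.cos_sq_add_sin_sq (θ s)
    grind
  have h2 : 2 * Real.pi * (φ.rotate θ hθ w hw).tau = 2 * Real.pi * φ.tau - 2 * Real.pi * w := by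
    rw [two_pi_mul_tau, two_pi_mul_tau]
    simp only [hpt]
    rw [intervalIntegral.integral_sub]
    · congr 1
      rw [intervalIntegral.integral_deriv_eq_sub (fun s _ => (dθ s).differentiableAt)
        ((hθ.continuous_deriv (by simp)).intervalIntegrable _ _)]
      have := hw 0
      rw [zero_add] at this
      rw [this]
      ring
    · have h1 := φ.binormal_contDiff.continuous_deriv (by simp)
      have h2 := φ.smooth.continuous
      exact (Continuous.dotProduct h1 h2).intervalIntegrable _ _
    · exact (hθ.continuous_deriv (by simp)).intervalIntegrable _ _
  have hpi := Real.pi_pos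
  nlinarith

/-- Any two framings differ by a rotation in the normal planes. -/
theorem exists_rotate (φ ψ : Framing γ) : ∃ (θ : ℝ → ℝ) (hθ : ContDiff ℝ ∞ θ) (w : ℤ)
    (hw : ∀ s, θ (s + 1) = θ s + 2 * Real.pi * w), ∀ s,
      ψ.normal s = (φ.rotate θ hθ w hw).normal s := by
  have h1 : ContDiff ℝ ∞ fun s => ψ.normal s ⬝ᵥ φ.normal s :=
    contDiffOn_univ.1 ((contDiffOn_univ.2 ψ.smooth).dotProduct (contDiffOn_univ.2 φ.smooth))
  have h2 : ContDiff ℝ ∞ fun s => ψ.normal s ⬝ᵥ φ.binormal s :=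
    contDiffOn_univ.1 ((contDiffOn_univ.2 ψ.smooth).dotProduct
      (contDiffOn_univ.2 φ.binormal_contDiff))
  obtain ⟨θ, hθ, hc, hs⟩ := exists_angle h1 h2 fun s =>
    normal_coords_sq (γ.tangent_unit s) (φ.unit s) (φ.orthogonal s) (ψ.orthogonal s) (ψ.unit s)
  obtain ⟨w, hw⟩ := exists_int_of_cos_sin_eq (u := fun s => θ (s + 1)) (v := θ)
    (hθ.continuous.comp (by fun_prop)) hθ.continuous
    (fun s => by rw [← hc, ← hc, ψ.periodic, φ.periodic])
    (fun s => by rw [← hs, ← hs, ψ.periodic, φ.binormal_periodic])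
  refine ⟨θ, hθ, w, hw, fun s => ?_⟩
  change _ = Real.cos (θ s) • φ.normal s + Real.sin (θ s) • φ.binormal s
  rw [← hc, ← hs]
  exact normal_expansion (γ.tangent_unit s) (φ.unit s) (φ.orthogonal s) (ψ.orthogonal s)

end Framing

/-! ### Turns and flips of frames on quaternions, and parity of framings. -/

/-- The frame `M` turned by the angle `θ` about its first vector. -/
noncomputable def turnFrame (M : Matrix (Fin 3) (Fin 3) ℝ) (θ : ℝ) : Matrix (Fin 3) (Fin 3) ℝ :=
  Matrix.of ![M 0, Real.cos θ • M 1 + Real.sin θ • M 2, (-Real.sin θ) • M 1 + Real.cos θ • M 2]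

/-- The frame `M` turned by the angle `π` about an axis in the plane of its last two vectors. -/
noncomputable def flipFrame (M : Matrix (Fin 3) (Fin 3) ℝ) (θ : ℝ) : Matrix (Fin 3) (Fin 3) ℝ :=
  Matrix.of ![-M 0, Real.cos θ • M 1 + Real.sin θ • M 2, Real.sin θ • M 1 - Real.cos θ • M 2]

/-- The product `q (cos α + sin α i)` of quaternions. -/
noncomputable def quatTurn (q : Fin 4 → ℝ) (α : ℝ) : Fin 4 → ℝ :=
  Real.cos α • q + Real.sin α • ![-q 1, q 0, q 3, -q 2]

/-- The product `q (cos α j + sin α k)` of quaternions. -/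
noncomputable def quatFlip (q : Fin 4 → ℝ) (α : ℝ) : Fin 4 → ℝ :=
  Real.cos α • ![-q 2, -q 3, q 0, q 1] + Real.sin α • ![-q 3, q 2, -q 1, q 0]

theorem quatTurn_smul (c : ℝ) (q : Fin 4 → ℝ) (α : ℝ) : quatTurn (c • q) α = c • quatTurn q α := by
  ext i
  fin_cases i <;> simp [quatTurn, Matrix.vecHead, Matrix.vecTail] <;> ring

theorem quatFlip_smul (c : ℝ) (q : Fin 4 → ℝ) (α : ℝ) : quatFlip (c • q) α = c • quatFlip q α := by
  ext i
  fin_cases i <;> simp [quatFlip] <;> ring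

theorem quatTurn_add_int_mul_pi (q : Fin 4 → ℝ) (α : ℝ) (w : ℤ) :
    quatTurn q (α + w * Real.pi) = (-1 : ℝ) ^ w • quatTurn q α := by
  rw [quatTurn, quatTurn, Real.cos_add_int_mul_pi, Real.sin_add_int_mul_pi, smul_add, smul_smul,
    smul_smul]

theorem quatFlip_add_int_mul_pi (q : Fin 4 → ℝ) (α : ℝ) (w : ℤ) :
    quatFlip q (α + w * Real.pi) = (-1 : ℝ) ^ w • quatFlip q α := by
  rw [quatFlip, quatFlip, Real.cos_add_int_mul_pi, Real.sin_add_int_mul_pi, smul_add, smul_smul,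
    smul_smul]

/-- A unit imaginary quaternion squares to `-1`: a double flip is trivial on frames but not on their
lifts. This sign is why odd integers correspond to even loops in `antipodal_parity`. -/
theorem quatFlip_quatFlip (q : Fin 4 → ℝ) (α : ℝ) : quatFlip (quatFlip q α) α = -q := by
  have h := Real.cos_sq_add_sin_sq α
  ext i
  fin_cases i <;> simp [quatFlip]
  · linear_combination (-q 0) * h
  · linear_combination (-q 1) * h
  · linear_combination (-q 2) * h
  · linear_combination (-q 3) * h

theorem IsLift.turn {q : Fin 4 → ℝ} {M : Matrix (Fin 3) (Fin 3) ℝ} (h : IsLift q M) (α : ℝ) :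
    IsLift (quatTurn q α) (turnFrame M (2 * α)) := by
  obtain ⟨hq, rfl⟩ := h
  have hcs := Real.cos_sq_add_sin_sq α
  constructor
  · simp only [dotProduct, Fin.sum_univ_four, quatTurn] at hq ⊢
    simp
    linear_combination hq + (q 0 * q 0 + q 1 * q 1 + q 2 * q 2 + q 3 * q 3) * hcs
  · ext i j
    fin_cases i <;> fin_cases j <;>
      simp [quatFrame, turnFrame, quatTurn, Real.cos_two_mul', Real.sin_two_mul] <;>
      first
      | ring1
      | linear_combination (q 0 ^ 2 + q 1 ^ 2 - q 2 ^ 2 - q 3 ^ 2) * hcs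
      | linear_combination (q 1 * q 2 + q 0 * q 3) * hcs
      | linear_combination (q 1 * q 3 - q 0 * q 2) * hcs

theorem IsLift.flip {q : Fin 4 → ℝ} {M : Matrix (Fin 3) (Fin 3) ℝ} (h : IsLift q M) (α : ℝ) :
    IsLift (quatFlip q α) (flipFrame M (2 * α)) := by
  obtain ⟨hq, rfl⟩ := h
  have hcs := Real.cos_sq_add_sin_sq α
  constructor
  · simp only [dotProduct, Fin.sum_univ_four, quatFlip] at hq ⊢
    simp
    linear_combination hq + (q 0 * q 0 + q 1 * q 1 + q 2 * q 2 + q 3 * q 3) * hcs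
  · ext i j
    fin_cases i <;> fin_cases j <;>
      simp [quatFrame, flipFrame, quatFlip, Real.cos_two_mul', Real.sin_two_mul] <;>
      first
      | ring1
      | linear_combination (-(q 0 ^ 2 + q 1 ^ 2 - q 2 ^ 2 - q 3 ^ 2)) * hcs
      | linear_combination (-(2 * (q 1 * q 2 + q 0 * q 3))) * hcs
      | linear_combination (-(2 * (q 1 * q 3 - q 0 * q 2))) * hcs

theorem continuousOn_quatTurn {E : Type*} [TopologicalSpace E] {K : Set E} {q : E → Fin 4 → ℝ}
    {α : E → ℝ} (hq : ContinuousOn q K) (hα : ContinuousOn α K) :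
    ContinuousOn (fun z => quatTurn (q z) (α z)) K := by
  have hq' := continuousOn_pi.1 hq
  refine continuousOn_pi.2 fun i => ?_
  fin_cases i <;> simp [quatTurn] <;> fun_prop (disch := assumption)

theorem continuousOn_quatFlip {E : Type*} [TopologicalSpace E] {K : Set E} {q : E → Fin 4 → ℝ}
    {α : E → ℝ} (hq : ContinuousOn q K) (hα : ContinuousOn α K) :
    ContinuousOn (fun z => quatFlip (q z) (α z)) K := by
  have hq' := continuousOn_pi.1 hq
  refine continuousOn_pi.2 fun i => ?_
  fin_cases i <;> simp [quatFlip] <;> fun_prop (disch := assumption)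

theorem smul_eq_self_iff_of_sign {ε : ℝ} (hε : ε = 1 ∨ ε = -1) {v : Fin 4 → ℝ} (hv : v ≠ 0) :
    ε • v = v ↔ ε = 1 := by
  rcases hε with rfl | rfl
  · simp
  · simp only [neg_smul, one_smul, neg_eq_self, hv, false_iff]
    norm_num

theorem neg_one_zpow_eq_one_iff (w : ℤ) : (-1 : ℝ) ^ w = 1 ↔ Even w := by
  rcases Int.even_or_odd w with h | h
  · simp [h.neg_one_zpow, h]
  · simp only [h.neg_one_zpow, Int.not_even_iff_odd.2 h, iff_false]
    norm_num

namespace Framing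

variable {γ : ClosedCurve}

theorem frameMatrix_rotate (φ : Framing γ) {θ : ℝ → ℝ} {hθ : ContDiff ℝ ∞ θ} {w : ℤ}
    {hw : ∀ s, θ (s + 1) = θ s + 2 * Real.pi * w} (s : ℝ) :
    (φ.rotate θ hθ w hw).frameMatrix s = turnFrame (φ.frameMatrix s) (θ s) := by
  simp only [frameMatrix, rotate_binormal]
  rfl

theorem frameMatrix_periodic (φ : Framing γ) : Periodic φ.frameMatrix 1 := fun s =>
  congrArg Subtype.val (φ.frame_periodic s)

/-- The lift of the rotated frames is the old lift turned through `θ / 2`, which grows by `πw` over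
a period and contributes the sign `(-1)^w`. -/
theorem isEvenLoop_rotate (φ : Framing γ) {θ : ℝ → ℝ} {hθ : ContDiff ℝ ∞ θ} {w : ℤ}
    {hw : ∀ s, θ (s + 1) = θ s + 2 * Real.pi * w} :
    IsEvenLoop (φ.rotate θ hθ w hw).frameMatrix ↔ (IsEvenLoop φ.frameMatrix ↔ Even w) := by
  obtain ⟨q, hq, hl⟩ := exists_path_lift φ.frameMatrix_continuous.continuousOn
    fun s _ => φ.frameMatrix_mem s
  have hl' : ∀ s ∈ Icc (0 : ℝ) 1, IsLift (quatTurn (q s) (θ s / 2))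
      ((φ.rotate θ hθ w hw).frameMatrix s) := by
    intro s hs
    have := (hl s hs).turn (θ s / 2)
    rwa [mul_div_cancel₀ _ two_ne_zero, ← frameMatrix_rotate (hθ := hθ) (hw := hw)] at this
  have m0 : (0 : ℝ) ∈ Icc (0 : ℝ) 1 := by simp
  have m1 : (1 : ℝ) ∈ Icc (0 : ℝ) 1 := by simp
  rw [isEvenLoop_iff (continuousOn_quatTurn hq (hθ.continuous.div_const 2).continuousOn) hl',
    isEvenLoop_iff hq hl]
  have h01 : φ.frameMatrix 1 = φ.frameMatrix 0 := by simpa using φ.frameMatrix_periodic 0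
  obtain ⟨ε, hε, h⟩ : ∃ ε : ℝ, (ε = 1 ∨ ε = -1) ∧ q 1 = ε • q 0 :=
    ⟨q 0 ⬝ᵥ q 1, (hl 0 m0).dot_eq (h01 ▸ hl 1 m1), (hl 0 m0).eq_smul (h01 ▸ hl 1 m1)⟩
  have hθ1 : θ 1 / 2 = θ 0 / 2 + w * Real.pi := by
    have := hw 0
    rw [zero_add] at this
    rw [this]
    ring
  rw [hθ1, quatTurn_add_int_mul_pi, h, quatTurn_smul, smul_smul,
    smul_eq_self_iff_of_sign hε (ne_zero_of_dotProduct_self_eq_one (hl 0 m0).1),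
    smul_eq_self_iff_of_sign _ (ne_zero_of_dotProduct_self_eq_one (hl' 0 m0).1)]
  · rw [← neg_one_zpow_eq_one_iff w]
    rcases hε with rfl | rfl <;> rcases Int.even_or_odd w with hw | hw <;>
      norm_num [hw.neg_one_zpow]
  · rcases hε with rfl | rfl <;> rcases Int.even_or_odd w with hw | hw <;>
      norm_num [hw.neg_one_zpow]

/-- The loop of frames of a null-homotopic framing lifts to a loop of unit quaternions. -/
theorem isEvenLoop_of_nullhomotopic (φ : Framing γ) (h : φ.loop.Nullhomotopic) :
    IsEvenLoop φ.frameMatrix := by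
  obtain ⟨y, ⟨H⟩⟩ := h
  let G : ℝ × ℝ → Matrix (Fin 3) (Fin 3) ℝ := fun p =>
    (H (projIcc 0 1 zero_le_one p.1, (p.2 : UnitAddCircle)) : SO3)
  have hG : Continuous G := by
    refine continuous_subtype_val.comp (H.continuous.comp ?_)
    exact (continuous_projIcc.comp continuous_fst).prodMk
      ((AddCircle.continuous_mk' 1).comp continuous_snd)
  have key := isEvenLoop_congr_of_homotopy hG.continuousOn (fun p _ => Subtype.property _)
    (fun r _ => by
      have : ((1 : ℝ) : UnitAddCircle) = ((0 : ℝ) : UnitAddCircle) := by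
        simp
      simp only [G, this])
  have h0 : (fun s => G (0, s)) = φ.frameMatrix := by
    funext s
    simp only [G, projIcc_left]
    exact congrArg Subtype.val (H.apply_zero (s : UnitAddCircle))
  have h1 : (fun s => G (1, s)) = fun _ => (y : Matrix (Fin 3) (Fin 3) ℝ) := by
    funext s
    simp [G]
  rw [h0, h1] at key
  obtain ⟨q, hq⟩ := exists_isLift y.2
  exact key.2 ⟨fun _ => q, continuousOn_const, fun _ _ => hq, rfl⟩

end Framing

/-- The restrictions of `σ` to concentric circles of decreasing radius contract the loop to `σ 0`.
-/
theorem Swaddling.LiftsTo.nullhomotopic {γ : ClosedCurve} {β : Swaddling γ} {φ : Framing γ}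
    (h : β.LiftsTo φ) : φ.loop.Nullhomotopic := by
  obtain ⟨σ, hσ, -, hb⟩ := h
  let e : unitInterval × UnitAddCircle → ℂ := fun p =>
    (1 - (p.1 : ℝ)) • (AddCircle.toCircle p.2 : ℂ)
  have he : Continuous e := by
    have := (AddCircle.continuous_toCircle (T := 1)).comp
      (continuous_snd (X := unitInterval) (Y := UnitAddCircle))
    exact (continuous_const.sub (continuous_subtype_val.comp continuous_fst)).smul
      (continuous_subtype_val.comp this)
  have hm : ∀ p, e p ∈ Metric.closedBall (0 : ℂ) 1 := by
    intro p
    rw [mem_closedBall_zero_iff, norm_smul, Circle.norm_coe, mul_one, Real.norm_eq_abs,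
      abs_of_nonneg (by linarith [p.1.2.2])]
    linarith [p.1.2.1]
  refine ⟨σ 0, ⟨⟨⟨fun p => σ (e p), hσ.comp_continuous he hm⟩, fun x => ?_, fun x => ?_⟩⟩⟩
  · induction x using QuotientAddGroup.induction_on with
    | H s =>
      have : ((AddCircle.toCircle (s : UnitAddCircle) : Circle) : ℂ) =
          Complex.exp (2 * Real.pi * s * Complex.I) := by
        rw [AddCircle.toCircle_apply_mk, Circle.coe_exp]
        push_cast
        simp
      have h2 : e (0, (s : UnitAddCircle)) = Complex.exp (2 * Real.pi * s * Complex.I) := by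
        simp only [e]
        rw [this]
        simp
      exact (congrArg σ h2).trans (hb s)
  · simp [e]

/-! ### Extending loops over the disc. -/

theorem Function.Periodic.eq_of_angle_eq {F : Type*} {f : ℝ → F} (hf : Periodic f 1) {x y : ℝ}
    (h : (x : Real.Angle) = (y : Real.Angle)) :
    f (x / (2 * Real.pi)) = f (y / (2 * Real.pi)) := by
  obtain ⟨m, hm⟩ := Real.Angle.angle_eq_iff_two_pi_dvd_sub.1 h
  have : x / (2 * Real.pi) = y / (2 * Real.pi) + m * 1 := by
    rw [sub_eq_iff_eq_add.1 hm]
    field_simp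
    ring
  rw [this]
  exact hf.int_mul m _

theorem Function.Periodic.arg_exp {F : Type*} {f : ℝ → F} (hf : Periodic f 1) (s : ℝ) :
    f (Complex.arg (Complex.exp (2 * Real.pi * s * Complex.I)) / (2 * Real.pi)) = f s := by
  have h : (Complex.arg (Complex.exp (2 * Real.pi * s * Complex.I)) : Real.Angle) =
      ((2 * Real.pi * s : ℝ) : Real.Angle) := by
    rw [← Complex.arg_cos_add_sin_mul_I_coe_angle ((2 * Real.pi * s : ℝ) : Real.Angle),
      Complex.exp_mul_I, Real.Angle.cos_coe, Real.Angle.sin_coe]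
    push_cast
    rfl
  rw [hf.eq_of_angle_eq h, mul_div_cancel_left₀ _ (by positivity)]

/-- In a neighbourhood of any nonzero point, a periodic function of the argument is a function of
a smooth branch of the argument. -/
theorem Function.Periodic.arg_eventuallyEq {F : Type*} {f : ℝ → F} (hf : Periodic f 1) {w : ℂ}
    (hw : w ≠ 0) : (fun z => f (Complex.arg z / (2 * Real.pi))) =ᶠ[nhds w]
      fun z => f (((Complex.log (z / w)).im + Complex.arg w) / (2 * Real.pi)) := by
  filter_upwards [isOpen_ne.mem_nhds hw] with z hz
  refine hf.eq_of_angle_eq ?_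
  rw [Complex.log_im, Real.Angle.coe_add, Complex.arg_div_coe_angle hz hw, sub_add_cancel]

/-- Division by `w` moves the base point to `1`, away from the cut of the logarithm. -/
theorem contDiffAt_argBranch {w : ℂ} (hw : w ≠ 0) :
    ContDiffAt ℝ ∞ (fun z => ((Complex.log (z / w)).im + Complex.arg w) / (2 * Real.pi)) w := by
  have h1 : ContDiffAt ℝ ∞ Complex.log (w / w) := by
    rw [div_self hw]
    exact (Complex.contDiffAt_log (by simp)).restrict_scalars ℝ
  have h2 : ContDiffAt ℝ ∞ (fun z : ℂ => z / w) w := contDiffAt_id.div_const w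
  have h3 : ContDiffAt ℝ ∞ (fun z => (Complex.log (z / w)).im) w :=
    Complex.imCLM.contDiff.contDiffAt.comp w (ContDiffAt.comp (f := fun z : ℂ => z / w) w h1 h2)
  exact (h3.add contDiffAt_const).div_const _

theorem Function.Periodic.contDiffAt_arg {F : Type*} [NormedAddCommGroup F] [NormedSpace ℝ F]
    {f : ℝ → F} (hf : Periodic f 1) (hf' : ContDiff ℝ ∞ f) {w : ℂ} (hw : w ≠ 0) :
    ContDiffAt ℝ ∞ (fun z => f (Complex.arg z / (2 * Real.pi))) w :=
  (hf'.contDiffAt.comp w (contDiffAt_argBranch hw)).congr_of_eventuallyEq (hf.arg_eventuallyEq hw)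

/-- A smooth function on the plane which vanishes near the origin and is `1` on the unit circle. -/
noncomputable def discCutoff (z : ℂ) : ℝ := Real.smoothTransition (2 * ‖z‖ ^ 2 - 1)

theorem contDiff_discCutoff : ContDiff ℝ ∞ discCutoff :=
  Real.smoothTransition.contDiff.comp ((contDiff_const.mul (contDiff_norm_sq ℝ)).sub contDiff_const)

theorem discCutoff_exp (s : ℝ) : discCutoff (Complex.exp (2 * Real.pi * s * Complex.I)) = 1 := by
  simp only [discCutoff, norm_exp_turn]
  exact Real.smoothTransition.one_of_one_le (by norm_num)

/-- Away from the origin periodicity hides the jump of the argument, and near the origin the cutoff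
vanishes. -/
theorem Function.Periodic.contDiff_cutoff_smul_arg {F : Type*} [NormedAddCommGroup F]
    [NormedSpace ℝ F] {f : ℝ → F} (hf : Periodic f 1) (hf' : ContDiff ℝ ∞ f) :
    ContDiff ℝ ∞ fun z => discCutoff z • f (Complex.arg z / (2 * Real.pi)) := by
  refine contDiff_iff_contDiffAt.2 fun w => ?_
  by_cases hw : w = 0
  · refine (contDiffAt_const (c := 0)).congr_of_eventuallyEq ?_
    have hc : Continuous fun z : ℂ => 2 * ‖z‖ ^ 2 - 1 := by fun_prop
    filter_upwards [hc.continuousAt.eventually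
      (gt_mem_nhds (show 2 * ‖w‖ ^ 2 - 1 < 0 by simp [hw]))]
      with z hz
    rw [discCutoff, Real.smoothTransition.zero_of_nonpos hz.le, zero_smul]
  · exact contDiff_discCutoff.contDiffAt.smul (hf.contDiffAt_arg hf' hw)

theorem contDiff_quatFrame {E : Type*} [NormedAddCommGroup E] [NormedSpace ℝ E]
    {q : E → Fin 4 → ℝ} (hq : ContDiff ℝ ∞ q) (i : Fin 3) :
    ContDiff ℝ ∞ fun z => quatFrame (q z) i := by
  have hq' := contDiff_pi.1 hq
  refine contDiff_pi.2 fun j => ?_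
  fin_cases i <;> fin_cases j <;> simp [quatFrame] <;> fun_prop (disch := assumption)

theorem continuous_quatFrame : Continuous quatFrame := by
  refine continuous_matrix fun i j => ?_
  fin_cases i <;> fin_cases j <;> simp [quatFrame] <;> fun_prop

namespace Framing

variable {γ : ClosedCurve}

theorem contDiff_quatSquare_mulVec (φ : Framing γ) (v : Fin 4 → ℝ) :
    ContDiff ℝ ∞ fun s => quatSquare (φ.frameMatrix s) *ᵥ v := by
  have h : ∀ i j, ContDiff ℝ ∞ fun s => φ.frameMatrix s i j := by
    intro i j
    fin_cases i
    · exact contDiff_pi.1 γ.tangent_contDiff j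
    · exact contDiff_pi.1 φ.smooth j
    · exact contDiff_pi.1 φ.binormal_contDiff j
  refine contDiff_pi.2 fun a => ?_
  fin_cases a <;> simp [quatSquare, Matrix.mulVec, dotProduct, Fin.sum_univ_four] <;>
    fun_prop (disch := assumption)

/-- An even framing lifts to a smooth loop of unit quaternions. -/
theorem exists_smooth_lift (φ : Framing γ) (h : IsEvenLoop φ.frameMatrix) :
    ∃ q : ℝ → Fin 4 → ℝ, ContDiff ℝ ∞ q ∧ Periodic q 1 ∧ ∀ s, IsLift (q s) (φ.frameMatrix s) := by
  obtain ⟨p, hp, hl, h01⟩ := h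
  have hfract : ∀ s, φ.frameMatrix (Int.fract s) = φ.frameMatrix s := by
    intro s
    have := φ.frameMatrix_periodic.sub_int_mul_eq ⌊s⌋ (x := s)
    rwa [mul_one] at this
  set q : ℝ → Fin 4 → ℝ := p ∘ Int.fract
  have hq : Continuous q := hp.comp_fract'' h01.symm
  have hql : ∀ s, IsLift (q s) (φ.frameMatrix s) := fun s =>
    hfract s ▸ hl _ ⟨Int.fract_nonneg s, (Int.fract_lt_one s).le⟩
  refine ⟨q, contDiff_iff_contDiffAt.2 fun s => ?_, fun s => by simp [q], hql⟩
  have hdot : Continuous fun t => q t ⬝ᵥ q s := by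
    simp only [dotProduct]
    fun_prop
  have hpos : ∀ᶠ t in nhds s, 0 < q t ⬝ᵥ q s :=
    hdot.continuousAt.eventually (lt_mem_nhds (by beta_reduce; rw [(hql s).1]; exact one_pos))
  -- Near `s` the lift is the one with positive scalar product with the fixed vector `q s`, and this
  -- description depends smoothly on `t`.
  have heq : ∀ t ∈ {t | 0 < q t ⬝ᵥ q s}, q t = direction (quatSquare (φ.frameMatrix t) *ᵥ q s) := by
    intro t ht
    rw [(hql t).square_mulVec, direction_smul ht, direction_of_unit (hql t).1]
  refine (ContDiffOn.congr ?_ heq).contDiffAt hpos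
  refine (φ.contDiff_quatSquare_mulVec (q s)).contDiffOn.direction fun t ht => ?_
  rw [(hql t).square_mulVec]
  exact smul_ne_zero (ne_of_gt ht) (ne_zero_of_dotProduct_self_eq_one (hql t).1)

/-- An even framing bounds a swaddling map. -/
theorem exists_swaddling (φ : Framing γ) (h : IsEvenLoop φ.frameMatrix) :
    ∃ β : Swaddling γ, β.LiftsTo φ := by
  obtain ⟨q, hq, hqp, hql⟩ := φ.exists_smooth_lift h
  -- The multiples `r • q s` form the image of a smooth map from `ℝ²` to `ℝ⁴`, whose complement is
  -- dense. Negative `r` are included so that no segment from `p` to a point `q s` meets the origin;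
  -- such segments can thus be projected to `S³`.
  obtain ⟨p, hp⟩ : ∃ p : Fin 4 → ℝ, ∀ (r s : ℝ), r • q s ≠ p := by
    have hc : ContDiff ℝ 1 fun x : ℝ × ℝ => x.1 • q x.2 :=
      contDiff_fst.smul ((hq.of_le (by simp)).comp contDiff_snd)
    obtain ⟨p, hp⟩ := (hc.dense_compl_range_of_finrank_lt_finrank (by simp)).nonempty
    exact ⟨p, fun r s hrs => hp ⟨(r, s), hrs⟩⟩
  set χ : ℂ → ℝ := discCutoff
  set W : ℂ → Fin 4 → ℝ := fun z => (1 - χ z) • p + χ z • q (Complex.arg z / (2 * Real.pi))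
  have hW : ContDiff ℝ ∞ W :=
    ((contDiff_const.sub contDiff_discCutoff).smul contDiff_const).add
      (hqp.contDiff_cutoff_smul_arg hq)
  have hW0 : ∀ z, W z ≠ 0 := by
    intro z hz
    by_cases h1 : 1 - χ z = 0
    · have h2 : χ z = 1 := by linarith
      simp only [W, h2] at hz
      simp at hz
      exact ne_zero_of_dotProduct_self_eq_one (hql _).1 hz
    · refine hp (-((1 - χ z)⁻¹ * χ z)) (Complex.arg z / (2 * Real.pi)) ?_
      have := congrArg (fun v => (1 - χ z)⁻¹ • v) hz
      simp only [W, smul_add, smul_smul, inv_mul_cancel₀ h1, one_smul, smul_zero] at this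
      rw [neg_smul]
      exact (eq_neg_of_add_eq_zero_left this).symm
  set m : ℂ → Fin 4 → ℝ := fun z => direction (W z)
  have hm : ContDiff ℝ ∞ m := contDiffOn_univ.1 (hW.contDiffOn.direction fun z _ => hW0 z)
  have hm1 : ∀ z, m z ⬝ᵥ m z = 1 := fun z => direction_dot_self (hW0 z)
  have hb : ∀ s : ℝ, quatFrame (m (Complex.exp (2 * Real.pi * s * Complex.I))) =
      φ.frameMatrix s := by
    intro s
    have h1 : χ (Complex.exp (2 * Real.pi * s * Complex.I)) = 1 := discCutoff_exp s
    simp only [m, W, h1, hqp.arg_exp]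
    rw [sub_self, zero_smul, one_smul, zero_add, direction_of_unit (hql s).1, (hql s).2]
  refine ⟨⟨fun z => quatFrame (m z) 0, (contDiff_quatFrame hm 0).contDiffOn,
    fun z _ => specialOrthogonal_rows (quatFrame_mem (hm1 z)) 0 0, fun s => by rw [hb s]; rfl⟩,
    fun z => ⟨quatFrame (m z), quatFrame_mem (hm1 z)⟩, ?_, fun z _ => rfl,
    fun s => Subtype.ext (hb s)⟩
  exact ((continuous_quatFrame.comp hm.continuous).subtype_mk _).continuousOn

/-- An even framing bounds a disc of frames, namely the lift of the swaddling map built from it, and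
is contracted along this disc. -/
theorem nullhomotopic_iff (φ : Framing γ) : φ.loop.Nullhomotopic ↔ IsEvenLoop φ.frameMatrix :=
  ⟨φ.isEvenLoop_of_nullhomotopic, fun h => (φ.exists_swaddling h).choose_spec.nullhomotopic⟩

end Framing

/-! ### Lifts of swaddling maps and equality of correction terms. -/

/-- A continuous map from the closed disc to the circle has a continuous angle function. -/
theorem exists_angle_on_disc {x y : ℂ → ℝ} (hx : ContinuousOn x (Metric.closedBall 0 1))
    (hy : ContinuousOn y (Metric.closedBall 0 1))
    (h : ∀ z ∈ Metric.closedBall (0 : ℂ) 1, x z ^ 2 + y z ^ 2 = 1) :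
    ∃ θ : ℂ → ℝ, Continuous θ ∧ ∀ z ∈ Metric.closedBall (0 : ℂ) 1,
      x z = Real.cos (θ z) ∧ y z = Real.sin (θ z) := by
  -- The radial retraction extends the map to the simply connected plane, where it lifts through the
  -- covering `Circle.exp`.
  let ρ : ℂ → ℂ := fun z => (max 1 ‖z‖)⁻¹ • z
  have hpos : ∀ z : ℂ, 0 < max 1 ‖z‖ := fun z => lt_max_of_lt_left one_pos
  have hρ : Continuous ρ :=
    (Continuous.inv₀ (by fun_prop) fun z => (hpos z).ne').smul continuous_id
  have hρm : ∀ z, ρ z ∈ Metric.closedBall (0 : ℂ) 1 := by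
    intro z
    rw [mem_closedBall_zero_iff, norm_smul, norm_inv, Real.norm_of_nonneg (hpos z).le,
      inv_mul_le_one₀ (hpos z)]
    exact le_max_right _ _
  have hρid : ∀ z ∈ Metric.closedBall (0 : ℂ) 1, ρ z = z := by
    intro z hz
    rw [mem_closedBall_zero_iff] at hz
    simp [ρ, max_eq_left hz]
  let f : C(ℂ, Circle) :=
    ⟨fun z => ⟨⟨x (ρ z), y (ρ z)⟩, by
      change _ ∈ Metric.sphere (0 : ℂ) 1
      rw [mem_sphere_zero_iff_norm, Complex.norm_def, Complex.normSq_mk, Real.sqrt_eq_one,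
        ← h _ (hρm z)]
      ring⟩, by
      refine Continuous.subtype_mk ?_ _
      have h1 := hx.comp_continuous hρ hρm
      have h2 := hy.comp_continuous hρ hρm
      exact Complex.equivRealProdCLM.symm.continuous.comp (h1.prodMk h2)⟩
  obtain ⟨F, ⟨-, hF⟩, -⟩ := Circle.isCoveringMap_exp.existsUnique_continuousMap_lifts f 0
    (Complex.arg (f 0)) (Circle.exp_arg _)
  refine ⟨F, F.continuous, fun z hz => ?_⟩
  have h1 : Complex.exp (F z * Complex.I) = ⟨x z, y z⟩ := by
    rw [← Circle.coe_exp, show Circle.exp (F z) = f z from congrFun hF z]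
    change (⟨x (ρ z), y (ρ z)⟩ : ℂ) = _
    rw [hρid z hz]
  constructor
  · rw [← Complex.exp_ofReal_mul_I_re, h1]
  · rw [← Complex.exp_ofReal_mul_I_im, h1]

theorem turned_unit {a b : R3} (ha : a ⬝ᵥ a = 1) (hb : b ⬝ᵥ b = 1) (hab : a ⬝ᵥ b = 0) (θ : ℝ) :
    (Real.cos θ • b + Real.sin θ • a ⨯₃ b) ⬝ᵥ (Real.cos θ • b + Real.sin θ • a ⨯₃ b) = 1 := by
  have h1 : b ⬝ᵥ a ⨯₃ b = 0 := dot_cross_self _ _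
  have h2 : a ⨯₃ b ⬝ᵥ a ⨯₃ b = 1 := by rw [cross_dot_cross, ha, hb, hab]; simp
  simp only [add_dotProduct, dotProduct_add, smul_dotProduct, dotProduct_smul, smul_eq_mul,
    hb, h1, h2, dotProduct_comm (a ⨯₃ b) b]
  linear_combination Real.cos_sq_add_sin_sq θ

theorem dot_turned {a b : R3} (hab : a ⬝ᵥ b = 0) (θ : ℝ) :
    a ⬝ᵥ (Real.cos θ • b + Real.sin θ • a ⨯₃ b) = 0 := by
  have h1 : a ⬝ᵥ a ⨯₃ b = 0 := dot_self_cross _ _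
  simp only [dotProduct_add, dotProduct_smul, hab, h1, smul_zero, add_zero]

theorem Framing.eq_of_normal_eq {γ : ClosedCurve} {φ ψ : Framing γ}
    (h : ∀ s, φ.normal s = ψ.normal s) : φ = ψ := by
  cases φ
  cases ψ
  congr
  exact funext h

namespace Swaddling

variable {γ : ClosedCurve}

/-- The angle from a normal field `μ` over the disc to the second vector of `σ` is a function on the
whole disc, hence periodic along the circle. So `φ` has winding number zero relative to the boundary
framing of `μ`, whose correction term is that of `β`. -/
theorem LiftsTo.tau_eq {β : Swaddling γ} {φ : Framing γ} (h : β.LiftsTo φ) : β.tau = φ.tau := by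
  obtain ⟨σ, hσ, hσ0, hσb⟩ := h
  obtain ⟨μ, ψ, hμ, hμ1, hμ0, hψ, hτ⟩ := β.exists_framing
  obtain ⟨θ, hθ, w, hw, hn⟩ := ψ.exists_rotate φ
  have hφ : φ = ψ.rotate θ hθ w hw := Framing.eq_of_normal_eq hn
  have hmem : ∀ s : ℝ, Complex.exp (2 * Real.pi * s * Complex.I) ∈ Metric.closedBall (0 : ℂ) 1 :=
    fun s => by rw [mem_closedBall_zero_iff, norm_exp_turn]
  set e : ℂ → R3 := fun z => (σ z : Matrix (Fin 3) (Fin 3) ℝ) 1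
  have hval : Continuous fun M : SO3 => (M : Matrix (Fin 3) (Fin 3) ℝ) := continuous_subtype_val
  have he : ContinuousOn e (Metric.closedBall 0 1) :=
    (continuous_apply (1 : Fin 3)).comp_continuousOn (hval.comp_continuousOn hσ)
  have hsq : ∀ z ∈ Metric.closedBall (0 : ℂ) 1,
      (e z ⬝ᵥ μ z) ^ 2 + (e z ⬝ᵥ β.toFun z ⨯₃ μ z) ^ 2 = 1 := by
    intro z hz
    refine normal_coords_sq (β.unit z hz) (hμ1 z hz) (hμ0 z hz) ?_ ?_
    · rw [← hσ0 z hz]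
      exact specialOrthogonal_rows (σ z).2 0 1
    · exact specialOrthogonal_rows (σ z).2 1 1
  obtain ⟨ϑ, hϑ, hϑz⟩ := exists_angle_on_disc (he.dotProduct' hμ.continuousOn)
    (he.dotProduct' (β.smooth.cross hμ).continuousOn) hsq
  have heb : ∀ s : ℝ, e (Complex.exp (2 * Real.pi * s * Complex.I)) =
      Real.cos (θ s) • ψ.normal s + Real.sin (θ s) • ψ.binormal s := by
    intro s
    simp only [e, hσb]
    exact hn s
  have hbb : ∀ s : ℝ, β.toFun (Complex.exp (2 * Real.pi * s * Complex.I)) ⨯₃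
      μ (Complex.exp (2 * Real.pi * s * Complex.I)) = ψ.binormal s := by
    intro s
    rw [β.boundary, ← hψ]
    rfl
  obtain ⟨m, hm⟩ := exists_int_of_cos_sin_eq (u := θ)
    (v := fun s => ϑ (Complex.exp (2 * Real.pi * s * Complex.I))) hθ.continuous
    (hϑ.comp (by fun_prop))
    (fun s => by
      rw [← (hϑz _ (hmem s)).1, heb, ← hψ]
      simp [ψ.unit, ψ.normal_dot_binormal, dotProduct_comm (ψ.binormal s) (ψ.normal s)])
    (fun s => by
      rw [← (hϑz _ (hmem s)).2, heb, hbb]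
      simp [ψ.binormal_unit, ψ.normal_dot_binormal])
  have hw0 : w = 0 := by
    have h1 := hw 0
    rw [hm 0, hm (0 + 1), exp_turn_add_one] at h1
    have h2 : 2 * Real.pi * (w : ℝ) = 0 := by linarith
    have h3 : (w : ℝ) = 0 := by simpa [Real.pi_ne_zero] using h2
    exact_mod_cast h3
  rw [hφ, Framing.rotate_tau, hw0, hτ]
  simp

/-- Equal correction terms make the winding number relative to `ψ` vanish, so `θ` is periodic. Cut
off near the centre it extends over the disc, and turning `μ` by it gives the second vector of the
lift. -/
theorem liftsTo_of_tau_eq {β : Swaddling γ} {φ : Framing γ} (h : β.tau = φ.tau) :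
    β.LiftsTo φ := by
  obtain ⟨μ, ψ, hμ, hμ1, hμ0, hψ, hτ⟩ := β.exists_framing
  obtain ⟨θ, hθ, w, hw, hn⟩ := ψ.exists_rotate φ
  have hφ : φ = ψ.rotate θ hθ w hw := Framing.eq_of_normal_eq hn
  have hw0 : (w : ℝ) = 0 := by
    rw [hφ, Framing.rotate_tau, hτ] at h
    linarith
  have hθp : Periodic θ 1 := fun s => by rw [hw, hw0]; simp
  set ϑ : ℂ → ℝ := fun z => discCutoff z • θ (Complex.arg z / (2 * Real.pi))
  have hϑ : Continuous ϑ := (hθp.contDiff_cutoff_smul_arg hθ).continuous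
  set e : ℂ → R3 := fun z => Real.cos (ϑ z) • μ z + Real.sin (ϑ z) • β.toFun z ⨯₃ μ z
  have he : ContinuousOn e (Metric.closedBall 0 1) :=
    ((Real.continuous_cos.comp hϑ).continuousOn.smul hμ.continuousOn).add
      ((Real.continuous_sin.comp hϑ).continuousOn.smul (β.smooth.cross hμ).continuousOn)
  have hfr : ∀ z ∈ Metric.closedBall (0 : ℂ) 1,
      frameOf (β.toFun z) (e z) ∈ Matrix.specialOrthogonalGroup (Fin 3) ℝ := fun z hz =>
    frameOf_mem (β.unit z hz) (turned_unit (β.unit z hz) (hμ1 z hz) (hμ0 z hz) _)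
      (dot_turned (hμ0 z hz) _)
  classical
  let σ : ℂ → SO3 := fun z =>
    if hz : z ∈ Metric.closedBall (0 : ℂ) 1 then ⟨frameOf (β.toFun z) (e z), hfr z hz⟩ else 1
  have hσ : ∀ z ∈ Metric.closedBall (0 : ℂ) 1,
      (σ z : Matrix (Fin 3) (Fin 3) ℝ) = frameOf (β.toFun z) (e z) := fun z hz => by
    simp only [σ, dif_pos hz]
  refine ⟨σ, ?_, fun z hz => by rw [hσ z hz]; rfl, fun s => ?_⟩
  · refine Topology.IsInducing.subtypeVal.continuousOn_iff.2 ?_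
    exact (continuousOn_frameOf β.smooth.continuousOn he).congr hσ
  · have hmem : Complex.exp (2 * Real.pi * s * Complex.I) ∈ Metric.closedBall (0 : ℂ) 1 := by
      rw [mem_closedBall_zero_iff, norm_exp_turn]
    refine Subtype.ext ?_
    rw [hσ _ hmem]
    have he' : e (Complex.exp (2 * Real.pi * s * Complex.I)) = φ.normal s := by
      simp only [e, ϑ, discCutoff_exp, hθp.arg_exp, one_smul, β.boundary, ← hψ, hn s]
      rfl
    rw [he', β.boundary]
    rfl

end Swaddling

/-! ### The Gauss map near the diagonal. -/

theorem hasFDerivAt_parametric_integral {E : Type*} [NormedAddCommGroup E] [NormedSpace ℝ E]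
    {F : ℝ × ℝ → ℝ → E} (hF : ContDiff ℝ ∞ (uncurry F)) (p : ℝ × ℝ) :
    HasFDerivAt (fun p => ∫ u in (0 : ℝ)..1, F p u)
      (∫ u in (0 : ℝ)..1, (fderiv ℝ (uncurry F) (p, u)).comp
        (ContinuousLinearMap.inl ℝ (ℝ × ℝ) ℝ)) p := by
  set F' : ℝ × ℝ → ℝ → ℝ × ℝ →L[ℝ] E := fun p u =>
    (fderiv ℝ (uncurry F) (p, u)).comp (ContinuousLinearMap.inl ℝ (ℝ × ℝ) ℝ)
  have hF' : Continuous (uncurry F') :=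
    (hF.continuous_fderiv (by simp)).clm_comp continuous_const
  have hcF : ∀ p, Continuous (F p) := fun p => hF.continuous.comp (by fun_prop : Continuous (p, ·))
  obtain ⟨C, hC⟩ := ((isCompact_closedBall p 1).prod
    (isCompact_Icc (a := (0 : ℝ)) (b := 1))).exists_bound_of_continuousOn hF'.continuousOn
  refine intervalIntegral.hasFDerivAt_integral_of_dominated_of_fderiv_le (bound := fun _ => C)
    (s := Metric.closedBall p 1) (Metric.closedBall_mem_nhds p one_pos)
    (Filter.Eventually.of_forall fun x => (hcF x).aestronglyMeasurable)
    ((hcF p).intervalIntegrable _ _)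
    ((hF'.comp (by fun_prop : Continuous (p, ·))).aestronglyMeasurable)
    (Filter.Eventually.of_forall fun u hu x hx => ?_) intervalIntegrable_const
    (Filter.Eventually.of_forall fun u _ x _ => ?_)
  · rw [uIoc_of_le zero_le_one] at hu
    exact hC (x, u) ⟨hx, Ioc_subset_Icc_self hu⟩
  · exact HasFDerivAt.comp (f := fun x : ℝ × ℝ => (x, u)) x
      (hF.differentiable (by simp) (x, u)).hasFDerivAt (hasFDerivAt_prodMk_left x u)

/-- The derivative of such an integral is again one, with values in a space of linear maps; hence
the induction runs over all target spaces at once. -/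
theorem contDiff_parametric_integral {E : Type} [NormedAddCommGroup E] [NormedSpace ℝ E]
    {F : ℝ × ℝ → ℝ → E} (hF : ContDiff ℝ ∞ (uncurry F)) :
    ContDiff ℝ ∞ fun p => ∫ u in (0 : ℝ)..1, F p u := by
  refine contDiff_infty.2 fun n => ?_
  induction n generalizing E with
  | zero =>
    refine contDiff_zero.2 ?_
    exact intervalIntegral.continuous_parametric_intervalIntegral_of_continuous' hF.continuous 0 1
  | succ n ih =>
    refine contDiff_succ_iff_hasFDerivAt.2 ⟨_, ?_, hasFDerivAt_parametric_integral hF⟩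
    exact ih ((hF.fderiv_right (m := ∞) (by simp)).clm_comp contDiff_const)

theorem triple_neg_neg_neg (a b c : R3) : triple (-a) (-b) (-c) = -triple a b c := by
  simp [triple]

theorem triple_swap (a b c : R3) : triple a c b = -triple a b c := by
  rw [triple, triple, ← cross_anticomm, dotProduct_neg]

theorem triple_sub_right (a b c : R3) : triple a (b - c) c = triple a b c := by
  simp [triple]

namespace ClosedCurve

variable (γ : ClosedCurve)

/-- The difference quotient `(γ(x + t) - γ(x)) / t`, extended smoothly to `t = 0`. -/
noncomputable def chord (p : ℝ × ℝ) : R3 := ∫ u in (0 : ℝ)..1, deriv γ.toFun (p.1 + u * p.2)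

theorem deriv_contDiff : ContDiff ℝ ∞ (deriv γ.toFun) := (contDiff_infty_iff_deriv.1 γ.smooth).2

theorem contDiff_chord : ContDiff ℝ ∞ γ.chord := by
  refine contDiff_parametric_integral ?_
  have h : ContDiff ℝ ∞ fun q : (ℝ × ℝ) × ℝ => q.1.1 + q.2 * q.1.2 := by fun_prop
  exact γ.deriv_contDiff.comp h

theorem smul_chord (x t : ℝ) : t • γ.chord (x, t) = γ.toFun (x + t) - γ.toFun x := by
  have hd : ∀ u : ℝ, HasDerivAt (fun u => γ.toFun (x + u * t))
      (t • deriv γ.toFun (x + u * t)) u := by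
    intro u
    have h1 : HasDerivAt γ.toFun (deriv γ.toFun (x + u * t)) (x + u * t) :=
      (γ.smooth.differentiable (by simp) _).hasDerivAt
    have h2 : HasDerivAt (fun u : ℝ => x + u * t) t u := by
      simpa using ((hasDerivAt_id u).mul_const t).const_add x
    exact h1.scomp u h2
  have hc : Continuous fun u : ℝ => t • deriv γ.toFun (x + u * t) :=
    (γ.deriv_contDiff.continuous.comp (by fun_prop)).const_smul t
  have := intervalIntegral.integral_eq_sub_of_hasDerivAt (fun u _ => hd u)
    (hc.intervalIntegrable 0 1)
  rw [intervalIntegral.integral_smul] at this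
  simpa [chord] using this

theorem chord_zero (x : ℝ) : γ.chord (x, 0) = deriv γ.toFun x := by
  simp [chord]

theorem deriv_periodic : Periodic (deriv γ.toFun) 1 := by
  intro s
  rw [← deriv_comp_add_const]
  congr 1
  exact funext γ.periodic

theorem chord_add_one (x t : ℝ) : γ.chord (x + 1, t) = γ.chord (x, t) := by
  simp only [chord]
  refine intervalIntegral.integral_congr fun u _ => ?_
  simp only [show x + 1 + u * t = x + u * t + 1 by ring, γ.deriv_periodic (x + u * t)]

variable {γ}

theorem IsKnot.ne (hγ : γ.IsKnot) (x : ℝ) {t : ℝ} (ht : t ∈ Ioo (0 : ℝ) 1) :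
    γ.toFun (x + t) ≠ γ.toFun x := by
  have hfract : ∀ s, γ.toFun (Int.fract s) = γ.toFun s := by
    intro s
    have := γ.periodic.sub_int_mul_eq ⌊s⌋ (x := s)
    rwa [mul_one] at this
  intro h
  rw [← hfract, ← hfract x] at h
  have hm : ∀ s : ℝ, Int.fract s ∈ Ico (0 : ℝ) 1 := fun s =>
    ⟨Int.fract_nonneg s, Int.fract_lt_one s⟩
  obtain ⟨m, hm⟩ := Int.fract_eq_fract.1 (hγ (hm _) (hm _) h)
  rw [add_sub_cancel_left] at hm
  have h1 : (0 : ℝ) < m := hm ▸ ht.1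
  have h2 : (m : ℝ) < 1 := hm ▸ ht.2
  have h1' : 0 < m := by exact_mod_cast h1
  have h2' : m < 1 := by exact_mod_cast h2
  omega

theorem IsKnot.chord_ne_zero (hγ : γ.IsKnot) (x : ℝ) {t : ℝ} (ht : t ∈ Ico (0 : ℝ) 1) :
    γ.chord (x, t) ≠ 0 := by
  rcases ht.1.eq_or_lt with rfl | h
  · rw [chord_zero]
    exact γ.regular x
  · intro h0
    have := γ.smul_chord x t
    rw [h0, smul_zero] at this
    exact hγ.ne x ⟨h, ht.2⟩ (sub_eq_zero.1 this.symm)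

variable (γ) in
/-- The Gauss map in the coordinates `(x, t)`, `y = x + t`, extended smoothly to `t = 0`. -/
noncomputable def chordDir (p : ℝ × ℝ) : R3 := direction (γ.chord p)

theorem chordDir_zero (x : ℝ) : γ.chordDir (x, 0) = γ.tangent x := by
  rw [chordDir, chord_zero]
  rfl

theorem chordDir_add_one (x t : ℝ) : γ.chordDir (x + 1, t) = γ.chordDir (x, t) := by
  rw [chordDir, chordDir, chord_add_one]

theorem IsKnot.chordDir_unit (hγ : γ.IsKnot) {p : ℝ × ℝ} (hp : p.2 ∈ Ico (0 : ℝ) 1) :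
    γ.chordDir p ⬝ᵥ γ.chordDir p = 1 :=
  direction_dot_self (hγ.chord_ne_zero p.1 hp)

theorem IsKnot.contDiffAt_chordDir (hγ : γ.IsKnot) {p : ℝ × ℝ} (hp : p.2 ∈ Ico (0 : ℝ) 1) :
    ContDiffAt ℝ ∞ γ.chordDir p := by
  have h0 : γ.chord p ≠ 0 := hγ.chord_ne_zero p.1 hp
  exact (ContDiffOn.direction (S := {p | γ.chord p ≠ 0}) γ.contDiff_chord.contDiffOn
    fun _ h => h).contDiffAt ((isOpen_ne.preimage γ.contDiff_chord.continuous).mem_nhds h0)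

theorem gaussMap_eq_chordDir {x y : ℝ} (h : x < y) : γ.gaussMap x y = γ.chordDir (x, y - x) := by
  have := γ.smul_chord x (y - x)
  rw [add_sub_cancel] at this
  rw [gaussMap, unitDir_eq_direction, ← this, direction_smul (sub_pos.2 h), chordDir]

theorem gaussMap_swap (x y : ℝ) : γ.gaussMap y x = -γ.gaussMap x y := by
  rw [gaussMap, gaussMap, unitDir_eq_direction, unitDir_eq_direction, ← direction_neg, neg_sub]

/-- The chord from `x + 1/2` to `x + 1` is the reversed chord from `x` to `x + 1/2`. -/
theorem chordDir_half (x : ℝ) : γ.chordDir (x + 1 / 2, 1 / 2) = -γ.chordDir (x, 1 / 2) := by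
  have h1 := gaussMap_eq_chordDir (γ := γ) (show x + 1 / 2 < x + 1 by linarith)
  have h2 := gaussMap_eq_chordDir (γ := γ) (show x < x + 1 / 2 by linarith)
  rw [show x + 1 - (x + 1 / 2) = 1 / 2 by ring] at h1
  rw [show x + 1 / 2 - x = 1 / 2 by ring] at h2
  rw [← h1, ← h2, ← gaussMap_swap, gaussMap, gaussMap, γ.periodic]

variable (γ) in
/-- The density of the pulled back area form in the coordinates `(x, t)`. -/
noncomputable def chordArea (p : ℝ × ℝ) : ℝ :=
  triple (γ.chordDir p) (fderiv ℝ γ.chordDir p (1, 0)) (fderiv ℝ γ.chordDir p (0, 1))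

theorem IsKnot.pullbackArea_chordDir (hγ : γ.IsKnot) {x t : ℝ} (ht : t ∈ Ico (0 : ℝ) 1) :
    pullbackArea (fun x t => γ.chordDir (x, t)) x t = γ.chordArea (x, t) := by
  have hd := ((hγ.contDiffAt_chordDir (p := (x, t)) ht).differentiableAt (by simp)).hasFDerivAt
  rw [pullbackArea, hd.hasDerivAt_fst.deriv, hd.hasDerivAt_snd.deriv, chordArea]

/-- With `t = y - x` the derivative in `x` becomes `∂_x - ∂_t`; the extra term repeats the last
entry of the determinant and drops out. -/
theorem IsKnot.pullbackArea_gaussMap (hγ : γ.IsKnot) {x t : ℝ} (ht : t ∈ Ioo (0 : ℝ) 1) :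
    pullbackArea γ.gaussMap x (x + t) = γ.chordArea (x, t) := by
  have hd := ((hγ.contDiffAt_chordDir (p := (x, t)) ⟨ht.1.le, ht.2⟩).differentiableAt
    (by simp)).hasFDerivAt
  have h1 : HasDerivAt (fun a => γ.gaussMap a (x + t))
      (fderiv ℝ γ.chordDir (x, t) (1, 0) - fderiv ℝ γ.chordDir (x, t) (0, 1)) x := by
    have hl : HasDerivAt (fun a : ℝ => (a, x + t - a)) ((1, -1) : ℝ × ℝ) x :=
      (hasDerivAt_id x).prodMk ((hasDerivAt_id x).const_sub (x + t))
    have hd' : HasFDerivAt γ.chordDir (fderiv ℝ γ.chordDir (x, t)) (x, x + t - x) := by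
      rwa [add_sub_cancel_left]
    have h := HasFDerivAt.comp_hasDerivAt (f := fun a : ℝ => (a, x + t - a)) x hd' hl
    rw [show ((1, -1) : ℝ × ℝ) = (1, 0) - (0, 1) by simp, map_sub] at h
    refine h.congr_of_eventuallyEq ?_
    filter_upwards [gt_mem_nhds (show x < x + t by linarith [ht.1])] with a ha
    exact gaussMap_eq_chordDir ha
  have h2 : HasDerivAt (fun b => γ.gaussMap x b) (fderiv ℝ γ.chordDir (x, t) (0, 1)) (x + t) := by
    have hl : HasDerivAt (fun b : ℝ => (x, b - x)) ((0, 1) : ℝ × ℝ) (x + t) :=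
      (hasDerivAt_const _ x).prodMk ((hasDerivAt_id _).sub_const x)
    have hd' : HasFDerivAt γ.chordDir (fderiv ℝ γ.chordDir (x, t)) (x, x + t - x) := by
      rwa [add_sub_cancel_left]
    refine (HasFDerivAt.comp_hasDerivAt (f := fun b : ℝ => (x, b - x)) (x + t) hd'
      hl).congr_of_eventuallyEq ?_
    filter_upwards [lt_mem_nhds (show x < x + t by linarith [ht.1])] with b hb
    exact gaussMap_eq_chordDir hb
  rw [pullbackArea, h1.deriv, h2.deriv, gaussMap_eq_chordDir (by linarith [ht.1]),
    add_sub_cancel_left, triple_sub_right, chordArea]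

variable (γ) in
theorem pullbackArea_gaussMap_swap (x y : ℝ) :
    pullbackArea γ.gaussMap y x = pullbackArea γ.gaussMap x y := by
  have h1 : (fun a => γ.gaussMap a x) = fun a => -γ.gaussMap x a :=
    funext fun a => gaussMap_swap x a
  have h2 : (fun b => γ.gaussMap y b) = fun b => -γ.gaussMap b y :=
    funext fun b => gaussMap_swap b y
  rw [pullbackArea, h1, h2, gaussMap_swap x y, deriv.fun_neg, deriv.fun_neg, triple_neg_neg_neg,
    triple_swap, neg_neg, pullbackArea]

variable (γ) in
theorem pullbackArea_gaussMap_periodic (x : ℝ) : Periodic (pullbackArea γ.gaussMap x) 1 := by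
  intro y
  have h : ∀ a b, γ.gaussMap a (b + 1) = γ.gaussMap a b := fun a b => by
    rw [gaussMap, gaussMap, γ.periodic]
  rw [pullbackArea, pullbackArea, ← deriv_comp_add_const]
  simp only [h]

theorem chordArea_add_one (x t : ℝ) : γ.chordArea (x + 1, t) = γ.chordArea (x, t) := by
  have h : fderiv ℝ γ.chordDir (x + 1, t) = fderiv ℝ γ.chordDir (x, t) := by
    have h1 := fderiv_comp_add_right (𝕜 := ℝ) (f := γ.chordDir) (x := (x, t)) ((1, 0) : ℝ × ℝ)
    have h2 : (fun p : ℝ × ℝ => γ.chordDir (p + (1, 0))) = γ.chordDir := by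
      funext p
      rw [show p + (1, 0) = (p.1 + 1, p.2) by ext <;> simp]
      exact chordDir_add_one p.1 p.2
    rw [h2] at h1
    simpa using h1.symm
  rw [chordArea, chordArea, h, chordDir_add_one]

theorem IsKnot.continuousOn_chordArea (hγ : γ.IsKnot) :
    ContinuousOn γ.chordArea (univ ×ˢ Ico 0 1) := by
  have h : ∀ p ∈ (univ : Set ℝ) ×ˢ Ico (0 : ℝ) 1, ContDiffAt ℝ ∞ γ.chordDir p := fun p hp =>
    hγ.contDiffAt_chordDir hp.2
  have h1 : ContinuousOn γ.chordDir (univ ×ˢ Ico 0 1) := fun p hp =>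
    (h p hp).continuousAt.continuousWithinAt
  have h2 : ContinuousOn (fderiv ℝ γ.chordDir) (univ ×ˢ Ico 0 1) := fun p hp =>
    ((h p hp).fderiv_right (m := 0) (by simp)).continuousAt.continuousWithinAt
  exact continuousOn_triple h1 (h2.clm_apply continuousOn_const) (h2.clm_apply continuousOn_const)

end ClosedCurve

/-! ### Reduction to half of the annulus. -/

theorem integral_integral_swap_of_continuous {F : ℝ → ℝ → ℝ} (hF : Continuous (uncurry F))
    (a b c d : ℝ) :
    ∫ x in a..b, ∫ t in c..d, F x t = ∫ t in c..d, ∫ x in a..b, F x t := by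
  refine MeasureTheory.intervalIntegral_intervalIntegral_swap ?_
  exact (hF.continuousOn.integrableOn_compact (isCompact_uIcc.prod isCompact_uIcc)).mono_set
    (prod_mono uIoc_subset_uIcc uIoc_subset_uIcc)

/-- The integral over the torus of a symmetric function is twice the integral over the half
`0 ≤ y - x ≤ 1/2`. -/
theorem integral_torus_symmetric {g A : ℝ → ℝ → ℝ} (hA : Continuous (uncurry A))
    (hAp : ∀ t, Periodic (fun x => A x t) 1) (hgp : ∀ x, Periodic (g x) 1)
    (hsymm : ∀ x y, g y x = g x y)
    (hgA : ∀ x, ∀ t ∈ Ioo (0 : ℝ) (1 / 2), g x (x + t) = A x t) :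
    ∫ x in (0 : ℝ)..1, ∫ y in (0 : ℝ)..1, g x y =
      2 * ∫ x in (0 : ℝ)..1, ∫ t in (0 : ℝ)..(1 / 2), A x t := by
  have hAd : Continuous (uncurry fun x t => A (x - t) t) :=
    hA.comp (by fun_prop : Continuous fun p : ℝ × ℝ => (p.1 - p.2, p.2))
  have hright : ∀ x, EqOn (fun y => A x (y - x)) (g x) (uIoo x (x + 1 / 2)) := by
    intro x y hy
    rw [uIoo_of_le (by linarith)] at hy
    have h := hgA x (y - x) ⟨by linarith [hy.1], by linarith [hy.2]⟩
    rw [add_sub_cancel] at h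
    exact h.symm
  have hleft : ∀ x, EqOn (fun y => A y (x - y)) (g x) (uIoo (x - 1 / 2) x) := by
    intro x y hy
    rw [uIoo_of_le (by linarith)] at hy
    have h := hgA y (x - y) ⟨by linarith [hy.2], by linarith [hy.1]⟩
    rw [add_sub_cancel] at h
    exact h.symm.trans (hsymm x y)
  have hcr : ∀ x, Continuous fun y => A x (y - x) := fun x =>
    hA.comp (by fun_prop : Continuous fun y => (x, y - x))
  have hcl : ∀ x, Continuous fun y => A y (x - y) := fun x =>
    hA.comp (by fun_prop : Continuous fun y => (y, x - y))
  -- The period in `y` is centred at `x`. The part `y > x` gives `A x t`, the part `y < x` gives `A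
  -- (x - t) t` by symmetry, and a translation in `x` identifies their integrals.
  have hinner : ∀ x, ∫ y in (0 : ℝ)..1, g x y =
      (∫ t in (0 : ℝ)..(1 / 2), A (x - t) t) + ∫ t in (0 : ℝ)..(1 / 2), A x t := by
    intro x
    have h1 := (hgp x).intervalIntegral_add_eq 0 (x - 1 / 2)
    rw [zero_add, show x - 1 / 2 + 1 = x + 1 / 2 by ring] at h1
    rw [h1, ← intervalIntegral.integral_add_adjacent_intervals (b := x)
      (((hcl x).intervalIntegrable _ _).congr_uIoo (hleft x))
      (((hcr x).intervalIntegrable _ _).congr_uIoo (hright x)),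
      ← intervalIntegral.integral_congr_uIoo (hleft x),
      ← intervalIntegral.integral_congr_uIoo (hright x)]
    congr 1
    · have := intervalIntegral.integral_comp_sub_left (a := 0) (b := 1 / 2)
        (fun y => A y (x - y)) x
      simp only [sub_sub_cancel, sub_zero] at this
      exact this.symm
    · have := intervalIntegral.integral_comp_sub_right (a := x) (b := x + 1 / 2) (A x) x
      rw [sub_self, add_sub_cancel_left] at this
      exact this
  have hshift : ∫ x in (0 : ℝ)..1, ∫ t in (0 : ℝ)..(1 / 2), A (x - t) t =
      ∫ x in (0 : ℝ)..1, ∫ t in (0 : ℝ)..(1 / 2), A x t := by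
    rw [integral_integral_swap_of_continuous hAd, integral_integral_swap_of_continuous hA]
    refine intervalIntegral.integral_congr fun t _ => ?_
    have h2 := (hAp t).intervalIntegral_add_eq (0 - t) 0
    rw [zero_add, show 0 - t + 1 = 1 - t by ring] at h2
    exact (intervalIntegral.integral_comp_sub_right (fun x => A x t) t).trans h2
  have hint : ∀ {F : ℝ → ℝ → ℝ}, Continuous (uncurry F) →
      Continuous fun x => ∫ t in (0 : ℝ)..(1 / 2), F x t := fun {F} hF =>
    intervalIntegral.continuous_parametric_intervalIntegral_of_continuous' hF 0 (1 / 2)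
  simp only [hinner]
  rw [intervalIntegral.integral_add ((hint hAd).intervalIntegrable _ _)
    ((hint hA).intervalIntegrable _ _), hshift]
  ring

/-- The Gauss integral is twice the integral over the part `0 ≤ t ≤ 1/2` of the annulus with
coordinates `(x, t)`, `y = x + t`, since the Gauss map is antipodally equivariant. -/
theorem ClosedCurve.IsKnot.gaussIntegral_eq {γ : ClosedCurve} (hγ : γ.IsKnot) :
    γ.gaussIntegral = 2 * ∫ x in (0 : ℝ)..1, ∫ t in (0 : ℝ)..(1 / 2),
      pullbackArea (fun x t => γ.chordDir (x, t)) x t := by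
  -- Clamping `t` to `[0, 1/2]` gives a continuous function on the plane and avoids `t = 1`, where
  -- the chord vanishes.
  have hA : Continuous (uncurry fun x t => γ.chordArea (x, max 0 (min t (1 / 2)))) := by
    refine hγ.continuousOn_chordArea.comp_continuous
      (f := fun p : ℝ × ℝ => (p.1, max 0 (min p.2 (1 / 2)))) (by fun_prop)
      fun p => ⟨mem_univ _, ?_, ?_⟩
    · exact le_max_left _ _
    · exact max_lt one_pos (lt_of_le_of_lt (min_le_right _ _) (by norm_num))
  have hAeq : ∀ x, ∀ t ∈ Icc (0 : ℝ) (1 / 2), γ.chordArea (x, max 0 (min t (1 / 2))) =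
      γ.chordArea (x, t) := fun x t ht => by rw [min_eq_left ht.2, max_eq_right ht.1]
  refine (integral_torus_symmetric hA (fun t x => γ.chordArea_add_one _ _)
    γ.pullbackArea_gaussMap_periodic (fun x y => γ.pullbackArea_gaussMap_swap x y)
    fun x t ht => ?_).trans ?_
  · rw [hAeq x t ⟨ht.1.le, ht.2.le⟩]
    exact hγ.pullbackArea_gaussMap ⟨ht.1, by linarith [ht.2]⟩
  · congr 1
    refine intervalIntegral.integral_congr fun x _ =>
      intervalIntegral.integral_congr fun t ht => ?_
    rw [uIcc_of_le (by norm_num)] at ht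
    exact (hAeq x t ht).trans (hγ.pullbackArea_chordDir ⟨ht.1, by linarith [ht.2]⟩).symm

/-! ### Parity on the antipodal circle. -/

/-- The correction term of a framing of an antipodally symmetric curve on the sphere is an integer,
and it is odd if and only if the loop of frames lifts to a loop of unit quaternions. -/
theorem antipodal_parity {w n : ℝ → R3} (hw : ContDiff ℝ ∞ w) (hn : ContDiff ℝ ∞ n)
    (hw1 : ∀ x, w x ⬝ᵥ w x = 1) (hn1 : ∀ x, n x ⬝ᵥ n x = 1) (hwn : ∀ x, w x ⬝ᵥ n x = 0)
    (hwa : ∀ x, w (x + 1 / 2) = -w x) (hnp : Periodic n 1) :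
    ∃ m : ℤ, ∫ x in (0 : ℝ)..1, n x ⬝ᵥ deriv (fun x => w x ⨯₃ n x) x = 2 * Real.pi * m ∧
      (IsEvenLoop (fun x => frameOf (w x) (n x)) ↔ Odd m) := by
  set b : ℝ → R3 := fun x => w x ⨯₃ n x with hb
  have hbs : ContDiff ℝ ∞ b :=
    contDiffOn_univ.1 ((contDiffOn_univ.2 hw).cross (contDiffOn_univ.2 hn))
  have hb1 : ∀ x, b x ⬝ᵥ b x = 1 := fun x => by
    simp only [hb, cross_dot_cross, hw1, hn1, hwn, dotProduct_comm (n x) (w x)]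
    simp
  have hnb : ∀ x, n x ⬝ᵥ b x = 0 := fun x => dot_cross_self _ _
  have hwb : ∀ x, w x ⨯₃ b x = -n x := fun x => by
    simp only [hb, cross_cross_eq_smul_sub_smul', hwn, hw1]
    simp
  have hwn' : ∀ x, w x ⬝ᵥ n (x + 1 / 2) = 0 := fun x => by
    have := hwn (x + 1 / 2)
    rwa [hwa, neg_dotProduct, neg_eq_zero] at this
  have hns : ContDiff ℝ ∞ fun x => n (x + 1 / 2) := hn.comp (by fun_prop)
  -- The vectors `w x` and `w (x + 1/2)` are opposite, so both have the same normal plane, and `θ`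
  -- is the angle from `n x` to `n (x + 1/2)` in it.
  obtain ⟨θ, hθ, hc, hs⟩ := exists_angle
    (contDiffOn_univ.1 ((contDiffOn_univ.2 hns).dotProduct (contDiffOn_univ.2 hn)))
    (contDiffOn_univ.1 ((contDiffOn_univ.2 hns).dotProduct (contDiffOn_univ.2 hbs)))
    fun x => normal_coords_sq (hw1 x) (hn1 x) (hwn x) (hwn' x) (hn1 _)
  have hnh : ∀ x, n (x + 1 / 2) = Real.cos (θ x) • n x + Real.sin (θ x) • b x := fun x => by
    rw [← hc, ← hs]
    exact normal_expansion (hw1 x) (hn1 x) (hwn x) (hwn' x)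
  have hbh : ∀ x, b (x + 1 / 2) = Real.sin (θ x) • n x - Real.cos (θ x) • b x := fun x => by
    change w (x + 1 / 2) ⨯₃ n (x + 1 / 2) = _
    rw [hwa, hnh, map_neg, LinearMap.neg_apply, map_add, map_smul, map_smul, hwb]
    simp only [hb]
    module
  have hnp' : ∀ x, n (x + 1 / 2 + 1 / 2) = n x := fun x => by
    rw [add_assoc, show (1 / 2 + 1 / 2 : ℝ) = 1 by norm_num, hnp]
  obtain ⟨m, hm⟩ := exists_int_of_cos_sin_eq (u := fun x => θ (x + 1 / 2)) (v := θ)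
    (hθ.continuous.comp (by fun_prop)) hθ.continuous
    (fun x => by rw [← hc, ← hc, hnp', dotProduct_comm])
    (fun x => by
      rw [← hs (x + 1 / 2), hnp', hbh]
      simp [hn1, hnb])
  refine ⟨m, ?_, ?_⟩
  · have dn : ∀ x, HasDerivAt n (deriv n x) x := fun x =>
      (hn.differentiable (by simp) x).hasDerivAt
    have db : ∀ x, HasDerivAt b (deriv b x) x := fun x =>
      (hbs.differentiable (by simp) x).hasDerivAt
    have dθ : ∀ x, HasDerivAt θ (deriv θ x) x := fun x =>
      (hθ.differentiable (by simp) x).hasDerivAt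
    set a : ℝ → ℝ := fun x => n x ⬝ᵥ deriv b x
    have ha : Continuous a := Continuous.dotProduct hn.continuous (hbs.continuous_deriv (by simp))
    -- The normal plane is traversed with reversed orientation, so `a` changes sign up to `θ'`. The
    -- two halves of the period then cancel except for the increment `2πm` of `θ`.
    have hah : ∀ x, a (x + 1 / 2) = deriv θ x - a x := by
      intro x
      have h1 : HasDerivAt (fun x => b (x + 1 / 2)) (deriv b (x + 1 / 2)) x :=
        (db (x + 1 / 2)).comp_add_const x (1 / 2)
      have h2 := ((dθ x).sin.fun_smul (dn x)).fun_sub ((dθ x).cos.fun_smul (db x))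
      simp only [hbh] at h1
      have hnn := (dn x).dot_const_eq (dn x) hn1
      have hbb := (db x).dot_const_eq (db x) hb1
      have hnb' := (dn x).dot_const_eq (db x) hnb
      simp only [a]
      rw [h1.unique h2, hnh]
      simp only [add_dotProduct, dotProduct_add, dotProduct_sub, smul_dotProduct, dotProduct_smul,
        smul_eq_mul, hn1, hb1, hnb, dotProduct_comm (b x) (n x), dotProduct_comm (deriv n x) (n x),
        dotProduct_comm (deriv n x) (b x), dotProduct_comm (deriv b x) (b x)] at hnn hbb hnb' ⊢
      have hcs := Real.cos_sq_add_sin_sq (θ x)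
      grind
    have hsplit : ∫ x in (0 : ℝ)..1, a x =
        (∫ x in (0 : ℝ)..(1 / 2), a x) + ∫ x in (0 : ℝ)..(1 / 2), a (x + 1 / 2) := by
      rw [intervalIntegral.integral_comp_add_right a,
        ← intervalIntegral.integral_add_adjacent_intervals
        (ha.intervalIntegrable 0 (1 / 2)) (ha.intervalIntegrable (1 / 2) 1)]
      norm_num
    change ∫ x in (0 : ℝ)..1, a x = _
    rw [hsplit]
    simp only [hah]
    rw [intervalIntegral.integral_sub ((hθ.continuous_deriv (by simp)).intervalIntegrable _ _)
      (ha.intervalIntegrable _ _), add_sub_cancel,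
      intervalIntegral.integral_deriv_eq_sub (fun x _ => (dθ x).differentiableAt)
        ((hθ.continuous_deriv (by simp)).intervalIntegrable _ _)]
    have := hm 0
    rw [zero_add] at this
    rw [this]
    ring
  · have hmem : ∀ x, frameOf (w x) (n x) ∈ Matrix.specialOrthogonalGroup (Fin 3) ℝ := fun x =>
      frameOf_mem (hw1 x) (hn1 x) (hwn x)
    have hfc := continuousOn_frameOf (S := univ) hw.continuous.continuousOn
      hn.continuous.continuousOn
    obtain ⟨q, hq, hl⟩ := exists_path_lift (hfc.mono (subset_univ _)) fun x _ => hmem x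
    have hflip : ∀ x, frameOf (w (x + 1 / 2)) (n (x + 1 / 2)) =
        flipFrame (frameOf (w x) (n x)) (θ x) := by
      intro x
      have h3 : w (x + 1 / 2) ⨯₃ n (x + 1 / 2) = _ := hbh x
      rw [frameOf, h3, hnh, hwa]
      rfl
    have hsub : ∀ x ∈ Icc (0 : ℝ) (1 / 2), x ∈ Icc (0 : ℝ) 1 ∧ x + 1 / 2 ∈ Icc (0 : ℝ) 1 :=
      fun x hx => ⟨⟨hx.1, by linarith [hx.2]⟩, ⟨by linarith [hx.1], by linarith [hx.2]⟩⟩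
    -- The shifted lift is the flipped lift up to a constant sign `ε`. Used at `0` and at `1/2` this
    -- makes `q 1` a double flip of `q 0`, where `ε` enters squared and the growth of `θ / 2` by
    -- `πm` gives `(-1)^m`.
    obtain ⟨ε, hε, h⟩ := isPreconnected_Icc.lift_unique
      (f := fun x => frameOf (w (x + 1 / 2)) (n (x + 1 / 2)))
      (p := fun x => quatFlip (q x) (θ x / 2)) (q := fun x => q (x + 1 / 2))
      (continuousOn_quatFlip (hq.mono fun x hx => (hsub x hx).1)
        (hθ.continuous.div_const 2).continuousOn)
      (fun x hx => by
        have := (hl x (hsub x hx).1).flip (θ x / 2)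
        rwa [mul_div_cancel₀ _ two_ne_zero, ← hflip] at this)
      (hq.comp (by fun_prop) fun x hx => (hsub x hx).2)
      (fun x hx => hl _ (hsub x hx).2)
    have m0 : (0 : ℝ) ∈ Icc (0 : ℝ) (1 / 2) := ⟨le_rfl, by norm_num⟩
    have m2 : (1 / 2 : ℝ) ∈ Icc (0 : ℝ) (1 / 2) := ⟨by norm_num, le_rfl⟩
    have e1 := h 0 m0
    have e2 := h (1 / 2) m2
    have hθh : θ (1 / 2) / 2 = θ 0 / 2 + m * Real.pi := by
      have := hm 0
      rw [zero_add] at this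
      rw [this]
      ring
    simp only [zero_add] at e1
    rw [show (1 / 2 + 1 / 2 : ℝ) = 1 by norm_num, hθh, quatFlip_add_int_mul_pi, e1, quatFlip_smul,
      quatFlip_quatFlip] at e2
    have hεε : ε * ε = 1 := by rcases hε with rfl | rfl <;> norm_num
    rw [isEvenLoop_iff hq hl, e2]
    have hq0 : q 0 ≠ 0 := ne_zero_of_dotProduct_self_eq_one (hl 0 (by simp)).1
    rw [show ε • (-1 : ℝ) ^ m • ε • -q 0 = (-(-1 : ℝ) ^ m) • q 0 by
      rw [smul_smul, smul_smul, smul_neg, ← neg_smul]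
      congr 1
      linear_combination (-(-1 : ℝ) ^ m) * hεε]
    rcases Int.even_or_odd m with hmm | hmm
    · simp only [hmm.neg_one_zpow, neg_smul, one_smul, neg_eq_self, hq0, false_iff,
        Int.not_odd_iff_even, hmm]
    · simp [hmm.neg_one_zpow, hmm]

/-! ### Degrees of the extended Gauss maps. -/

section Degree

variable {γ : ClosedCurve}

/-- A normal field along the Gauss map on the half `0 ≤ t ≤ 1/2` of the annulus which extends a
given framing of the curve. -/
theorem ClosedCurve.IsKnot.exists_normal_chordDir (hγ : γ.IsKnot) (φ : Framing γ) :
    ∃ μ : ℝ × ℝ → R3, ContDiffOn ℝ ∞ μ (univ ×ˢ Icc 0 (1 / 2)) ∧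
      (∀ p ∈ (univ : Set ℝ) ×ˢ Icc (0 : ℝ) (1 / 2), μ p ⬝ᵥ μ p = 1) ∧
      (∀ p ∈ (univ : Set ℝ) ×ˢ Icc (0 : ℝ) (1 / 2), γ.chordDir p ⬝ᵥ μ p = 0) ∧
      (∀ x t, μ (x + 1, t) = μ (x, t)) ∧ ∀ x, μ (x, 0) = φ.normal x := by
  have hmem : ∀ r ∈ Icc (0 : ℝ) 1, ∀ t ∈ Icc (0 : ℝ) (1 / 2), r * t ∈ Ico (0 : ℝ) 1 :=
    fun r hr t ht => ⟨mul_nonneg hr.1 ht.1, by nlinarith [hr.1, hr.2, ht.1, ht.2]⟩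
  obtain ⟨N, hN, hpos⟩ := exists_subdivision_pos
    (K := Icc (0 : ℝ) 1 ×ˢ Icc (0 : ℝ) (1 / 2)) (isCompact_Icc.prod isCompact_Icc)
    (D := fun r r' z => γ.chordDir (z.1, r * z.2) ⬝ᵥ γ.chordDir (z.1, r' * z.2))
    (by
      refine ContinuousOn.dotProduct' ?_ ?_
      · intro p hp
        refine ContinuousAt.continuousWithinAt ?_
        exact ContinuousAt.comp (f := fun p : ℝ × ℝ × ℝ × ℝ => (p.2.2.1, p.1 * p.2.2.2))
          (hγ.contDiffAt_chordDir (hmem _ hp.1 _ hp.2.2.2)).continuousAt (by fun_prop)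
      · intro p hp
        refine ContinuousAt.continuousWithinAt ?_
        exact ContinuousAt.comp (f := fun p : ℝ × ℝ × ℝ × ℝ => (p.2.2.1, p.2.1 * p.2.2.2))
          (hγ.contDiffAt_chordDir (hmem _ hp.2.1 _ hp.2.2.2)).continuousAt (by fun_prop))
    (fun r hr z hz => by
      rw [hγ.chordDir_unit (hmem r hr _ hz.2)]
      exact one_pos)
  -- The strip is not compact; the subdivision chosen over one period in `x` serves everywhere by
  -- periodicity.
  have hfract : ∀ x t, γ.chordDir (Int.fract x, t) = γ.chordDir (x, t) := fun x t => by
    have hp : Periodic (fun x => γ.chordDir (x, t)) 1 := fun x => chordDir_add_one x t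
    have := hp.sub_int_mul_eq (x := x) ⌊x⌋
    rwa [mul_one] at this
  obtain ⟨μ, hμ, hμ1, hμ0, hμp, hμν⟩ := exists_normal_transport (n := ∞)
    (S := univ ×ˢ Icc (0 : ℝ) (1 / 2))
    (H := fun r z => γ.chordDir (z.1, r * z.2)) hN
    (fun r hr p hp => by
      refine ContDiffAt.contDiffWithinAt ?_
      exact ContDiffAt.comp (f := fun p : ℝ × ℝ => (p.1, r * p.2)) p
        (hγ.contDiffAt_chordDir (hmem r hr _ hp.2)) (by fun_prop))
    (fun r hr p hp => hγ.chordDir_unit (hmem r hr _ hp.2))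
    (fun k hk p hp => by
      have := hpos k hk (Int.fract p.1, p.2)
        ⟨⟨Int.fract_nonneg _, (Int.fract_lt_one _).le⟩, hp.2⟩
      simpa only [hfract] using this)
    (ν := fun p => φ.normal p.1) (φ.smooth.comp contDiff_fst).contDiffOn
    (fun p _ => φ.unit _)
    (fun p _ => by rw [zero_mul, chordDir_zero]; exact φ.orthogonal _)
  refine ⟨μ, hμ, hμ1, fun p hp => ?_, fun x t => ?_, fun x => ?_⟩
  · have := hμ0 p hp
    rwa [one_mul] at this
  · exact hμp _ _ (fun r => chordDir_add_one _ _) (φ.periodic x)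
  · exact hμν (x, 0) ⟨mem_univ _, le_rfl, by norm_num⟩ fun r => by simp

/-- The Gauss integral of a knot in terms of the correction term of a framing. -/
theorem ClosedCurve.IsKnot.gaussIntegral_eq_tau (hγ : γ.IsKnot) (φ : Framing γ) :
    ∃ m : ℤ, γ.gaussIntegral = 4 * Real.pi * φ.tau - 4 * Real.pi * m ∧
      (IsEvenLoop φ.frameMatrix ↔ Odd m) := by
  obtain ⟨μ, hμ, hμ1, hμ0, hμp, hμν⟩ := hγ.exists_normal_chordDir φ
  have hIco : ∀ {t : ℝ}, t ∈ Icc (0 : ℝ) (1 / 2) → t ∈ Ico (0 : ℝ) 1 := fun {t} ht =>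
    ⟨ht.1, by linarith [ht.2]⟩
  have hB : ContDiffOn ℝ ∞ γ.chordDir (univ ×ˢ Icc 0 (1 / 2)) := fun p hp =>
    (hγ.contDiffAt_chordDir (hIco hp.2)).contDiffWithinAt
  have hB1 : ∀ p ∈ (univ : Set ℝ) ×ˢ Icc (0 : ℝ) (1 / 2), γ.chordDir p ⬝ᵥ γ.chordDir p = 1 :=
    fun p hp => hγ.chordDir_unit (hIco hp.2)
  have hhalf : ∀ x : ℝ, (x, (1 / 2 : ℝ)) ∈ (univ : Set ℝ) ×ˢ Icc (0 : ℝ) (1 / 2) := fun x =>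
    ⟨mem_univ _, by norm_num, le_rfl⟩
  have hline : ContDiff ℝ ∞ fun x : ℝ => (x, (1 / 2 : ℝ)) := by fun_prop
  have stokes := integral_pullbackArea_strip (by norm_num) hB hμ hB1 hμ1 hμ0
    (fun t _ x => chordDir_add_one x t) (fun t _ x => hμp x t)
  obtain ⟨m, hm, hodd⟩ := antipodal_parity
    (w := fun x => γ.chordDir (x, 1 / 2)) (n := fun x => μ (x, 1 / 2))
    (contDiffOn_univ.1 (hB.comp hline.contDiffOn fun x _ => hhalf x))
    (contDiffOn_univ.1 (hμ.comp hline.contDiffOn fun x _ => hhalf x))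
    (fun x => hB1 _ (hhalf x)) (fun x => hμ1 _ (hhalf x)) (fun x => hμ0 _ (hhalf x))
    (fun x => chordDir_half x) (fun x => hμp x _)
  refine ⟨m, ?_, ?_⟩
  · have htau : ∫ x in (0 : ℝ)..1, μ (x, 0) ⬝ᵥ deriv (fun x => γ.chordDir (x, 0) ⨯₃ μ (x, 0)) x =
        2 * Real.pi * φ.tau := by
      rw [φ.two_pi_mul_tau]
      simp only [chordDir_zero, hμν]
      exact intervalIntegral.integral_congr fun s _ => dotProduct_comm _ _
    rw [hγ.gaussIntegral_eq, stokes, hm, htau]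
    ring
  · rw [← hodd]
    have hmaps : MapsTo (fun p : ℝ × ℝ => (p.2, p.1 / 2)) (Icc 0 1 ×ˢ Icc 0 1)
        (univ ×ˢ Icc 0 (1 / 2)) := fun p hp =>
      ⟨mem_univ _, by have := hp.1.1; positivity, by have := hp.1.2; dsimp only; linarith⟩
    have hc : ContinuousOn (fun p : ℝ × ℝ => (p.2, p.1 / 2)) (Icc (0 : ℝ) 1 ×ˢ Icc (0 : ℝ) 1) := by
      fun_prop
    -- The circles `t = r / 2` join the framing of the curve to the frames over the middle circle,
    -- which therefore have the same parity.
    have h := isEvenLoop_congr_of_homotopy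
      (H := fun p : ℝ × ℝ => frameOf (γ.chordDir (p.2, p.1 / 2)) (μ (p.2, p.1 / 2)))
      (continuousOn_frameOf (hB.continuousOn.comp hc hmaps) (hμ.continuousOn.comp hc hmaps))
      (fun p hp => frameOf_mem (hB1 _ (hmaps hp)) (hμ1 _ (hmaps hp)) (hμ0 _ (hmaps hp)))
      (fun r _ => by
        have h1 := γ.chordDir_add_one 0 (r / 2)
        have h2 := hμp 0 (r / 2)
        rw [zero_add] at h1 h2
        simp only [h1, h2])
    simp only [zero_div, chordDir_zero, hμν] at h
    exact h

/-- The area swept out by the half-circles from `-T` through `n` to `T`. -/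
theorem Framing.integral_cylinderMap (φ : Framing γ) :
    ∫ s in (0 : ℝ)..1, ∫ θ in (0 : ℝ)..Real.pi, pullbackArea φ.cylinderMap s θ =
      -(4 * Real.pi * φ.tau) := by
  have key : ∀ s, ∫ θ in (0 : ℝ)..Real.pi, pullbackArea φ.cylinderMap s θ =
      -(2 * (deriv φ.binormal s ⬝ᵥ φ.normal s)) := by
    intro s
    have dT : HasDerivAt γ.tangent (deriv γ.tangent s) s :=
      (γ.tangent_contDiff.differentiable (by simp) s).hasDerivAt
    have dn : HasDerivAt φ.normal (deriv φ.normal s) s :=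
      (φ.smooth.differentiable (by simp) s).hasDerivAt
    have db : HasDerivAt φ.binormal (deriv φ.binormal s) s :=
      (φ.binormal_contDiff.differentiable (by simp) s).hasDerivAt
    have hnb := dn.dot_const_eq db φ.normal_dot_binormal
    have hpt : ∀ θ, pullbackArea φ.cylinderMap s θ =
        -Real.cos θ * (deriv γ.tangent s ⬝ᵥ φ.binormal s) +
          Real.sin θ * (deriv φ.normal s ⬝ᵥ φ.binormal s) := by
      intro θ
      have h1 : HasDerivAt (fun x => φ.cylinderMap x θ)
          ((-Real.cos θ) • deriv γ.tangent s + Real.sin θ • deriv φ.normal s) s :=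
        (dT.fun_const_smul (-Real.cos θ)).fun_add (dn.fun_const_smul (Real.sin θ))
      have h2 : HasDerivAt (fun y => φ.cylinderMap s y)
          (Real.sin θ • γ.tangent s + Real.cos θ • φ.normal s) θ := by
        have := ((Real.hasDerivAt_cos θ).neg.smul_const (γ.tangent s)).add
          ((Real.hasDerivAt_sin θ).smul_const (φ.normal s))
        rwa [neg_neg] at this
      rw [pullbackArea, h1.deriv, h2.deriv, cylinderMap, Framing.binormal]
      generalize deriv γ.tangent s = T'
      generalize deriv φ.normal s = n'
      generalize γ.tangent s = T
      generalize φ.normal s = n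
      simp only [triple, cross_apply, dotProduct, Fin.sum_univ_three, Pi.add_apply, Pi.smul_apply,
        smul_eq_mul, Matrix.cons_val]
      have := Real.sin_sq_add_cos_sq θ
      grind
    simp only [hpt]
    -- Over `[0, π]` the cosine integrates to `0` and the sine to `2`.
    rw [intervalIntegral.integral_add (Continuous.intervalIntegrable (by fun_prop) _ _)
      (Continuous.intervalIntegrable (by fun_prop) _ _), intervalIntegral.integral_mul_const,
      intervalIntegral.integral_mul_const, intervalIntegral.integral_neg, integral_cos,
      integral_sin]
    simp only [Real.sin_pi, Real.sin_zero, Real.cos_zero, Real.cos_pi,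
      dotProduct_comm (deriv φ.binormal s)]
    linarith
  simp only [key]
  rw [intervalIntegral.integral_neg, intervalIntegral.integral_const_mul, ← φ.two_pi_mul_tau]
  ring

theorem Framing.extendedGaussDegree_eq (φ : Framing γ) :
    φ.extendedGaussDegree = γ.gaussIntegral / (4 * Real.pi) - φ.tau := by
  have := Real.pi_ne_zero
  rw [extendedGaussDegree, φ.integral_cylinderMap]
  field_simp
  ring

/-- The antipodal map reverses the area form, so the contributions of the oppositely oriented discs
`β` and `-β` add up. -/
theorem discArea_neg (f : ℂ → R3) : discArea (fun z => -f z) = -discArea f := by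
  rw [discArea, discArea, ← MeasureTheory.integral_neg]
  refine MeasureTheory.integral_congr_ae (Filter.Eventually.of_forall fun z => ?_)
  simp only [fderiv_fun_neg, neg_apply, triple_neg_neg_neg]

theorem Swaddling.extendedGaussDegree_eq (β : Swaddling γ) :
    β.extendedGaussDegree = γ.gaussIntegral / (4 * Real.pi) - β.tau := by
  have := Real.pi_ne_zero
  rw [extendedGaussDegree, discArea_neg, tau]
  field_simp
  ring

/-- Every swaddling map lifts to a null-homotopic framing. -/
theorem Swaddling.exists_even_framing (β : Swaddling γ) :
    ∃ φ : Framing γ, IsEvenLoop φ.frameMatrix ∧ φ.tau = β.tau := by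
  obtain ⟨_, φ, -, -, -, -, h⟩ := β.exists_framing
  exact ⟨φ, φ.nullhomotopic_iff.1 (Swaddling.liftsTo_of_tau_eq h.symm).nullhomotopic, h⟩

/-- A framing can be rotated so that its correction term changes by an even integer. -/
theorem Framing.exists_even_shift (φ : Framing γ) (h : IsEvenLoop φ.frameMatrix) (k : ℤ) :
    ∃ ψ : Framing γ, IsEvenLoop ψ.frameMatrix ∧ ψ.tau = φ.tau - 2 * k := by
  refine ⟨φ.rotate (fun s => 2 * Real.pi * (2 * k : ℤ) * s) (by fun_prop) (2 * k)
    (fun s => by ring), ?_, ?_⟩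
  · rw [Framing.isEvenLoop_rotate]
    simp [h]
  · rw [Framing.rotate_tau]
    push_cast
    ring

end Degree

/-! ### Assembly of the claims. -/

theorem mainTheorem3 (γ : ClosedCurve) :
    (∀ (φ : Framing γ) (β : Swaddling γ), φ.loop.Nullhomotopic →
      ∃ k : ℤ, 2 * Real.pi * β.tau + 4 * Real.pi * k = 2 * Real.pi * φ.tau) ∧
    (∀ φ : Framing γ, φ.loop.Nullhomotopic →
      ∀ k : ℤ, ∃ β : Swaddling γ,
        2 * Real.pi * β.tau + 4 * Real.pi * k = 2 * Real.pi * φ.tau) ∧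
    (∀ (β : Swaddling γ) (k : ℤ), ∃ φ : Framing γ, φ.loop.Nullhomotopic ∧
      2 * Real.pi * β.tau + 4 * Real.pi * k = 2 * Real.pi * φ.tau) ∧
    (∀ (φ : Framing γ) (β : Swaddling γ),
      β.LiftsTo φ ↔ φ.loop.Nullhomotopic ∧ β.tau = φ.tau) ∧
    (γ.IsKnot →
      (∀ φ : Framing γ, ∃ d : ℤ, φ.extendedGaussDegree = d ∧
        (φ.loop.Nullhomotopic ↔ Odd d)) ∧
      ∀ β : Swaddling γ, ∃ d : ℤ, β.extendedGaussDegree = d ∧ Odd d) := by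
  have hπ := Real.pi_ne_zero
  refine ⟨fun φ β h => ?_, fun φ h k => ?_, fun β k => ?_, fun φ β => ?_, fun hγ =>
    ⟨fun φ => ?_, fun β => ?_⟩⟩
  -- Relative to an even framing with the correction term of `β`, the even framing `φ` has even
  -- winding number `2j`, which lowers `τ` by `2j`.
  · obtain ⟨ψ, hψ, hτ⟩ := β.exists_even_framing
    obtain ⟨θ, hθ, w, hw, hn⟩ := ψ.exists_rotate φ
    obtain rfl := Framing.eq_of_normal_eq hn
    rw [Framing.nullhomotopic_iff, Framing.isEvenLoop_rotate] at h
    obtain ⟨j, rfl⟩ := h.1 hψ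
    refine ⟨-j, ?_⟩
    rw [Framing.rotate_tau, hτ]
    push_cast
    ring
  -- The framing is shifted first and then bounded by a disc, which inherits the shifted correction
  -- term.
  · obtain ⟨ψ, hψ, hτ⟩ := φ.exists_even_shift (φ.nullhomotopic_iff.1 h) k
    obtain ⟨β, hβ⟩ := ψ.exists_swaddling hψ
    refine ⟨β, ?_⟩
    rw [hβ.tau_eq, hτ]
    ring
  · obtain ⟨ψ, hψ, hτ⟩ := β.exists_even_framing
    obtain ⟨φ, hφ, hτ'⟩ := ψ.exists_even_shift hψ (-k)
    refine ⟨φ, φ.nullhomotopic_iff.2 hφ, ?_⟩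
    rw [hτ', hτ]
    push_cast
    ring
  · exact ⟨fun h => ⟨h.nullhomotopic, h.tau_eq⟩, fun h => Swaddling.liftsTo_of_tau_eq h.2⟩
  · obtain ⟨m, hm, hodd⟩ := hγ.gaussIntegral_eq_tau φ
    refine ⟨-m, ?_, by rw [φ.nullhomotopic_iff, hodd, odd_neg]⟩
    rw [φ.extendedGaussDegree_eq, hm]
    push_cast
    field_simp
    ring
  · obtain ⟨φ, hφ, hτ⟩ := β.exists_even_framing
    obtain ⟨m, hm, hodd⟩ := hγ.gaussIntegral_eq_tau φ
    refine ⟨-m, ?_, by rw [odd_neg]; exact hodd.1 hφ⟩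
    rw [β.extendedGaussDegree_eq, hm, hτ]
    push_cast
    field_simp
    ring
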